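/- Let $\Omega\subset\mathbb{R}^2$, let $f,u:\Omega\to\mathbb{R}$ be smooth, and let $x_0$ be an interior point of $\Omega$ with $\nabla u(x_0)\neq 0$. Put $\nu(z)=\sqrt{1+z^2}$ and $g(z)=1/(1+z^2)$. The Euclidean amoeba distance of $x,y\in\Omega$ is $$d(x,y)=\inf_c\int_0^1\sqrt{\|c'(t)\|^2+|(f\circ c)'(t)|^2}\,\mathrm{d}t ,$$ the infimum being over all regular $C^1$ curves $c:[0,1]\to\Omega$ from $x$ to $y$; the amoeba is $\mathcal{A}_\varrho=\{x\in\Omega : d(x_0,x)\le\varrho\}$, and $p=p_\varrho$ denotes its area. For $0<k<p$ the value of $u$ at rank $k$ in $\mathcal{A}_\varrho$ is the least $m$ such that $\{x\in\mathcal{A}_\varrho : u(x)\le m\}$ has area at least $k$. Let $M_\varrho(B)$ be the value at rank $p/2+B$; thus $M_\varrho(0)$ is the median of $u$, and $M_\varrho(B)$ is one step at $x_0$ of the amoeba active contour filter biased by $B$. All derivatives below are taken at $x_0$. Let $\eta=\nabla u/|\nabla u|$, $\chi=\nabla f/|\nabla f|$ (any unit vector if $\nabla f=0$), let $\zeta$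 and $\xi$ be $\chi$ and $\eta$ rotated by $\pi/2$, and let $\alpha$ be the angle from $\chi$ to $\eta$, i.e. $\eta=\cos\alpha\,\chi+\sin\alpha\,\zeta$. Let $$\mathcal{L}=\frac{u_{\xi\xi}}{\nu(|\nabla f|\sin\alpha)^2}-|\nabla u|\bigl(H_1f_{\chi\chi}+2H_2f_{\chi\zeta}+H_3f_{\zeta\zeta}\bigr),$$ $$\begin{pmatrix}H_1&H_2\\H_2&H_3\end{pmatrix}=\tfrac32\,\nu(|\nabla f|\sin\alpha)\int_{\alpha-\pi/2}^{\alpha+\pi/2}\frac{\nu'(|\nabla f|\cos\vartheta)}{\nu(|\nabla f|\cos\vartheta)^4}\begin{pmatrix}\cos^2\vartheta&\sin\vartheta\cos\vartheta\\ \sin\vartheta\cos\vartheta&\sin^2\vartheta\end{pmatrix}\mathrm{d}\vartheta$$ be the right-hand side of the amoeba active contour equation. Say that the bias $B(\varrho)$ *approximates the force term* $\gamma(\varrho)F$ if, as $\varrho\to0^+$ and with $\tau=\varrho^2/6$, * eventually $0<p/2+B<p$, and $\{x\in\mathcal{A}_\varrho: u(x)\le M_\varrho(B)\}$ has area exactly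 $p/2+B$; * $M_\varrho(B)-M_\varrho(0)=\tau\,\gamma(\varrho)F+o(\tau\,\gamma(\varrho))$; * whenever $\gamma(\varrho)\to\gamma_0\in\mathbb{R}$, then $M_\varrho(B)=u(x_0)+\tau\,(\mathcal{L}+\gamma_0F)+o(\tau)$, so that a step of the filter approximates an explicit time step of size $\tau$ of $u_t=\mathcal{L}+\gamma_0F$. Then the following hold. 1. **Fixed offset bias** (rank $p/2+b$). If $b=b(\varrho)=o(\varrho^2)$, then $B=b$ approximates the force term $\gamma_bF_b$ with $F_b=|\nabla u|\,\nu(|\nabla f|\sin\alpha)$ and $\gamma_b=3b/\varrho^3$. 2. **Quantile bias** (rank $p/2+qp$). If $q=q(\varrho)\to0$, then $B=qp$ approximates the force term $\gamma_qF_q$ with $$F_q=|\nabla u|\sqrt{\frac{1+|\nabla f|^2\sin^2\alpha}{1+|\nabla f|^2}},\qquad \gamma_q=\frac{3\pi q}{\varrho}.$$ Moreover, for every $q\in(-\frac12,\frac12)$ independent of $\varrho$, for all sufficiently small $\varrho>0$ the rank $p/2+qp$ is proper and attained exactly as in the first item above, and $M_\varrho(qp)=u(x_0)+\varrho\,C(q)F_q+o(\varrho)$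 as $\varrho\to0^+$, where $C(q)$ is the number $c$ for which the part of the unit disk with first coordinate at most $c$ has area $(\frac12+q)\pi$; and $C(q)/q\to\pi/2$ as $q\to0$. 3. **Quadratic bias** (rank $p/2+rp^2$). If $r=r(\varrho)$ satisfies $r\varrho^2\to0$ (for instance, if $r$ is constant), then $B=rp^2$ approximates the force term $\gamma_rF_r$ with $F_r=|\nabla u|\,\nu(|\nabla f|\sin\alpha)/\nu(|\nabla f|)^2$ and $\gamma_r=3\pi^2\varrho r$. 4. **Rotationally symmetric case.** If $f$ and $u$ depend on $\Omega$ only on the distance from a common centre, then $F_b=|\nabla u|$ (constant weight), $g(|\nabla f|)\,|\nabla u|\le F_q\le|\nabla u|$ (the weight lies between the constant weight and the $g$-weight), and $F_r=g(|\nabla f|)\,|\nabla u|$ (the $g$-weighted force). -/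

import Mathlib

open MeasureTheory Set Filter Topology
open scoped ContDiff ENNReal Asymptotics

noncomputable section

namespace Amoeba

/-- The image plane with its Euclidean norm. -/
abbrev Plane : Type := EuclideanSpace ℝ (Fin 2)

/-- The function `ν` of the Euclidean amoeba metric (contrast scale `β = 1`). -/
def nu (z : ℝ) : ℝ := Real.sqrt (1 + z ^ 2)

/-- The edge-stopping function belonging to the Euclidean amoeba metric (Perona-Malik). -/
def edgeStop (z : ℝ) : ℝ := 1 / (1 + z ^ 2)

/-- `c` restricted to `[0,1]` is a regular curve in `Ω` from `p` to `q`. -/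
structure IsRegularCurve (Ω : Set Plane) (p q : Plane) (c : ℝ → Plane) : Prop where
  contDiffOn : ContDiffOn ℝ 1 c (Icc 0 1)
  regular : ∀ t ∈ Icc (0 : ℝ) 1, derivWithin c (Icc 0 1) t ≠ 0
  mapsTo : MapsTo c (Icc 0 1) Ω
  source : c 0 = p
  target : c 1 = q

/-- Length of `c : [0,1] → Ω` in the Euclidean amoeba metric of the image `f`:
the integral of `√(‖c'‖² + |(f ∘ c)'|²)`. -/
def curveLength (f : Plane → ℝ) (c : ℝ → Plane) : ℝ≥0∞ :=
  ∫⁻ t in Icc (0 : ℝ) 1, ENNReal.ofReal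
    (Real.sqrt (‖derivWithin c (Icc 0 1) t‖ ^ 2 + |derivWithin (f ∘ c) (Icc 0 1) t| ^ 2))

/-- Euclidean amoeba distance on `Ω` induced by `f` (`∞` if no regular curve joins the points). -/
def amoebaDist (Ω : Set Plane) (f : Plane → ℝ) (p q : Plane) : ℝ≥0∞ :=
  ⨅ (c : ℝ → Plane) (_ : IsRegularCurve Ω p q c), curveLength f c

/-- The amoeba: the ball of radius `ρ` about `x₀` in the amoeba distance. -/
def amoeba (Ω : Set Plane) (f : Plane → ℝ) (x₀ : Plane) (ρ : ℝ) : Set Plane :=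
  {x | x ∈ Ω ∧ amoebaDist Ω f x₀ x ≤ ENNReal.ofReal ρ}

/-- Two-dimensional Lebesgue measure as a real number. -/
def area (S : Set Plane) : ℝ := volume.real S

/-- The value at rank `k` in the (ascending) order of the values of `u` on `A`,
where ranks are measured by area: the least `m` such that `u ≤ m` on a part of `A`
of area at least `k`. -/
def rankValue (A : Set Plane) (u : Plane → ℝ) (k : ℝ) : ℝ :=
  sInf {m : ℝ | k ≤ area {x | x ∈ A ∧ u x ≤ m}}

/-- `k` is a proper rank for `A`, and the value at rank `k` cuts off exactly the area `k`. -/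
def RankAttained (A : Set Plane) (u : Plane → ℝ) (k : ℝ) : Prop :=
  0 < k ∧ k < area A ∧ area {x | x ∈ A ∧ u x ≤ rankValue A u k} = k

/-- The rank `p / 2 + bias p` that a biased median selects in the amoeba, `p` being its area. -/
def biasedRank (Ω : Set Plane) (f : Plane → ℝ) (x₀ : Plane) (ρ : ℝ) (bias : ℝ → ℝ) : ℝ :=
  area (amoeba Ω f x₀ ρ) / 2 + bias (area (amoeba Ω f x₀ ρ))

/-- One step at `x₀` of the biased amoeba active contour filter on the level-set function `u`,
with amoebas of radius `ρ` generated by the image `f`. -/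
def biasedStep (Ω : Set Plane) (f u : Plane → ℝ) (x₀ : Plane) (ρ : ℝ) (bias : ℝ → ℝ) : ℝ :=
  rankValue (amoeba Ω f x₀ ρ) u (biasedRank Ω f x₀ ρ bias)

/-- The unbiased step: the median of `u` on the amoeba. -/
def medianStep (Ω : Set Plane) (f u : Plane → ℝ) (x₀ : Plane) (ρ : ℝ) : ℝ :=
  rankValue (amoeba Ω f x₀ ρ) u (area (amoeba Ω f x₀ ρ) / 2)

/-- Rotation by a right angle. -/
def rot (v : Plane) : Plane := !₂[-(v 1), v 0]

/-- The unit vector at angle `θ` from the unit vector `χ`. -/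
def dir (χ : Plane) (θ : ℝ) : Plane := Real.cos θ • χ + Real.sin θ • rot χ

/-- Second directional derivative `h_{vw}` at `x`. -/
def d2 (h : Plane → ℝ) (x v w : Plane) : ℝ := fderiv ℝ (fderiv ℝ h) x v w

/-- `(3/2) ν(s sin α) ∫ ν'(s cos θ) / ν(s cos θ)⁴ · k(θ) dθ` over `[α - π/2, α + π/2]`. -/
def hCoeff (s α : ℝ) (k : ℝ → ℝ) : ℝ :=
  3 / 2 * nu (s * Real.sin α) *
    ∫ θ in (α - Real.pi / 2)..(α + Real.pi / 2),
      deriv nu (s * Real.cos θ) / nu (s * Real.cos θ) ^ 4 * k θ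

/-- Right-hand side at `x` of the amoeba active contour equation
`u_t = G u_{ξξ} - |∇u| (H₁ f_{χχ} + 2 H₂ f_{χζ} + H₃ f_{ζζ})`. Here `χ` is the unit vector in
the direction of `∇f`, `ζ ⟂ χ`, and `α` is the angle from `χ` to `η = ∇u / |∇u|`, `ξ ⟂ η`. -/
def contourRHS (f u : Plane → ℝ) (x χ : Plane) (α : ℝ) : ℝ :=
  1 / nu (‖gradient f x‖ * Real.sin α) ^ 2 * d2 u x (rot (dir χ α)) (rot (dir χ α))
    - ‖gradient u x‖ *
      (hCoeff ‖gradient f x‖ α (fun θ => Real.cos θ ^ 2) * d2 f x χ χ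
        + 2 * hCoeff ‖gradient f x‖ α (fun θ => Real.sin θ * Real.cos θ) * d2 f x χ (rot χ)
        + hCoeff ‖gradient f x‖ α (fun θ => Real.sin θ ^ 2) * d2 f x (rot χ) (rot χ))

/-- Force belonging to a fixed offset bias; `a = |∇u|`, `s = |∇f|`. -/
def offsetForce (a s α : ℝ) : ℝ := a * nu (s * Real.sin α)

/-- Force belonging to a quantile bias; `a = |∇u|`, `s = |∇f|`. -/
def quantileForce (a s α : ℝ) : ℝ :=
  a * Real.sqrt ((1 + s ^ 2 * Real.sin α ^ 2) / (1 + s ^ 2))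

/-- Force belonging to a quadratic bias; `a = |∇u|`, `s = |∇f|`. -/
def quadraticForce (a s α : ℝ) : ℝ := a * (nu (s * Real.sin α) / nu s ^ 2)

/-- The biased steps (with a bias that may depend on `ρ`) produce the force term `γ(ρ) F` in the
amoeba active contour equation as `ρ → 0+`, the time step being `τ = ρ² / 6`:
the rank in question is a proper one; compared to the unbiased step, the bias contributes
`τ γ(ρ) F` up to a relative error that tends to zero; and if `γ(ρ) → γ₀`, one step is, up to
`o(τ)`, an explicit time step of size `τ` of `u_t = contourRHS + γ₀ F`. -/
def ApproximatesForce (Ω : Set Plane) (f u : Plane → ℝ) (x₀ χ : Plane) (α : ℝ)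
    (bias : ℝ → ℝ → ℝ) (γ : ℝ → ℝ) (F : ℝ) : Prop :=
  (∀ᶠ ρ in 𝓝[>] (0 : ℝ),
    RankAttained (amoeba Ω f x₀ ρ) u (biasedRank Ω f x₀ ρ (bias ρ))) ∧
  ((fun ρ : ℝ => biasedStep Ω f u x₀ ρ (bias ρ) - medianStep Ω f u x₀ ρ
      - ρ ^ 2 / 6 * (γ ρ * F)) =o[𝓝[>] (0 : ℝ)] fun ρ : ℝ => ρ ^ 2 / 6 * γ ρ) ∧
  (∀ γ₀ : ℝ, Tendsto γ (𝓝[>] (0 : ℝ)) (𝓝 γ₀) →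
    Tendsto (fun ρ : ℝ => (biasedStep Ω f u x₀ ρ (bias ρ) - u x₀) / (ρ ^ 2 / 6))
      (𝓝[>] (0 : ℝ)) (𝓝 (contourRHS f u x₀ χ α + γ₀ * F)))

/-- Signed distance from the centre of the chord of the unit disk that cuts off
the fraction `1/2 + q` of its area. -/
def diskOffset (q : ℝ) : ℝ :=
  rankValue (Metric.closedBall (0 : Plane) 1) (fun x => x 0) (Real.pi / 2 + q * Real.pi)

/-- On `Ω`, the function `h` depends only on the distance from `z`. -/
def RotSymmetricAbout (Ω : Set Plane) (z : Plane) (h : Plane → ℝ) : Prop :=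
  ∀ x ∈ Ω, ∀ y ∈ Ω, dist x z = dist y z → h x = h y

end Amoeba

end

/-! Blow up the picture at `x₀` by `1/ρ` in the frame `(η, ξ)`, with coordinates `(y, z)` corrected
by the parabola `y ↦ y - ρ k z² / 2`, `k = u_ξξ / |∇u|`. The correction straightens the level line
of `u` through `x₀`. The rescaled image `U = (u - u(x₀)) / ρ` then has slope `a + O(ρ)` in `y`,
where `a = |∇u|`, and is `O(ρ²)` on `y = 0`. The amoeba distance exceeds the chord of the graph of
`f` by at most a third-order term, so the rescaled amoeba is `{N² + ρ T ≤ 1 + O(ρ²)}`. Here `N² =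
|w|² + (b · w)²`, with `b = (s cos α, -s sin α)` the gradient of `f` in the frame and `s = |∇f|`.
The cubic form `T` carries the Hessian of `f` and the curvature `k`. `exists_localModel` provides
this; all later asymptotics use only `LocalModel`.

Three area computations then suffice. To zeroth order the amoeba is an ellipse of area `π / ν(s)`,
which a linear map preserving the lines `y = const` sends to the unit disc (`volume_quadN_le`). Near
level zero, a strip of height `dt` has area about `2 dt / (a ν(b₂))`, the length of the central
chord divided by the slope (`exists_strip_estimate`). Finally, since `T` is odd, the two halves of
the amoeba differ in area by `ρ ∫ T / N⁵ + O(ρ²)` (`exists_median_estimate`).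

Dividing the asymmetry by the density gives the median. Its value is `τ` times the right-hand side
of the contour equation, by an explicit antiderivative for the curvature part and the substitution
`θ = φ + α` for the Hessian part (`contourRHS_eq`). A bias `B` moves the rescaled area by `B / ρ²`,
hence the value by `ρ · (a ν(b₂) / 2) · B / ρ² = τ · (3B / ρ³) · a ν(s sin α)` to leading order. The
three laws follow on inserting `p ≈ π ρ² / ν(s)` (`Rescaled.approximatesForce`). For fixed `q` the
shift is not small, and the comparison is made with the area function of the disc itself. In the
rotationally symmetric case both gradients are radial, so `s sin α = 0`. -/

noncomputable section

namespace Amoeba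

/-! ### Local models and areas between level lines -/

/-- The square in which the rescaled amoebas are studied. -/
def box : Set (ℝ × ℝ) := {w | |w.1| ≤ 2 ∧ |w.2| ≤ 2}

/-- Squared norm of the metric `I + b bᵀ`. -/
def quadN (b₁ b₂ : ℝ) (w : ℝ × ℝ) : ℝ := w.1 ^ 2 + w.2 ^ 2 + (b₁ * w.1 + b₂ * w.2) ^ 2

/-- A rescaled amoeba `A` of radius `ρ` and a rescaled image `U`, in coordinates in which `U` is
`a y` up to small errors and `A` is `{quadN + ρ T ≤ 1}` up to an error of order `ρ ^ 2`. -/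
structure LocalModel (a b₁ b₂ : ℝ) (T : ℝ × ℝ → ℝ) (C ρ : ℝ) (A : Set (ℝ × ℝ))
    (U : ℝ × ℝ → ℝ) : Prop where
  subset : A ⊆ box
  upper : ∀ w ∈ A, quadN b₁ b₂ w + ρ * T w ≤ 1 + C * ρ ^ 2
  lower : ∀ w ∈ box, w ≠ 0 → quadN b₁ b₂ w + ρ * T w ≤ 1 - C * ρ ^ 2 → w ∈ A
  cont : ContinuousOn U box
  incr : ∀ y₁ y₂ z, (y₁, z) ∈ box → (y₂, z) ∈ box →
    |U (y₂, z) - U (y₁, z) - a * (y₂ - y₁)| ≤ C * ρ * |y₂ - y₁|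
  base : ∀ z, |z| ≤ 2 → |U (0, z)| ≤ C * ρ ^ 2

/-- The area of the part of `A` on which `U ≤ t`. -/
def subArea (A : Set (ℝ × ℝ)) (U : ℝ × ℝ → ℝ) (t : ℝ) : ℝ := volume.real {w | w ∈ A ∧ U w ≤ t}

lemma isClosed_box : IsClosed box := by
  have h1 : IsClosed {w : ℝ × ℝ | |w.1| ≤ 2} := isClosed_le (by fun_prop) (by fun_prop)
  have h2 : IsClosed {w : ℝ × ℝ | |w.2| ≤ 2} := isClosed_le (by fun_prop) (by fun_prop)
  exact h1.inter h2

lemma box_eq : box = Icc (-2 : ℝ) 2 ×ˢ Icc (-2 : ℝ) 2 := by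
  ext w; simp only [box, mem_ofPred_eq, abs_le, mem_prod, mem_Icc]

lemma volume_lt_top_of_subset_box {S : Set (ℝ × ℝ)} (h : S ⊆ box) : volume S < ⊤ := by
  refine (measure_mono h).trans_lt ?_
  rw [box_eq]
  exact (isCompact_Icc.prod isCompact_Icc).measure_lt_top

namespace LocalModel

variable {a b₁ b₂ C ρ : ℝ} {T : ℝ × ℝ → ℝ} {A : Set (ℝ × ℝ)} {U : ℝ × ℝ → ℝ}

lemma measurableSet_le (h : LocalModel a b₁ b₂ T C ρ A U) (t : ℝ) :
    MeasurableSet (box ∩ {w | U w ≤ t}) :=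
  (h.cont.preimage_isClosed_of_isClosed isClosed_box isClosed_Iic).measurableSet

/-- The set `A` is not assumed measurable. Only the sublevel sets of `U` in the box are, and
splitting an arbitrary set along a measurable one is enough. -/
lemma subArea_sub (h : LocalModel a b₁ b₂ T C ρ A U) {t₁ t₂ : ℝ} (ht : t₁ ≤ t₂) :
    subArea A U t₂ - subArea A U t₁ = volume.real {w | w ∈ A ∧ t₁ < U w ∧ U w ≤ t₂} := by
  have hf : volume {w | w ∈ A ∧ U w ≤ t₂} ≠ ⊤ :=
    (volume_lt_top_of_subset_box fun w hw => h.subset hw.1).ne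
  have := measureReal_inter_add_sdiff (μ := volume) (s := {w | w ∈ A ∧ U w ≤ t₂})
    (h.measurableSet_le t₁) hf
  have e1 : {w | w ∈ A ∧ U w ≤ t₂} ∩ (box ∩ {w | U w ≤ t₁}) = {w | w ∈ A ∧ U w ≤ t₁} := by
    ext w
    constructor
    · rintro ⟨⟨h1, _⟩, _, h3⟩; exact ⟨h1, h3⟩
    · rintro ⟨h1, h2⟩; exact ⟨⟨h1, le_trans h2 ht⟩, h.subset h1, h2⟩
  have e2 : {w | w ∈ A ∧ U w ≤ t₂} \ (box ∩ {w | U w ≤ t₁}) =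
      {w | w ∈ A ∧ t₁ < U w ∧ U w ≤ t₂} := by
    ext w
    constructor
    · rintro ⟨⟨h1, h2⟩, h3⟩
      exact ⟨h1, lt_of_not_ge fun h4 => h3 ⟨h.subset h1, h4⟩, h2⟩
    · rintro ⟨h1, h2, h3⟩; exact ⟨⟨h1, h3⟩, fun h4 => absurd h4.2 (not_le.2 h2)⟩
  rw [e1, e2] at this
  unfold subArea
  linarith

lemma area_sub_subArea (h : LocalModel a b₁ b₂ T C ρ A U) (t : ℝ) :
    volume.real A - subArea A U t = volume.real {w | w ∈ A ∧ t < U w} := by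
  have hf : volume A ≠ ⊤ := (volume_lt_top_of_subset_box h.subset).ne
  have := measureReal_inter_add_sdiff (μ := volume) (s := A) (h.measurableSet_le t) hf
  have e1 : A ∩ (box ∩ {w | U w ≤ t}) = {w | w ∈ A ∧ U w ≤ t} := by
    ext w
    exact ⟨fun hw => ⟨hw.1, hw.2.2⟩, fun hw => ⟨hw.1, h.subset hw.1, hw.2⟩⟩
  have e2 : A \ (box ∩ {w | U w ≤ t}) = {w | w ∈ A ∧ t < U w} := by
    ext w
    exact ⟨fun hw => ⟨hw.1, lt_of_not_ge fun h4 => hw.2 ⟨h.subset hw.1, h4⟩⟩,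
      fun hw => ⟨hw.1, fun h4 => absurd h4.2 (not_le.2 hw.2)⟩⟩
  rw [e1, e2] at this
  unfold subArea
  linarith

lemma monotone_subArea (h : LocalModel a b₁ b₂ T C ρ A U) : Monotone (subArea A U) :=
  fun t₁ t₂ ht => by
    have := h.subArea_sub ht
    have h2 : 0 ≤ volume.real {w | w ∈ A ∧ t₁ < U w ∧ U w ≤ t₂} := measureReal_nonneg
    linarith

lemma measurableSet_strip (h : LocalModel a b₁ b₂ T C ρ A U) {Y Z : ℝ} (hY : Y ≤ 2) (hZ : Z ≤ 2)
    (t₁ t₂ : ℝ) :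
    MeasurableSet {w : ℝ × ℝ | |w.1| ≤ Y ∧ |w.2| ≤ Z ∧ t₁ < U w ∧ U w ≤ t₂} := by
  have h1 : MeasurableSet {w : ℝ × ℝ | |w.1| ≤ Y} :=
    (isClosed_le (by fun_prop) (by fun_prop)).measurableSet
  have h2 : MeasurableSet {w : ℝ × ℝ | |w.2| ≤ Z} :=
    (isClosed_le (by fun_prop) (by fun_prop)).measurableSet
  convert (h1.inter h2).inter ((h.measurableSet_le t₂).diff (h.measurableSet_le t₁)) using 1
  ext w
  constructor
  · rintro ⟨h1, h2, h3, h4⟩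
    exact ⟨⟨h1, h2⟩, ⟨⟨h1.trans hY, h2.trans hZ⟩, h4⟩, fun h5 => absurd h5.2 (not_le.2 h3)⟩
  · rintro ⟨⟨h1, h2⟩, ⟨h3, h4⟩, h5⟩
    exact ⟨h1, h2, lt_of_not_ge fun h6 => h5 ⟨h3, h6⟩, h4⟩

/-- Fubini over `z`: along each horizontal line `U` grows at rate at least `a - C ρ`, so a slice of
the strip has diameter at most `(t₂ - t₁) / (a - C ρ)`. -/
lemma volume_strip_le (h : LocalModel a b₁ b₂ T C ρ A U) (hρ : C * ρ < a) {Z : ℝ} (hZ : Z ≤ 2)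
    {t₁ t₂ : ℝ} (ht : t₁ ≤ t₂) :
    volume {w : ℝ × ℝ | |w.1| ≤ 2 ∧ |w.2| ≤ Z ∧ t₁ < U w ∧ U w ≤ t₂}
      ≤ ENNReal.ofReal (2 * Z / (a - C * ρ) * (t₂ - t₁)) := by
  have hpos : 0 < a - C * ρ := by linarith
  rw [Measure.volume_eq_prod, Measure.prod_apply_symm (h.measurableSet_strip le_rfl hZ t₁ t₂)]
  have key : ∀ z : ℝ, volume ((fun y : ℝ => (y, z)) ⁻¹'
      {w : ℝ × ℝ | |w.1| ≤ 2 ∧ |w.2| ≤ Z ∧ t₁ < U w ∧ U w ≤ t₂})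
      ≤ (Icc (-Z) Z).indicator (fun _ => ENNReal.ofReal ((t₂ - t₁) / (a - C * ρ))) z := by
    intro z
    by_cases hz : |z| ≤ Z
    · rw [indicator_of_mem (by simpa [abs_le] using hz)]
      refine (Real.volume_le_diam _).trans ?_
      refine Metric.ediam_le fun y₁ hy₁ y₂ hy₂ => ?_
      rw [edist_dist]
      refine ENNReal.ofReal_le_ofReal ?_
      rw [le_div_iff₀ hpos, Real.dist_eq]
      simp only [mem_preimage, mem_ofPred_eq] at hy₁ hy₂
      have hi := abs_le.1 (h.incr y₂ y₁ z ⟨hy₂.1, hz.trans hZ⟩ ⟨hy₁.1, hz.trans hZ⟩)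
      rcases le_total y₁ y₂ with h12 | h12
      · rw [abs_of_nonpos (by linarith)] at hi ⊢
        nlinarith [hi.1, hi.2]
      · rw [abs_of_nonneg (by linarith)] at hi ⊢
        nlinarith [hi.1, hi.2]
    · have : ((fun y : ℝ => (y, z)) ⁻¹'
        {w : ℝ × ℝ | |w.1| ≤ 2 ∧ |w.2| ≤ Z ∧ t₁ < U w ∧ U w ≤ t₂}) = ∅ := by
        ext y; simp only [mem_preimage, mem_ofPred_eq, mem_empty_iff_false, iff_false]
        exact fun h' => hz h'.2.1
      rw [this]; simp
  refine (lintegral_mono key).trans ?_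
  rw [lintegral_indicator measurableSet_Icc, setLIntegral_const, Real.volume_Icc,
    ← ENNReal.ofReal_mul (div_nonneg (by linarith) hpos.le)]
  refine ENNReal.ofReal_le_ofReal (le_of_eq ?_)
  field_simp; ring

/-- Fubini again, now with slopes at most `a + C ρ`. The bounds on `|t₁|` and `|t₂|` make both
levels be attained with `|y| ≤ Y` on every horizontal line, by the intermediate value theorem, so
each slice contains a full interval. -/
lemma le_volume_strip (h : LocalModel a b₁ b₂ T C ρ A U) (hρ : C * ρ < a) (hρ0 : 0 ≤ C * ρ)
    {Y Z : ℝ} (hY0 : 0 ≤ Y) (hY : Y ≤ 2) (hZ : Z ≤ 2) {t₁ t₂ : ℝ} (ht : t₁ ≤ t₂)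
    (h1 : |t₁| ≤ (a - C * ρ) * Y - C * ρ ^ 2) (h2 : |t₂| ≤ (a - C * ρ) * Y - C * ρ ^ 2) :
    ENNReal.ofReal (2 * Z / (a + C * ρ) * (t₂ - t₁)) ≤
      volume {w : ℝ × ℝ | |w.1| ≤ Y ∧ |w.2| ≤ Z ∧ t₁ < U w ∧ U w ≤ t₂} := by
  have hpos : 0 < a + C * ρ := by linarith
  rw [Measure.volume_eq_prod, Measure.prod_apply_symm (h.measurableSet_strip hY hZ t₁ t₂)]
  have key : ∀ z : ℝ, (Icc (-Z) Z).indicator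
      (fun _ => ENNReal.ofReal ((t₂ - t₁) / (a + C * ρ))) z ≤
      volume ((fun y : ℝ => (y, z)) ⁻¹'
        {w : ℝ × ℝ | |w.1| ≤ Y ∧ |w.2| ≤ Z ∧ t₁ < U w ∧ U w ≤ t₂}) := by
    intro z
    by_cases hz : z ∈ Icc (-Z) Z
    swap
    · rw [indicator_of_notMem hz]; exact zero_le
    rw [indicator_of_mem hz]
    have hz' : |z| ≤ Z := abs_le.2 hz
    have hz2 : |z| ≤ 2 := hz'.trans hZ
    have hb := abs_le.1 (h.base z hz2)
    have hin : ∀ y ∈ Icc (-Y) Y, (y, z) ∈ box := fun y hy => ⟨(abs_le.2 hy).trans hY, hz2⟩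
    have h0 : (0 : ℝ) ∈ Icc (-Y) Y := ⟨by linarith, hY0⟩
    have hcont : ContinuousOn (fun y => U (y, z)) (Icc (-Y) Y) :=
      h.cont.comp (by fun_prop) fun y hy => hin y hy
    have hU1 : (a - C * ρ) * Y - C * ρ ^ 2 ≤ U (Y, z) := by
      have := abs_le.1 (h.incr 0 Y z (hin _ h0) (hin _ ⟨by linarith, le_rfl⟩))
      rw [sub_zero, abs_of_nonneg hY0] at this
      linarith [this.1]
    have hU2 : U (-Y, z) ≤ -((a - C * ρ) * Y - C * ρ ^ 2) := by
      have := abs_le.1 (h.incr 0 (-Y) z (hin _ h0) (hin _ ⟨le_rfl, by linarith⟩))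
      rw [sub_zero, abs_neg, abs_of_nonneg hY0] at this
      linarith [this.2]
    have ivt : ∀ t, |t| ≤ (a - C * ρ) * Y - C * ρ ^ 2 → ∃ y ∈ Icc (-Y) Y, U (y, z) = t := by
      intro t ht
      have := intermediate_value_Icc (by linarith : -Y ≤ Y) hcont
      exact this ⟨by linarith [(abs_le.1 ht).1], by linarith [(abs_le.1 ht).2]⟩
    obtain ⟨y₁, hy₁, e1⟩ := ivt t₁ h1
    obtain ⟨y₂, hy₂, e2⟩ := ivt t₂ h2
    have hlt : ∀ y ∈ Icc (-Y) Y, ∀ y' ∈ Icc (-Y) Y, y < y' →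
        (a - C * ρ) * (y' - y) ≤ U (y', z) - U (y, z) ∧
        U (y', z) - U (y, z) ≤ (a + C * ρ) * (y' - y) := by
      intro y hy y' hy' hyy
      have := abs_le.1 (h.incr y y' z (hin _ hy) (hin _ hy'))
      rw [abs_of_pos (by linarith)] at this
      constructor <;> linarith [this.1, this.2]
    have hsub : Ioc y₁ y₂ ⊆ (fun y : ℝ => (y, z)) ⁻¹'
        {w : ℝ × ℝ | |w.1| ≤ Y ∧ |w.2| ≤ Z ∧ t₁ < U w ∧ U w ≤ t₂} := by
      intro y hy
      have hyI : y ∈ Icc (-Y) Y := ⟨by linarith [hy₁.1, hy.1], hy.2.trans hy₂.2⟩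
      refine ⟨abs_le.2 hyI, hz', ?_, ?_⟩
      · have := (hlt y₁ hy₁ y hyI hy.1).1
        rw [← e1]
        nlinarith [mul_pos (sub_pos.2 hρ) (sub_pos.2 hy.1)]
      · rcases hy.2.eq_or_lt with h' | h'
        · rw [h', e2]
        · have := (hlt y hyI y₂ hy₂ h').1
          rw [← e2]
          nlinarith [mul_pos (sub_pos.2 hρ) (sub_pos.2 h')]
    refine le_trans ?_ (measure_mono hsub)
    rw [Real.volume_Ioc]
    refine ENNReal.ofReal_le_ofReal ?_
    rw [div_le_iff₀ hpos]
    rcases lt_trichotomy y₁ y₂ with h' | h' | h'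
    · linarith [(hlt y₁ hy₁ y₂ hy₂ h').2]
    · rw [← e1, ← e2, h']; simp
    · have := (hlt y₂ hy₂ y₁ hy₁ h').1
      nlinarith [mul_pos (sub_pos.2 hρ) (sub_pos.2 h')]
  refine le_trans ?_ (lintegral_mono key)
  rw [lintegral_indicator measurableSet_Icc, setLIntegral_const, Real.volume_Icc,
    ← ENNReal.ofReal_mul (div_nonneg (by linarith) hpos.le)]
  refine ENNReal.ofReal_le_ofReal (le_of_eq ?_)
  field_simp; ring

lemma subArea_sub_le (h : LocalModel a b₁ b₂ T C ρ A U) (hρ : C * ρ < a) {t₁ t₂ : ℝ}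
    (ht : t₁ ≤ t₂) :
    subArea A U t₂ - subArea A U t₁ ≤ 4 / (a - C * ρ) * (t₂ - t₁) := by
  rw [h.subArea_sub ht]
  have hpos : 0 < a - C * ρ := by linarith
  refine ENNReal.toReal_le_of_le_ofReal
    (mul_nonneg (div_nonneg (by norm_num) hpos.le) (by linarith)) ?_
  have := h.volume_strip_le hρ le_rfl ht
  refine le_trans (measure_mono ?_) (this.trans_eq (by norm_num))
  rintro w ⟨h1, h2, h3⟩
  exact ⟨(h.subset h1).1, (h.subset h1).2, h2, h3⟩

lemma continuous_subArea (h : LocalModel a b₁ b₂ T C ρ A U) (hρ : C * ρ < a) :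
    Continuous (subArea A U) := by
  have hpos : 0 < a - C * ρ := by linarith
  have : LipschitzWith (Real.toNNReal (4 / (a - C * ρ))) (subArea A U) := by
    refine LipschitzWith.of_dist_le_mul fun t₁ t₂ => ?_
    rw [Real.coe_toNNReal _ (by positivity), Real.dist_eq, Real.dist_eq]
    rcases le_total t₁ t₂ with h' | h'
    · rw [abs_of_nonpos (by linarith [h.monotone_subArea h']), abs_of_nonpos (by linarith)]
      linarith [h.subArea_sub_le hρ h']
    · rw [abs_of_nonneg (by linarith [h.monotone_subArea h']), abs_of_nonneg (by linarith)]
      linarith [h.subArea_sub_le hρ h']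
  exact this.continuous

lemma abs_U_sub_le (h : LocalModel a b₁ b₂ T C ρ A U) {w : ℝ × ℝ} (hw : w ∈ box) :
    |U w - a * w.1| ≤ C * ρ * |w.1| + C * ρ ^ 2 := by
  have h1 := h.incr 0 w.1 w.2 ⟨by norm_num, hw.2⟩ hw
  have h2 := h.base w.2 hw.2
  rw [sub_zero] at h1
  have : U w - a * w.1 = (U (w.1, w.2) - U (0, w.2) - a * w.1) + U (0, w.2) := by
    simp only [Prod.mk.eta]; ring
  rw [this]
  exact (abs_add_le _ _).trans (add_le_add h1 h2)

end LocalModel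

/-! ### Area density at level zero -/

lemma nu_sq (z : ℝ) : nu z ^ 2 = 1 + z ^ 2 := Real.sq_sqrt (by positivity)

lemma one_le_nu (z : ℝ) : 1 ≤ nu z := Real.one_le_sqrt.2 (by nlinarith [sq_nonneg z])

lemma nu_pos (z : ℝ) : 0 < nu z := zero_lt_one.trans_le (one_le_nu z)

/-- On the line `y = 0` the metric reduces to `(ν(b₂) z)²`, so the central chord of the ellipse is
`|z| ≤ 1 / ν(b₂)`. The lemma bounds the error incurred off that line. -/
lemma abs_quadN_sub_le (b₁ b₂ : ℝ) {w : ℝ × ℝ} (hw : w ∈ box) :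
    |quadN b₁ b₂ w - (nu b₂ * w.2) ^ 2| ≤ (2 + |b₁| * (2 * |b₁| + 4 * |b₂|)) * |w.1| := by
  have e : quadN b₁ b₂ w - (nu b₂ * w.2) ^ 2 =
      (w.1 + b₁ * (b₁ * w.1 + 2 * b₂ * w.2)) * w.1 := by
    rw [mul_pow, nu_sq, quadN]; ring
  rw [e, abs_mul]
  refine mul_le_mul_of_nonneg_right ?_ (abs_nonneg _)
  refine (abs_add_le _ _).trans (add_le_add hw.1 ?_)
  rw [abs_mul]
  refine mul_le_mul_of_nonneg_left ?_ (abs_nonneg _)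
  refine (abs_add_le _ _).trans (add_le_add ?_ ?_)
  · rw [abs_mul]; nlinarith [hw.1, abs_nonneg b₁]
  · rw [abs_mul, abs_mul, abs_two]; nlinarith [hw.2, abs_nonneg b₂]

lemma volume_real_diff_zero (S : Set (ℝ × ℝ)) : volume.real (S \ {0}) = volume.real S := by
  rw [measureReal_def, measureReal_def, measure_sdiff_null (measure_singleton _)]

/-- The area of thin strips between level lines of `U` near the centre of the amoeba. -/
lemma exists_strip_estimate {a b₁ b₂ C M : ℝ} {T : ℝ × ℝ → ℝ} (ha : 0 < a) (hC : 0 ≤ C)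
    (hM : ∀ w ∈ box, |T w| ≤ M) {ε : ℝ} (hε : 0 < ε) :
    ∃ δ > 0, ∀ ρ A U, 0 < ρ → ρ < δ → LocalModel a b₁ b₂ T C ρ A U →
      ∀ t₁ t₂, |t₁| ≤ δ → |t₂| ≤ δ → t₁ ≤ t₂ →
        |subArea A U t₂ - subArea A U t₁ - 2 / (a * nu b₂) * (t₂ - t₁)| ≤ ε * (t₂ - t₁) := by
  have hν := one_le_nu b₂
  have hν0 := nu_pos b₂
  have hM0 : 0 ≤ M := (abs_nonneg _).trans (hM 0 (by simp [box]))
  -- With `s = C ρ`, the strip is enclosed between strips of half-length `1 / ν(b₂) ± η / 2` on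
  -- which `U` has slope between `a - s` and `a + s`. Continuity at `0` puts both area bounds within
  -- `ε` of `2 / (a ν(b₂))`.
  obtain ⟨η, hη, hηε⟩ : ∃ η > 0, η < a / 2 ∧ η ≤ 1 ∧ ∀ s, 0 ≤ s → s < η →
      2 * (1 / nu b₂ + η / 2) / (a - s) ≤ 2 / (a * nu b₂) + ε ∧
      2 / (a * nu b₂) - ε ≤ 2 * (1 / nu b₂ - η / 2) / (a + s) := by
    have c1 : ContinuousAt (fun x : ℝ => 2 * (1 / nu b₂ + x / 2) / (a - x)) 0 := by
      refine ContinuousAt.div (by fun_prop) (by fun_prop) (by simpa using ha.ne')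
    have c2 : ContinuousAt (fun x : ℝ => 2 * (1 / nu b₂ - x / 2) / (a + x)) 0 := by
      refine ContinuousAt.div (by fun_prop) (by fun_prop) (by simpa using ha.ne')
    have v1 : 2 * (1 / nu b₂ + (0 : ℝ) / 2) / (a - 0) = 2 / (a * nu b₂) := by
      simp only [zero_div, add_zero, sub_zero]; field_simp
    have v2 : 2 * (1 / nu b₂ - (0 : ℝ) / 2) / (a + 0) = 2 / (a * nu b₂) := by
      simp only [zero_div, add_zero, sub_zero]; field_simp
    have e1 := c1.eventually_lt (continuousAt_const (y := 2 / (a * nu b₂) + ε))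
      (by rw [v1]; linarith)
    have e2 := (continuousAt_const (y := 2 / (a * nu b₂) - ε)).eventually_lt c2
      (by rw [v2]; linarith)
    have e3 : ∀ᶠ x : ℝ in 𝓝 0, x < a / 2 := Iio_mem_nhds (by linarith)
    have e4 : ∀ᶠ x : ℝ in 𝓝 0, x < 1 / nu b₂ := Iio_mem_nhds (by positivity)
    have e5 : ∀ᶠ x : ℝ in 𝓝[>] 0, 0 < x := self_mem_nhdsWithin
    obtain ⟨η, ⟨⟨⟨h1, h2⟩, h3⟩, h4⟩, h5⟩ :=
      ((((e1.and e2).and e3).and e4).filter_mono nhdsWithin_le_nhds |>.and e5).exists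
    have h6 : 1 / nu b₂ ≤ 1 := by rw [div_le_one hν0]; exact hν
    refine ⟨η, h5, h3, by linarith, fun s hs0 hs => ⟨le_trans ?_ h1.le, h2.le.trans ?_⟩⟩
    · exact div_le_div_of_nonneg_left (by positivity) (by linarith) (by linarith)
    · exact div_le_div_of_nonneg_left (by nlinarith) (by linarith) (by linarith)
  obtain ⟨hηa, hη1, hηε⟩ := hηε
  set K : ℝ := 2 + |b₁| * (2 * |b₁| + 4 * |b₂|) with hK
  have hK0 : 0 < K := by positivity
  set e : ℝ := η / 2 with he
  have he0 : 0 < e := by positivity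
  obtain ⟨Y, hY0, hY1, hYe⟩ : ∃ Y > 0, Y ≤ 1 ∧ K * Y ≤ e / 2 := by
    refine ⟨min 1 (e / (2 * K)), by positivity, min_le_left _ _, ?_⟩
    calc K * min 1 (e / (2 * K)) ≤ K * (e / (2 * K)) :=
          mul_le_mul_of_nonneg_left (min_le_right _ _) hK0.le
      _ = e / 2 := by field_simp
  obtain ⟨δ, hδ0, hδ1, hδη, hδY⟩ : ∃ δ > 0, δ ≤ 1 ∧ δ * (1 + C + M) ≤ η / 4 ∧
      δ * (1 + C + M) ≤ a * Y / 2 := by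
    refine ⟨min 1 (min (η / 4) (a * Y / 2) / (1 + C + M)), by positivity, min_le_left _ _, ?_, ?_⟩
    all_goals
      have h1 := mul_le_mul_of_nonneg_right
        (min_le_right 1 (min (η / 4) (a * Y / 2) / (1 + C + M))) (by positivity : 0 ≤ 1 + C + M)
      rw [div_mul_cancel₀ _ (by positivity)] at h1
    · exact h1.trans (min_le_left _ _)
    · exact h1.trans (min_le_right _ _)
  refine ⟨δ, hδ0, fun ρ A U hρ0 hρ h t₁ t₂ ht1 ht2 ht => ?_⟩
  have hexp : δ * (1 + C + M) = δ + C * δ + M * δ := by ring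
  rw [hexp] at hδη hδY
  have hCδ : 0 ≤ C * δ := by positivity
  have hCρ0 : 0 ≤ C * ρ := by positivity
  have hCρδ : C * ρ ≤ C * δ := by gcongr
  have hMρ : M * ρ ≤ M * δ := by gcongr
  have hMδ : 0 ≤ M * δ := by positivity
  have hCρη : C * ρ < η := by linarith
  have hCρ2 : C * ρ ^ 2 ≤ C * δ := by
    have : C * ρ ^ 2 = C * ρ * ρ := by ring
    rw [this]; nlinarith
  have hCρ20 : 0 ≤ C * ρ ^ 2 := by positivity
  obtain ⟨hup, hlo⟩ := hηε (C * ρ) hCρ0 hCρη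
  have hT : ∀ w ∈ box, |ρ * T w| ≤ M * δ := fun w hw => by
    rw [abs_mul, abs_of_pos hρ0]; nlinarith [hM w hw, abs_nonneg (T w)]
  have hinv : nu b₂ * (1 / nu b₂) = 1 := by field_simp
  have hinv1 : 1 / nu b₂ ≤ 1 := by rw [div_le_one hν0]; exact hν
  rw [h.subArea_sub ht]
  have hsub1 : {w | w ∈ A ∧ t₁ < U w ∧ U w ≤ t₂} ⊆
      {w : ℝ × ℝ | |w.1| ≤ 2 ∧ |w.2| ≤ 1 / nu b₂ + e ∧ t₁ < U w ∧ U w ≤ t₂} := by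
    rintro w ⟨hwA, h1, h2⟩
    have hw := h.subset hwA
    refine ⟨hw.1, ?_, h1, h2⟩
    have hU : |U w| ≤ δ := abs_le.2 ⟨by linarith [(abs_le.1 ht1).1], by linarith [(abs_le.1 ht2).2]⟩
    have hy : |w.1| ≤ Y := by
      have h3 := h.abs_U_sub_le hw
      have h4 : a * |w.1| ≤ |U w| + |U w - a * w.1| := by
        rw [← abs_of_pos ha, ← abs_mul, abs_of_pos ha]
        have := abs_sub (U w) (U w - a * w.1)
        simpa using this
      have h5 : (a / 2) * |w.1| ≤ (a / 2) * Y := by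
        have : C * ρ * |w.1| ≤ a / 2 * |w.1| :=
          mul_le_mul_of_nonneg_right (by linarith) (abs_nonneg _)
        linarith
      exact le_of_mul_le_mul_left h5 (by positivity)
    have h6 := (abs_le.1 (abs_quadN_sub_le b₁ b₂ hw)).1
    rw [← hK] at h6
    have h7 := h.upper w hwA
    have h8 := (abs_le.1 (hT w hw)).1
    have h9 : (nu b₂ * w.2) ^ 2 ≤ 1 + e := by
      have := mul_le_mul_of_nonneg_left hy hK0.le
      linarith
    by_contra! hcon
    have h10 : 1 + e ≤ nu b₂ * |w.2| := by
      have h3 := mul_le_mul_of_nonneg_left hcon.le hν0.le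
      have h4 := mul_le_mul_of_nonneg_right hν he0.le
      rw [mul_add, hinv] at h3
      linarith
    rw [← sq_abs, abs_mul, abs_of_pos hν0] at h9
    have h12 := pow_le_pow_left₀ (by linarith) h10 2
    have h13 : (1 + e) ^ 2 = 1 + e + (e + e ^ 2) := by ring
    have h14 : 0 < e + e ^ 2 := by positivity
    linarith
  -- The lower inclusion of a local model says nothing about the centre; removing this one point
  -- costs no area.
  have hsub2 : {w : ℝ × ℝ | |w.1| ≤ Y ∧ |w.2| ≤ 1 / nu b₂ - e ∧ t₁ < U w ∧ U w ≤ t₂} \ {0} ⊆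
      {w | w ∈ A ∧ t₁ < U w ∧ U w ≤ t₂} := by
    rintro w ⟨⟨hy, hz, h1, h2⟩, hw0⟩
    have hw : w ∈ box := ⟨hy.trans (by linarith), hz.trans (by linarith)⟩
    refine ⟨h.lower w hw hw0 ?_, h1, h2⟩
    have h6 := (abs_le.1 (abs_quadN_sub_le b₁ b₂ hw)).2
    rw [← hK] at h6
    have h8 := (abs_le.1 (hT w hw)).2
    have h10 : nu b₂ * |w.2| ≤ 1 - e := by
      have h3 := mul_le_mul_of_nonneg_left hz hν0.le
      have h4 := mul_le_mul_of_nonneg_right hν he0.le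
      rw [mul_sub, hinv] at h3
      linarith
    have h11 : (nu b₂ * w.2) ^ 2 ≤ 1 - e := by
      rw [← sq_abs, abs_mul, abs_of_pos hν0]
      have h12 := mul_nonneg hν0.le (abs_nonneg w.2)
      have h13 := pow_le_pow_left₀ h12 h10 2
      have h14 : 0 ≤ (1 - e) * e := mul_nonneg (by linarith) he0.le
      have h15 : (1 - e) ^ 2 = 1 - e - (1 - e) * e := by ring
      linarith
    have := mul_le_mul_of_nonneg_left hy hK0.le
    linarith
  have hfin : ∀ S ⊆ box, volume S ≠ ⊤ := fun S hS => (volume_lt_top_of_subset_box hS).ne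
  have hZ2 : 1 / nu b₂ + e ≤ 2 := by linarith
  have u1 := h.volume_strip_le (by linarith) hZ2 ht
  have hδY' : δ ≤ (a - C * ρ) * Y - C * ρ ^ 2 := by
    have : a / 2 * Y ≤ (a - C * ρ) * Y := mul_le_mul_of_nonneg_right (by linarith) hY0.le
    linarith
  have u2 := h.le_volume_strip (by linarith) hCρ0 hY0.le (by linarith) (by linarith : 1 / nu b₂ - e ≤ 2)
    ht (ht1.trans hδY') (ht2.trans hδY')
  have v1 : volume.real {w | w ∈ A ∧ t₁ < U w ∧ U w ≤ t₂} ≤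
      2 * (1 / nu b₂ + e) / (a - C * ρ) * (t₂ - t₁) := by
    refine ENNReal.toReal_le_of_le_ofReal ?_ ((measure_mono hsub1).trans u1)
    have : 0 < a - C * ρ := by linarith
    have : 0 ≤ t₂ - t₁ := by linarith
    positivity
  have v2 : 2 * (1 / nu b₂ - e) / (a + C * ρ) * (t₂ - t₁) ≤
      volume.real {w | w ∈ A ∧ t₁ < U w ∧ U w ≤ t₂} := by
    refine le_trans ?_ (measureReal_mono hsub2 (hfin _ fun w hw => h.subset hw.1))
    rw [volume_real_diff_zero]
    refine (ENNReal.ofReal_le_iff_le_toReal (hfin _ ?_)).1 u2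
    exact fun w hw => ⟨hw.1.trans (by linarith), hw.2.1.trans (by linarith)⟩
  have w1 := mul_le_mul_of_nonneg_right hup (sub_nonneg.2 ht)
  have w2 := mul_le_mul_of_nonneg_right hlo (sub_nonneg.2 ht)
  rw [abs_le]
  constructor <;> linarith

/-! ### Half areas in polar coordinates and the asymmetry -/

lemma abs_cubic_sub_le {x e K : ℝ} (hx : |x| ≤ K) (he : |e| ≤ K) (he1 : |e| ≤ 1) :
    |(1 - e) ^ 2 + x * (1 - e) ^ 3 - (1 - 2 * e + x)| ≤ 8 * K ^ 2 := by
  have hK : 0 ≤ K := (abs_nonneg _).trans hx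
  have e1 : (1 - e) ^ 2 + x * (1 - e) ^ 3 - (1 - 2 * e + x) =
      e * e - x * e * (3 - 3 * e + e * e) := by ring
  have h1 : |e * e| ≤ K ^ 2 := by
    rw [abs_mul, sq]; exact mul_le_mul he he (abs_nonneg _) hK
  have h2 : |x * e| ≤ K ^ 2 := by
    rw [abs_mul, sq]; exact mul_le_mul hx he (abs_nonneg _) hK
  have h3 : |3 - 3 * e + e * e| ≤ 7 := by
    obtain ⟨h4, h5⟩ := abs_le.1 he1
    rw [abs_le]; constructor <;> nlinarith
  have h4 : |x * e * (3 - 3 * e + e * e)| ≤ K ^ 2 * 7 := by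
    rw [abs_mul]; exact mul_le_mul h2 h3 (abs_nonneg _) (by positivity)
  rw [e1]
  refine (abs_sub _ _).trans ?_
  linarith

/-- The difference quotient `g + g' + x (g² + g g' + g'²)` is at least `(g + g') (1 - |x| (g +
g'))`, so `g² + x g³` is increasing in the range considered. -/
lemma cubic_le_cubic {x g g' : ℝ} (hg : 0 ≤ g) (hgg : g ≤ g') (hx : |x| * (g + g') ≤ 1) :
    g ^ 2 + x * g ^ 3 ≤ g' ^ 2 + x * g' ^ 3 := by
  have hg' : 0 ≤ g' := hg.trans hgg
  have h1 : -(|x| * (g + g') ^ 2) ≤ x * (g ^ 2 + g * g' + g' ^ 2) := by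
    have h2 : |x * (g ^ 2 + g * g' + g' ^ 2)| ≤ |x| * (g + g') ^ 2 := by
      rw [abs_mul, abs_of_nonneg (by positivity : 0 ≤ g ^ 2 + g * g' + g' ^ 2)]
      exact mul_le_mul_of_nonneg_left (by nlinarith) (abs_nonneg _)
    exact (abs_le.1 h2).1
  have h3 : |x| * (g + g') * (g + g') ≤ 1 * (g + g') :=
    mul_le_mul_of_nonneg_right hx (by linarith)
  have h4 : 0 ≤ (g' - g) * ((g + g') + x * (g ^ 2 + g * g' + g' ^ 2)) :=
    mul_nonneg (by linarith) (by nlinarith)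
  nlinarith

/-- Solving `g ^ 2 + x g ^ 3 ≤ 1` for `g` up to second order in `x`. -/
lemma exists_radial_estimate {C K G : ℝ} (hC : 0 ≤ C) (hK : 0 ≤ K) (hG : 0 ≤ G) :
    ∃ C' ≥ 0, ∃ δ > 0, ∀ ρ t g, 0 < ρ → ρ < δ → |t| ≤ K → 0 ≤ g →
      |ρ * t / 2| ≤ 1 / 2 ∧ C' * ρ ^ 2 ≤ 1 / 2 ∧
      (g ≤ 1 - ρ * t / 2 - C' * ρ ^ 2 → g ^ 2 + ρ * t * g ^ 3 ≤ 1 - C * ρ ^ 2) ∧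
      (g ≤ G → g ^ 2 + ρ * t * g ^ 3 ≤ 1 + C * ρ ^ 2 → g ≤ 1 - ρ * t / 2 + C' * ρ ^ 2) := by
  set L := K + 1 with hL
  -- At `g = 1 - ρ t / 2 ∓ C' ρ²` the cubic is `1 ∓ 2 C' ρ²` up to `8 (ρ L)²`, by `abs_cubic_sub_le`
  -- with bound `ρ L`. Thus `2 C'` must absorb `C` and `8 L²`; the extra `1` gives a strict
  -- inequality for the contradiction.
  set C' := (C + 8 * L ^ 2 + 1) / 2 with hC'
  have hL0 : 0 < L := by positivity
  have hC'0 : 0 < C' := by positivity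
  refine ⟨C', hC'0.le, 1 / (L * (2 * C' + G + 4)), by positivity, fun ρ t g hρ hρδ ht hg => ?_⟩
  rw [lt_div_iff₀ (by positivity)] at hρδ
  have hx : |ρ * t| ≤ ρ * K := by rw [abs_mul, abs_of_pos hρ]; gcongr
  have hρL : 0 < ρ * L := by positivity
  have k1 : ρ * L * 2 * C' + ρ * L * G + ρ * L * 4 < 1 := by linarith
  have k2 : 0 ≤ ρ * L * G := by positivity
  have k3 : 0 ≤ ρ * L * 2 * C' := by positivity
  have k4 : ρ * K ≤ ρ * L := by gcongr; linarith
  have k5 : ρ ≤ ρ * L := by nlinarith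
  have k6 : C' * ρ ^ 2 ≤ ρ / 2 := by
    have : ρ * C' ≤ ρ * L * C' := by gcongr
    nlinarith
  have k7 : 0 ≤ C' * ρ ^ 2 := by positivity
  have hx2 : |ρ * t / 2| ≤ ρ * K / 2 := by rw [abs_div, abs_two]; linarith
  have hx3 := abs_le.1 hx2
  refine ⟨by linarith, by linarith, fun h => ?_, fun hgG h => ?_⟩
  · have he : |ρ * t / 2 + C' * ρ ^ 2| ≤ ρ * L := by
      rw [abs_le]; constructor <;> linarith
    have h1 := (abs_le.1 (abs_cubic_sub_le (hx.trans k4) he (by linarith))).2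
    have h2 : g ≤ 1 - (ρ * t / 2 + C' * ρ ^ 2) := by linarith
    have h3 := cubic_le_cubic (x := ρ * t) hg h2 ?_
    · rw [mul_pow] at h1
      have : C' * 2 = C + 8 * L ^ 2 + 1 := by rw [hC']; ring
      nlinarith [sq_nonneg ρ]
    · have h4 : g + (1 - (ρ * t / 2 + C' * ρ ^ 2)) ≤ 4 := by linarith
      calc _ ≤ ρ * L * 4 := mul_le_mul (hx.trans k4) h4 (by linarith) hρL.le
        _ ≤ 1 := by linarith
  · by_contra! hcon
    have he : |ρ * t / 2 - C' * ρ ^ 2| ≤ ρ * L := by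
      rw [abs_le]; constructor <;> linarith
    have h1 := (abs_le.1 (abs_cubic_sub_le (hx.trans k4) he (by linarith))).1
    have h2 : 1 - (ρ * t / 2 - C' * ρ ^ 2) ≤ g := by linarith
    have h3 := cubic_le_cubic (x := ρ * t) (by linarith) h2 ?_
    · rw [mul_pow] at h1
      have : C' * 2 = C + 8 * L ^ 2 + 1 := by rw [hC']; ring
      have : 0 < ρ ^ 2 := by positivity
      nlinarith
    · have h4 : 1 - (ρ * t / 2 - C' * ρ ^ 2) + g ≤ G + 4 := by linarith
      calc _ ≤ ρ * L * (G + 4) := mul_le_mul (hx.trans k4) h4 (by linarith) hρL.le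
        _ ≤ 1 := by linarith

/-- The area of a star-shaped subset of the right half plane in polar coordinates. -/
lemma volume_real_eq_integral_polar {S : Set (ℝ × ℝ)} (hS : MeasurableSet S) {R : ℝ → ℝ}
    (hR : Continuous R) (hR0 : ∀ φ, 0 ≤ R φ)
    (h : ∀ r φ, 0 < r → φ ∈ Ioo (-Real.pi) Real.pi →
      ((r * Real.cos φ, r * Real.sin φ) ∈ S ↔
        φ ∈ Ioo (-(Real.pi / 2)) (Real.pi / 2) ∧ r ≤ R φ)) :
    volume.real S = ∫ φ in (-(Real.pi / 2))..(Real.pi / 2), R φ ^ 2 / 2 := by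
  have hpi := Real.pi_pos
  have h0 : volume S = ∫⁻ p : ℝ × ℝ, S.indicator 1 p := by rw [lintegral_indicator_one hS]
  have h1 : volume S = ∫⁻ φ : ℝ, (Ioo (-(Real.pi / 2)) (Real.pi / 2)).indicator
      (fun φ => ENNReal.ofReal (R φ ^ 2 / 2)) φ := by
    rw [h0, ← lintegral_comp_polarCoord_symm]
    have e1 : ∀ p ∈ polarCoord.target, ENNReal.ofReal p.1 • S.indicator 1 (polarCoord.symm p) =
        {p : ℝ × ℝ | p.2 ∈ Ioo (-(Real.pi / 2)) (Real.pi / 2) ∧ p.1 ∈ Ioc 0 (R p.2)}.indicator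
          (fun p => ENNReal.ofReal p.1) p := by
      rintro ⟨r, φ⟩ hp
      rw [polarCoord_target] at hp
      have hp1 : 0 < r := hp.1
      have := h r φ hp1 hp.2
      rw [polarCoord_symm_apply]
      simp only [indicator, mem_ofPred_eq, this, mem_Ioc, hp1, true_and]
      split_ifs <;> simp
    have hmeas : MeasurableSet
        {p : ℝ × ℝ | p.2 ∈ Ioo (-(Real.pi / 2)) (Real.pi / 2) ∧ p.1 ∈ Ioc 0 (R p.2)} := by
      have m1 : MeasurableSet {p : ℝ × ℝ | 0 < p.1} :=
        measurableSet_lt measurable_const measurable_fst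
      have m2 : MeasurableSet {p : ℝ × ℝ | p.1 ≤ R p.2} :=
        measurableSet_le measurable_fst (hR.measurable.comp measurable_snd)
      exact (measurable_snd measurableSet_Ioo).inter (m1.inter m2)
    rw [setLIntegral_congr_fun (by rw [polarCoord_target]; exact measurableSet_Ioi.prod measurableSet_Ioo) e1]
    rw [setLIntegral_indicator hmeas]
    have e2 : {p : ℝ × ℝ | p.2 ∈ Ioo (-(Real.pi / 2)) (Real.pi / 2) ∧ p.1 ∈ Ioc 0 (R p.2)} ∩
        polarCoord.target =
        {p : ℝ × ℝ | p.2 ∈ Ioo (-(Real.pi / 2)) (Real.pi / 2) ∧ p.1 ∈ Ioc 0 (R p.2)} := by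
      refine inter_eq_left.2 ?_
      rintro ⟨r, φ⟩ ⟨h1, h2⟩
      rw [polarCoord_target]
      exact ⟨h2.1, by linarith [h1.1], by linarith [h1.2]⟩
    rw [e2, ← lintegral_indicator hmeas, Measure.volume_eq_prod, lintegral_prod_symm]
    swap
    · exact ((by fun_prop : Measurable fun p : ℝ × ℝ => ENNReal.ofReal p.1).indicator hmeas).aemeasurable
    refine lintegral_congr fun φ => ?_
    by_cases hφ : φ ∈ Ioo (-(Real.pi / 2)) (Real.pi / 2)
    · rw [indicator_of_mem hφ]
      have e3 : ∀ r, {p : ℝ × ℝ | p.2 ∈ Ioo (-(Real.pi / 2)) (Real.pi / 2) ∧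
          p.1 ∈ Ioc 0 (R p.2)}.indicator (fun p => ENNReal.ofReal p.1) (r, φ) =
          (Ioc 0 (R φ)).indicator (fun r => ENNReal.ofReal r) r := by
        intro r
        simp only [indicator, mem_ofPred_eq, hφ, true_and]
      simp_rw [e3]
      rw [lintegral_indicator measurableSet_Ioc, ← ofReal_integral_eq_lintegral_ofReal,
        ← intervalIntegral.integral_of_le (hR0 φ), integral_id]
      · congr 1; ring
      · exact (continuous_id.integrableOn_Icc).mono_set Ioc_subset_Icc_self
      · exact (ae_restrict_mem measurableSet_Ioc).mono fun r hr => hr.1.le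
    · rw [indicator_of_notMem hφ]
      have e3 : ∀ r, {p : ℝ × ℝ | p.2 ∈ Ioo (-(Real.pi / 2)) (Real.pi / 2) ∧
          p.1 ∈ Ioc 0 (R p.2)}.indicator (fun p => ENNReal.ofReal p.1) (r, φ) = 0 := by
        intro r
        refine indicator_of_notMem ?_ _
        exact fun h' => hφ h'.1
      simp_rw [e3, lintegral_zero]
  rw [lintegral_indicator measurableSet_Ioo, ← ofReal_integral_eq_lintegral_ofReal,
    ← integral_Ioc_eq_integral_Ioo, ← intervalIntegral.integral_of_le (by linarith)] at h1
  · rw [measureReal_def, h1, ENNReal.toReal_ofReal]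
    exact intervalIntegral.integral_nonneg (by linarith) fun φ _ => by positivity
  · exact (Continuous.integrableOn_Icc (by fun_prop)).mono_set Ioo_subset_Icc_self
  · exact Eventually.of_forall fun φ => by positivity

/-- The norm belonging to `quadN`. -/
def normN (b₁ b₂ : ℝ) (w : ℝ × ℝ) : ℝ := Real.sqrt (quadN b₁ b₂ w)

lemma quadN_nonneg (b₁ b₂ : ℝ) (w : ℝ × ℝ) : 0 ≤ quadN b₁ b₂ w := by
  unfold quadN; positivity

lemma normN_sq (b₁ b₂ : ℝ) (w : ℝ × ℝ) : normN b₁ b₂ w ^ 2 = quadN b₁ b₂ w :=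
  Real.sq_sqrt (quadN_nonneg _ _ _)

lemma normN_nonneg (b₁ b₂ : ℝ) (w : ℝ × ℝ) : 0 ≤ normN b₁ b₂ w := Real.sqrt_nonneg _

lemma abs_fst_le_normN (b₁ b₂ : ℝ) (w : ℝ × ℝ) : |w.1| ≤ normN b₁ b₂ w := by
  refine abs_le_of_sq_le_sq ?_ (normN_nonneg _ _ _)
  rw [normN_sq, quadN]; nlinarith [sq_nonneg w.2, sq_nonneg (b₁ * w.1 + b₂ * w.2)]

lemma abs_snd_le_normN (b₁ b₂ : ℝ) (w : ℝ × ℝ) : |w.2| ≤ normN b₁ b₂ w := by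
  refine abs_le_of_sq_le_sq ?_ (normN_nonneg _ _ _)
  rw [normN_sq, quadN]; nlinarith [sq_nonneg w.1, sq_nonneg (b₁ * w.1 + b₂ * w.2)]

lemma continuous_quadN (b₁ b₂ : ℝ) : Continuous (quadN b₁ b₂) := by
  unfold quadN; fun_prop

lemma continuous_normN (b₁ b₂ : ℝ) : Continuous (normN b₁ b₂) :=
  (continuous_quadN b₁ b₂).sqrt

lemma normN_smul (b₁ b₂ : ℝ) {r : ℝ} (hr : 0 ≤ r) (w : ℝ × ℝ) :
    normN b₁ b₂ (r • w) = r * normN b₁ b₂ w := by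
  have : quadN b₁ b₂ (r • w) = r ^ 2 * quadN b₁ b₂ w := by
    simp only [quadN, Prod.smul_fst, Prod.smul_snd, smul_eq_mul]; ring
  rw [normN, this, Real.sqrt_mul (by positivity), Real.sqrt_sq hr, normN]

lemma normN_neg (b₁ b₂ : ℝ) (w : ℝ × ℝ) : normN b₁ b₂ (-w) = normN b₁ b₂ w := by
  have : quadN b₁ b₂ (-w) = quadN b₁ b₂ w := by
    simp only [quadN, Prod.fst_neg, Prod.snd_neg]; ring
  rw [normN, this, normN]

/-- The point at angle `φ` on the unit circle. -/
def circ (φ : ℝ) : ℝ × ℝ := (Real.cos φ, Real.sin φ)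

lemma continuous_circ : Continuous circ := by unfold circ; fun_prop

lemma one_le_normN_circ (b₁ b₂ φ : ℝ) : 1 ≤ normN b₁ b₂ (circ φ) := by
  refine Real.one_le_sqrt.2 ?_
  have := Real.sin_sq_add_cos_sq φ
  simp only [quadN, circ]
  nlinarith [sq_nonneg (b₁ * Real.cos φ + b₂ * Real.sin φ)]

lemma smul_circ (r φ : ℝ) : (r * Real.cos φ, r * Real.sin φ) = r • circ φ := by
  simp [circ]

/-- A cubic form that is controlled by the norm `normN`. -/
structure IsCubic (b₁ b₂ : ℝ) (T : ℝ × ℝ → ℝ) (K : ℝ) : Prop where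
  continuous : Continuous T
  smul : ∀ (r : ℝ) w, T (r • w) = r ^ 3 * T w
  nonneg : 0 ≤ K
  bound : ∀ w, |T w| ≤ K * normN b₁ b₂ w ^ 3

lemma IsCubic.neg {b₁ b₂ K : ℝ} {T : ℝ × ℝ → ℝ} (hT : IsCubic b₁ b₂ T K) :
    IsCubic b₁ b₂ (fun w => T (-w)) K where
  continuous := hT.continuous.comp continuous_neg
  smul r w := by rw [← smul_neg, hT.smul]
  nonneg := hT.nonneg
  bound w := by simpa [normN_neg] using hT.bound (-w)

lemma IsCubic.apply_neg {b₁ b₂ K : ℝ} {T : ℝ × ℝ → ℝ} (hT : IsCubic b₁ b₂ T K) (w : ℝ × ℝ) :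
    T (-w) = -T w := by
  have := hT.smul (-1) w
  rw [neg_one_smul] at this
  rw [this]; ring

/-- The half of a star-shaped region that lies in the right half plane. -/
def sector (b₁ b₂ : ℝ) (T : ℝ × ℝ → ℝ) (ρ c : ℝ) : Set (ℝ × ℝ) :=
  {w | 0 < w.1 ∧ normN b₁ b₂ w ≤ 1 - ρ * (T w / normN b₁ b₂ w ^ 3) / 2 + c}

/-- The quotient `T / N³` is homogeneous of degree zero, so on each ray the defining inequality
bounds `r` by an explicit radius divided by `N (circ φ)`, and the polar area formula applies. -/
lemma volume_sector {b₁ b₂ K : ℝ} {T : ℝ × ℝ → ℝ} (hT : IsCubic b₁ b₂ T K) {ρ c : ℝ}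
    (h0 : ∀ φ, 0 ≤ 1 - ρ * (T (circ φ) / normN b₁ b₂ (circ φ) ^ 3) / 2 + c) :
    volume.real (sector b₁ b₂ T ρ c) = ∫ φ in (-(Real.pi / 2))..(Real.pi / 2),
      ((1 - ρ * (T (circ φ) / normN b₁ b₂ (circ φ) ^ 3) / 2 + c) / normN b₁ b₂ (circ φ)) ^ 2 / 2 := by
  have hN := continuous_normN b₁ b₂
  have hpos : ∀ φ, 0 < normN b₁ b₂ (circ φ) := fun φ =>
    zero_lt_one.trans_le (one_le_normN_circ b₁ b₂ φ)
  refine volume_real_eq_integral_polar ?_ ?_ ?_ ?_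
  · have m1 : MeasurableSet {w : ℝ × ℝ | 0 < w.1} :=
      measurableSet_lt measurable_const measurable_fst
    refine m1.inter (measurableSet_le hN.measurable ?_)
    have := hT.continuous.measurable
    have := hN.measurable
    fun_prop
  · have := hT.continuous.comp continuous_circ
    have h2 := hN.comp continuous_circ
    simp only [Function.comp_def] at this h2
    refine Continuous.div ?_ h2 fun φ => (hpos φ).ne'
    have h3 : Continuous fun φ => T (circ φ) / normN b₁ b₂ (circ φ) ^ 3 := this.div (h2.pow 3) fun φ => (pow_pos (hpos φ) 3).ne'
    exact (continuous_const.sub ((continuous_const.mul h3).div_const 2)).add continuous_const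
  · exact fun φ => div_nonneg (h0 φ) (hpos φ).le
  · intro r φ hr hφ
    rw [smul_circ]
    have e1 : T (r • circ φ) / normN b₁ b₂ (r • circ φ) ^ 3 =
        T (circ φ) / normN b₁ b₂ (circ φ) ^ 3 := by
      rw [hT.smul, normN_smul _ _ hr.le, mul_pow, mul_div_mul_left _ _ (by positivity)]
    unfold sector
    simp only [mem_ofPred_eq, e1]
    rw [normN_smul _ _ hr.le, le_div_iff₀ (hpos φ)]
    refine and_congr_left fun _ => ?_
    have : (r • circ φ).1 = r * Real.cos φ := by simp [circ]
    rw [this, mul_pos_iff_of_pos_left hr]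
    constructor
    · intro hc
      by_contra hcon
      rw [mem_Ioo, not_and_or, not_lt, not_lt] at hcon
      refine absurd hc (not_lt.2 ?_)
      rcases hcon with h1 | h1
      · rw [← Real.cos_neg]
        exact Real.cos_nonpos_of_pi_div_two_le_of_le (by linarith) (by linarith [hφ.1, Real.pi_pos])
      · exact Real.cos_nonpos_of_pi_div_two_le_of_le h1 (by linarith [hφ.2, Real.pi_pos])
    · exact fun h => Real.cos_pos_of_mem_Ioo h

lemma normN_le_of_mem_box (b₁ b₂ : ℝ) {w : ℝ × ℝ} (hw : w ∈ box) :
    normN b₁ b₂ w ≤ 4 + (2 * |b₁| + 2 * |b₂|) := by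
  have h3 : |b₁ * w.1 + b₂ * w.2| ≤ 2 * |b₁| + 2 * |b₂| := by
    refine (abs_add_le _ _).trans ?_
    rw [abs_mul, abs_mul]
    nlinarith [hw.1, hw.2, abs_nonneg b₁, abs_nonneg b₂]
  refine Real.sqrt_le_iff.2 ⟨by positivity, ?_⟩
  have h4 : (b₁ * w.1 + b₂ * w.2) ^ 2 ≤ (2 * |b₁| + 2 * |b₂|) ^ 2 := sq_le_sq' (abs_le.1 h3).1 (abs_le.1 h3).2
  have h1 : w.1 ^ 2 ≤ 2 ^ 2 := sq_le_sq' (abs_le.1 hw.1).1 (abs_le.1 hw.1).2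
  have h2 : w.2 ^ 2 ≤ 2 ^ 2 := sq_le_sq' (abs_le.1 hw.2).1 (abs_le.1 hw.2).2
  have h5 : 0 ≤ 2 * |b₁| + 2 * |b₂| := by positivity
  unfold quadN; nlinarith

lemma IsCubic.eq_div_mul {b₁ b₂ K : ℝ} {T : ℝ × ℝ → ℝ} (hT : IsCubic b₁ b₂ T K) (w : ℝ × ℝ) :
    T w / normN b₁ b₂ w ^ 3 * normN b₁ b₂ w ^ 3 = T w := by
  -- Where `N` vanishes the quotient takes its default value `0`, and the cubic bound forces `T w =
  -- 0` as well.
  by_cases h : normN b₁ b₂ w = 0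
  · have := hT.bound w
    rw [h] at this
    have h2 : T w = 0 := by
      refine abs_eq_zero.1 (le_antisymm ?_ (abs_nonneg _)); simpa using this
    rw [h2]; simp
  · exact div_mul_cancel₀ _ (pow_ne_zero 3 h)

lemma IsCubic.abs_div_le {b₁ b₂ K : ℝ} {T : ℝ × ℝ → ℝ} (hT : IsCubic b₁ b₂ T K) (w : ℝ × ℝ) :
    |T w / normN b₁ b₂ w ^ 3| ≤ K := by
  rw [abs_div, abs_of_nonneg (pow_nonneg (normN_nonneg _ _ _) 3)]
  exact div_le_of_le_mul₀ (pow_nonneg (normN_nonneg _ _ _) 3) hT.nonneg (hT.bound w)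

/-- The area of the right half of a rescaled amoeba. -/
lemma exists_half_area_estimate {b₁ b₂ C K : ℝ} (hC : 0 ≤ C) (hK : 0 ≤ K) :
    -- The form `T` is quantified after the constants, so the same ones serve for `T` and for its
    -- reflection.
    ∃ C' ≥ 0, ∃ δ > 0, ∀ ρ T (A : Set (ℝ × ℝ)), 0 < ρ → ρ < δ → IsCubic b₁ b₂ T K → A ⊆ box →
      (∀ w ∈ A, quadN b₁ b₂ w + ρ * T w ≤ 1 + C * ρ ^ 2) →
      (∀ w ∈ box, w ≠ 0 → quadN b₁ b₂ w + ρ * T w ≤ 1 - C * ρ ^ 2 → w ∈ A) →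
      |volume.real {w | w ∈ A ∧ 0 < w.1} - ∫ φ in (-(Real.pi / 2))..(Real.pi / 2),
        ((1 - ρ * (T (circ φ) / normN b₁ b₂ (circ φ) ^ 3) / 2) / normN b₁ b₂ (circ φ)) ^ 2 / 2|
        ≤ C' * ρ ^ 2 := by
  obtain ⟨C', hC', δ, hδ, H⟩ := exists_radial_estimate hC hK
    (by positivity : 0 ≤ 4 + (2 * |b₁| + 2 * |b₂|))
  have hpi := Real.pi_pos
  refine ⟨2 * C' * Real.pi, by positivity, δ, hδ, fun ρ T A hρ hρδ hT hA hup hlo => ?_⟩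
  have hτ := fun w => H ρ (T w / normN b₁ b₂ w ^ 3) (normN b₁ b₂ w) hρ hρδ (hT.abs_div_le w)
    (normN_nonneg _ _ _)
  have hq : ∀ w, quadN b₁ b₂ w + ρ * T w = normN b₁ b₂ w ^ 2 +
      ρ * (T w / normN b₁ b₂ w ^ 3) * normN b₁ b₂ w ^ 3 := by
    intro w
    rw [mul_assoc, hT.eq_div_mul, normN_sq]
  have hC'ρ : 0 ≤ C' * ρ ^ 2 := by positivity
  have hbox : ∀ c, c ≤ 1 / 2 → sector b₁ b₂ T ρ c ⊆ box := by
    intro c hc w hw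
    have h1 := (abs_le.1 (hτ w).1).1
    have h2 := hw.2
    exact ⟨(abs_fst_le_normN b₁ b₂ w).trans (by linarith), (abs_snd_le_normN b₁ b₂ w).trans (by linarith)⟩
  -- The half amoeba is squeezed between two sectors whose radial functions differ from `(1 - ρ T /
  -- (2 N³)) / N` by at most `C' ρ²`.
  have s1 : {w | w ∈ A ∧ 0 < w.1} ⊆ sector b₁ b₂ T ρ (C' * ρ ^ 2) := by
    rintro w ⟨hw, hw0⟩
    refine ⟨hw0, (hτ w).2.2.2 (normN_le_of_mem_box _ _ (hA hw)) ?_⟩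
    rw [← hq]; exact hup w hw
  have s2 : sector b₁ b₂ T ρ (-(C' * ρ ^ 2)) ⊆ {w | w ∈ A ∧ 0 < w.1} := by
    intro w hw
    refine ⟨hlo w (hbox _ (by linarith) hw) ?_ ?_, hw.1⟩
    · rintro rfl; exact absurd hw.1 (by simp)
    · rw [hq]; exact (hτ w).2.2.1 (by linarith [hw.2])
  have hhalf := (hτ 0).2.1
  have v1 := measureReal_mono (μ := volume) s1 (volume_lt_top_of_subset_box (hbox _ hhalf)).ne
  have v2 := measureReal_mono (μ := volume) s2
    (volume_lt_top_of_subset_box fun w hw => hA hw.1).ne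
  have h0 : ∀ c, |c| ≤ 1 / 2 → ∀ φ, 0 ≤ 1 - ρ * (T (circ φ) / normN b₁ b₂ (circ φ) ^ 3) / 2 + c := by
    intro c hc φ
    linarith [(abs_le.1 (hτ (circ φ)).1).2, (abs_le.1 hc).1]
  have habs1 : |C' * ρ ^ 2| ≤ 1 / 2 := by rwa [abs_of_nonneg hC'ρ]
  have habs2 : |-(C' * ρ ^ 2)| ≤ 1 / 2 := by rwa [abs_neg]
  rw [volume_sector hT (h0 _ habs1)] at v1
  rw [volume_sector hT (h0 _ habs2)] at v2
  have hN := continuous_normN b₁ b₂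
  have hpos : ∀ φ, 0 < normN b₁ b₂ (circ φ) := fun φ =>
    zero_lt_one.trans_le (one_le_normN_circ b₁ b₂ φ)
  have hcont : ∀ c, Continuous fun φ =>
      ((1 - ρ * (T (circ φ) / normN b₁ b₂ (circ φ) ^ 3) / 2 + c) / normN b₁ b₂ (circ φ)) ^ 2 / 2 := by
    intro c
    have := hT.continuous.comp continuous_circ
    have h2 := hN.comp continuous_circ
    simp only [Function.comp_def] at this h2
    have h3 : Continuous fun φ => T (circ φ) / normN b₁ b₂ (circ φ) ^ 3 := this.div (h2.pow 3) fun φ => (pow_pos (hpos φ) 3).ne'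
    refine ((Continuous.div ?_ h2 fun φ => (hpos φ).ne').pow 2).div_const 2
    exact (continuous_const.sub ((continuous_const.mul h3).div_const 2)).add continuous_const
  have hcmp : ∀ c, |c| ≤ 1 / 2 → |(∫ φ in (-(Real.pi / 2))..(Real.pi / 2),
      ((1 - ρ * (T (circ φ) / normN b₁ b₂ (circ φ) ^ 3) / 2 + c) / normN b₁ b₂ (circ φ)) ^ 2 / 2)
      - ∫ φ in (-(Real.pi / 2))..(Real.pi / 2),
      ((1 - ρ * (T (circ φ) / normN b₁ b₂ (circ φ) ^ 3) / 2) / normN b₁ b₂ (circ φ)) ^ 2 / 2|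
      ≤ 2 * |c| * Real.pi := by
    intro c hc
    have hc0 := hcont 0
    simp only [add_zero] at hc0
    rw [← intervalIntegral.integral_sub ((hcont c).intervalIntegrable _ _)
      (hc0.intervalIntegrable _ _), ← Real.norm_eq_abs]
    refine (intervalIntegral.norm_integral_le_of_norm_le_const (C := 2 * |c|) ?_).trans_eq ?_
    · intro φ _
      set x := ρ * (T (circ φ) / normN b₁ b₂ (circ φ) ^ 3) / 2 with hx
      have hx1 : |x| ≤ 1 / 2 := (hτ (circ φ)).1
      have e1 : ((1 - x + c) / normN b₁ b₂ (circ φ)) ^ 2 / 2 -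
          ((1 - x) / normN b₁ b₂ (circ φ)) ^ 2 / 2 =
          c * (((1 - x) + c / 2) / normN b₁ b₂ (circ φ) ^ 2) := by
        have := (hpos φ).ne'
        field_simp; ring
      rw [e1, Real.norm_eq_abs, abs_mul, mul_comm 2 |c|]
      refine mul_le_mul_of_nonneg_left ?_ (abs_nonneg _)
      rw [abs_div, abs_of_pos (pow_pos (hpos φ) 2)]
      have h5 : |1 - x + c / 2| ≤ 2 := by
        have := abs_le.1 hx1
        have := abs_le.1 hc
        rw [abs_le]; constructor <;> linarith
      refine (div_le_self (abs_nonneg _) ?_).trans h5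
      exact one_le_pow₀ (one_le_normN_circ b₁ b₂ φ)
    · rw [show Real.pi / 2 - -(Real.pi / 2) = Real.pi by ring, abs_of_pos hpi]
  have i1 := abs_le.1 (hcmp _ habs1)
  have i2 := abs_le.1 (hcmp _ habs2)
  rw [abs_of_nonneg hC'ρ] at i1
  rw [abs_neg, abs_of_nonneg hC'ρ] at i2
  rw [abs_le]
  constructor <;> linarith [i1.1, i1.2, i2.1, i2.2]

/-- The coefficient of the first order in `ρ` of the asymmetry of a rescaled amoeba. -/
def asymm (b₁ b₂ : ℝ) (T : ℝ × ℝ → ℝ) : ℝ :=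
  ∫ φ in (-(Real.pi / 2))..(Real.pi / 2), T (circ φ) / normN b₁ b₂ (circ φ) ^ 5

lemma volume_sliver (c : ℝ) (hc : 0 ≤ c) :
    volume {w : ℝ × ℝ | |w.1| ≤ c ∧ |w.2| ≤ 2} = ENNReal.ofReal (8 * c) := by
  have : {w : ℝ × ℝ | |w.1| ≤ c ∧ |w.2| ≤ 2} = Icc (-c) c ×ˢ Icc (-2 : ℝ) 2 := by
    ext w; simp only [mem_ofPred_eq, abs_le, mem_prod, mem_Icc]
  rw [this, Measure.volume_eq_prod, Measure.prod_prod, Real.volume_Icc, Real.volume_Icc,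
    ← ENNReal.ofReal_mul (by linarith)]
  congr 1; ring

/-- The median defect of a rescaled amoeba. -/
lemma exists_median_estimate {a b₁ b₂ C K : ℝ} (ha : 0 < a) (hC : 0 ≤ C) (hK : 0 ≤ K) :
    ∃ C' ≥ 0, ∃ δ > 0, ∀ ρ T A U, 0 < ρ → ρ < δ → IsCubic b₁ b₂ T K →
      LocalModel a b₁ b₂ T C ρ A U →
      |2 * subArea A U 0 - volume.real A - ρ * asymm b₁ b₂ T| ≤ C' * ρ ^ 2 := by
  obtain ⟨C', hC', δ, hδ, H⟩ := exists_half_area_estimate (b₁ := b₁) (b₂ := b₂) hC hK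
  refine ⟨2 * C' + 32 * (C / a), by positivity, min δ (a / (2 * (C + 1)) ⊓ 1 / (C / a + 1)),
    by positivity, fun ρ T A U hρ hρδ hT h => ?_⟩
  have hρδ1 : ρ < δ := hρδ.trans_le (min_le_left _ _)
  have hCρ : C * ρ ≤ a / 2 := by
    have h1 : ρ < a / (2 * (C + 1)) := hρδ.trans_le ((min_le_right _ _).trans inf_le_left)
    rw [lt_div_iff₀ (by positivity)] at h1
    nlinarith
  have hρ1 : C / a * ρ ≤ 1 := by
    have h1 : ρ < 1 / (C / a + 1) := hρδ.trans_le ((min_le_right _ _).trans inf_le_right)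
    rw [lt_div_iff₀ (by positivity)] at h1
    nlinarith
  have hfin : ∀ S ⊆ box, volume S ≠ ⊤ := fun S hS => (volume_lt_top_of_subset_box hS).ne
  -- the two halves of the amoeba
  have p1 := H ρ T A hρ hρδ1 hT h.subset h.upper h.lower
  have hnegq : ∀ w, quadN b₁ b₂ (-w) = quadN b₁ b₂ w := fun w => by
    rw [← normN_sq, normN_neg, normN_sq]
  have hnegbox : ∀ w ∈ box, -w ∈ box := fun w hw => by simpa [box] using hw
  -- The left half is the right half of the reflected amoeba, whose metric is the same and whose
  -- cubic form has the opposite sign.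
  have p2 := H ρ (fun w => T (-w)) (-A) hρ hρδ1 hT.neg
    (fun w hw => by simpa using hnegbox _ (h.subset hw))
    (fun w hw => by have := h.upper _ hw; rwa [hnegq] at this)
    (fun w hw hw0 hq => h.lower (-w) (hnegbox _ hw) (neg_ne_zero.2 hw0) (by rwa [hnegq]))
  have e1 : volume.real {w | w ∈ -A ∧ 0 < w.1} = volume.real {w | w ∈ A ∧ w.1 < 0} := by
    have : {w : ℝ × ℝ | w ∈ -A ∧ 0 < w.1} = -{w | w ∈ A ∧ w.1 < 0} := by
      ext w; simp
    rw [this, measureReal_def, Measure.measure_neg, measureReal_def]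
  rw [e1] at p2
  have hN := continuous_normN b₁ b₂
  have hpos : ∀ φ, 0 < normN b₁ b₂ (circ φ) := fun φ =>
    zero_lt_one.trans_le (one_le_normN_circ b₁ b₂ φ)
  have hcont : ∀ T, IsCubic b₁ b₂ T K → Continuous fun φ =>
      ((1 - ρ * (T (circ φ) / normN b₁ b₂ (circ φ) ^ 3) / 2) / normN b₁ b₂ (circ φ)) ^ 2 / 2 := by
    intro T hT
    have := hT.continuous.comp continuous_circ
    have h2 := hN.comp continuous_circ
    simp only [Function.comp_def] at this h2
    have h3 : Continuous fun φ => T (circ φ) / normN b₁ b₂ (circ φ) ^ 3 :=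
      this.div (h2.pow 3) fun φ => (pow_pos (hpos φ) 3).ne'
    refine ((Continuous.div ?_ h2 fun φ => (hpos φ).ne').pow 2).div_const 2
    exact continuous_const.sub ((continuous_const.mul h3).div_const 2)
  -- In the difference of the squared radii `(1 + x)² - (1 - x)²` the even terms cancel exactly;
  -- only the linear one is left, which gives `ρ T / N⁵`.
  have e2 : (∫ φ in (-(Real.pi / 2))..(Real.pi / 2),
      ((1 - ρ * (T (-circ φ) / normN b₁ b₂ (circ φ) ^ 3) / 2) / normN b₁ b₂ (circ φ)) ^ 2 / 2)
      - ∫ φ in (-(Real.pi / 2))..(Real.pi / 2),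
      ((1 - ρ * (T (circ φ) / normN b₁ b₂ (circ φ) ^ 3) / 2) / normN b₁ b₂ (circ φ)) ^ 2 / 2
      = ρ * asymm b₁ b₂ T := by
    rw [← intervalIntegral.integral_sub ((hcont _ hT.neg).intervalIntegrable _ _)
      ((hcont _ hT).intervalIntegrable _ _), asymm, ← intervalIntegral.integral_const_mul]
    refine intervalIntegral.integral_congr fun φ _ => ?_
    have := (hpos φ).ne'
    simp only [hT.apply_neg]
    field_simp; ring
  -- comparison of `U ≤ 0` with the half plane
  set c := 2 * (C / a) * ρ ^ 2 with hc
  have hc0 : 0 ≤ c := by positivity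
  have hc2 : c ≤ 2 * ρ := by
    have : c = 2 * ((C / a * ρ) * ρ) := by rw [hc]; ring
    rw [this]; nlinarith
  -- Where the signs of `U` and `y` disagree, `a |y| ≤ |U - a y| ≤ C ρ |y| + C ρ²`. As `C ρ ≤ a /
  -- 2`, such points lie in a sliver of width `O(ρ²)`, which does not affect the first order.
  have hy : ∀ w ∈ box, a * |w.1| ≤ |U w - a * w.1| → |w.1| ≤ c := by
    intro w hw h1
    have h2 := h.abs_U_sub_le hw
    have h3 : C * ρ * |w.1| ≤ a / 2 * |w.1| := mul_le_mul_of_nonneg_right hCρ (abs_nonneg _)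
    have h4 : a / 2 * |w.1| ≤ a / 2 * c := by
      have : a / 2 * c = C * ρ ^ 2 := by rw [hc]; field_simp
      rw [this]; linarith
    exact le_of_mul_le_mul_left h4 (by positivity)
  have hsliver : volume.real {w : ℝ × ℝ | |w.1| ≤ c ∧ |w.2| ≤ 2} = 8 * c := by
    rw [measureReal_def, volume_sliver c hc0, ENNReal.toReal_ofReal (by positivity)]
  have hsfin : volume {w : ℝ × ℝ | |w.1| ≤ c ∧ |w.2| ≤ 2} ≠ ⊤ := by
    rw [volume_sliver c hc0]; exact ENNReal.ofReal_ne_top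
  have cmp : ∀ S S' : Set (ℝ × ℝ), S' ⊆ A →
      S ⊆ S' ∪ {w : ℝ × ℝ | |w.1| ≤ c ∧ |w.2| ≤ 2} →
      volume.real S ≤ volume.real S' + 8 * c := by
    intro S S' hS' hS
    rw [← hsliver]
    have hfin' : volume (S' ∪ {w : ℝ × ℝ | |w.1| ≤ c ∧ |w.2| ≤ 2}) ≠ ⊤ :=
      (measure_union_lt_top (hfin S' (hS'.trans h.subset)).lt_top hsfin.lt_top).ne
    exact (measureReal_mono hS hfin').trans (measureReal_union_le _ _)
  have hs : ∀ w ∈ A, 0 ≤ U w * -w.1 → |w.1| ≤ c := by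
    intro w hw h1
    refine hy w (h.subset hw) ?_
    rcases lt_trichotomy w.1 0 with h2 | h2 | h2
    · have : 0 ≤ U w := by nlinarith
      rw [abs_of_neg h2, le_abs]; left; linarith
    · rw [h2]; simp
    · have : U w ≤ 0 := by nlinarith
      rw [abs_of_pos h2, le_abs]; right; linarith
  have q1 := cmp {w | w ∈ A ∧ U w ≤ 0} {w | w ∈ A ∧ w.1 < 0} (fun w hw => hw.1) fun w hw => by
    by_cases h1 : w.1 < 0
    · exact Or.inl ⟨hw.1, h1⟩
    · exact Or.inr ⟨hs w hw.1 (by nlinarith [hw.2]), (h.subset hw.1).2⟩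
  have q2 := cmp {w | w ∈ A ∧ w.1 < 0} {w | w ∈ A ∧ U w ≤ 0} (fun w hw => hw.1) fun w hw => by
    by_cases h1 : U w ≤ 0
    · exact Or.inl ⟨hw.1, h1⟩
    · exact Or.inr ⟨hs w hw.1 (by nlinarith [hw.2]), (h.subset hw.1).2⟩
  have q3 := cmp {w | w ∈ A ∧ 0 < U w} {w | w ∈ A ∧ 0 < w.1} (fun w hw => hw.1) fun w hw => by
    by_cases h1 : 0 < w.1
    · exact Or.inl ⟨hw.1, h1⟩
    · exact Or.inr ⟨hs w hw.1 (by nlinarith [hw.2]), (h.subset hw.1).2⟩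
  have q4 := cmp {w | w ∈ A ∧ 0 < w.1} {w | w ∈ A ∧ 0 < U w} (fun w hw => hw.1) fun w hw => by
    by_cases h1 : 0 < U w
    · exact Or.inl ⟨hw.1, h1⟩
    · exact Or.inr ⟨hs w hw.1 (by nlinarith [hw.2]), (h.subset hw.1).2⟩
  have e3 := h.area_sub_subArea 0
  have e4 : subArea A U 0 = volume.real {w | w ∈ A ∧ U w ≤ 0} := rfl
  have p1' := abs_le.1 p1
  have p2' := abs_le.1 p2
  have e5 : (2 * C' + 32 * (C / a)) * ρ ^ 2 = 2 * (C' * ρ ^ 2) + 16 * c := by rw [hc]; ring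
  rw [e5, abs_le]
  constructor <;> linarith [p1'.1, p1'.2, p2'.1, p2'.2]

/-! ### The unit disc and its segments -/

/-- The plane in Cartesian coordinates. -/
def cartesian : ℝ × ℝ ≃ᵐ Plane :=
  MeasurableEquiv.finTwoArrow.symm.trans (MeasurableEquiv.toLp 2 (Fin 2 → ℝ))

lemma cartesian_apply (w : ℝ × ℝ) : cartesian w = !₂[w.1, w.2] := rfl

lemma measurePreserving_cartesian : MeasurePreserving cartesian :=
  (PiLp.volume_preserving_toLp (Fin 2)).comp (volume_preserving_finTwoArrow ℝ).symm

lemma area_eq_cartesian (S : Set Plane) : area S = volume.real (cartesian ⁻¹' S) := by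
  rw [area, measureReal_def, measureReal_def, measurePreserving_cartesian.measure_preimage_equiv]

/-- The closed unit disc. -/
def disc : Set (ℝ × ℝ) := {w | w.1 ^ 2 + w.2 ^ 2 ≤ 1}

/-- The area of the part of the unit disc on which the first coordinate is at most `c`. -/
def discArea (c : ℝ) : ℝ := subArea disc Prod.fst c

lemma mem_closedBall_cartesian (w : ℝ × ℝ) :
    cartesian w ∈ Metric.closedBall (0 : Plane) 1 ↔ w ∈ disc := by
  rw [mem_closedBall_zero_iff, cartesian_apply, EuclideanSpace.norm_eq, Real.sqrt_le_left zero_le_one]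
  simp [disc, Fin.sum_univ_two]

lemma volume_disc : volume.real disc = Real.pi := by
  have : disc = cartesian ⁻¹' Metric.closedBall (0 : Plane) 1 := by
    ext w; exact (mem_closedBall_cartesian w).symm
  rw [this, ← area_eq_cartesian, area, measureReal_def, EuclideanSpace.volume_closedBall_fin_two]
  simp [Real.pi_pos.le]

lemma area_closedBall_le (c : ℝ) :
    area {x : Plane | x ∈ Metric.closedBall (0 : Plane) 1 ∧ x 0 ≤ c} = discArea c := by
  rw [area_eq_cartesian, discArea, subArea]
  congr 1
  ext w
  simp only [mem_preimage, mem_ofPred_eq, mem_closedBall_cartesian]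
  rw [cartesian_apply]; simp

/-- The disc is a local model with no error terms at every scale, so the strip and median estimates
apply to it without separate integration. -/
lemma localModel_disc (ρ : ℝ) : LocalModel 1 0 0 (fun _ => 0) 0 ρ disc Prod.fst where
  subset w hw := by
    have hw : w.1 ^ 2 + w.2 ^ 2 ≤ 1 := hw
    exact ⟨abs_le.2 ⟨by nlinarith [sq_nonneg w.2], by nlinarith [sq_nonneg w.2]⟩,
      abs_le.2 ⟨by nlinarith [sq_nonneg w.1], by nlinarith [sq_nonneg w.1]⟩⟩
  upper w hw := by
    have hw : w.1 ^ 2 + w.2 ^ 2 ≤ 1 := hw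
    simpa [quadN] using hw
  lower w _ _ h := by
    simpa [quadN, disc] using h
  cont := continuous_fst.continuousOn
  incr y₁ y₂ z _ _ := by simp
  base z _ := by simp

lemma continuous_discArea : Continuous discArea :=
  (localModel_disc 1).continuous_subArea (by norm_num)

lemma monotone_discArea : Monotone discArea := (localModel_disc 1).monotone_subArea

/-- The part of the open disc between the two lines is open and nonempty. Strict monotonicity is
what later identifies the limit for a fixed quantile. -/
lemma discArea_lt {c c' : ℝ} (h : c < c') (h1 : -1 < c') (h2 : c < 1) :
    discArea c < discArea c' := by
  have h3 := (localModel_disc 1).subArea_sub h.le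
  set S : Set (ℝ × ℝ) := {w | w.1 ^ 2 + w.2 ^ 2 < 1 ∧ c < w.1 ∧ w.1 < c'} with hS
  have hopen : IsOpen S := by
    have o1 : IsOpen {w : ℝ × ℝ | w.1 ^ 2 + w.2 ^ 2 < 1} := isOpen_lt (by fun_prop) (by fun_prop)
    have o2 : IsOpen {w : ℝ × ℝ | c < w.1} := isOpen_lt (by fun_prop) (by fun_prop)
    have o3 : IsOpen {w : ℝ × ℝ | w.1 < c'} := isOpen_lt (by fun_prop) (by fun_prop)
    exact o1.inter (o2.inter o3)
  have hne : S.Nonempty := by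
    obtain ⟨x, hx1, hx2⟩ := exists_between (max_lt (lt_min h h2) (lt_min h1 (by norm_num)) :
      max c (-1) < min c' 1)
    obtain ⟨a1, a2⟩ := max_lt_iff.1 hx1
    obtain ⟨a3, a4⟩ := lt_min_iff.1 hx2
    exact ⟨(x, 0), by simp only []; nlinarith, a1, a3⟩
  have hpos := hopen.measure_pos volume hne
  have hsub : S ⊆ {w | w ∈ disc ∧ c < w.1 ∧ w.1 ≤ c'} := fun w hw =>
    ⟨hw.1.le, hw.2.1, hw.2.2.le⟩
  have hfin : volume {w | w ∈ disc ∧ c < w.1 ∧ w.1 ≤ c'} ≠ ⊤ :=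
    (volume_lt_top_of_subset_box fun w hw => (localModel_disc 1).subset hw.1).ne
  have : 0 < volume.real {w | w ∈ disc ∧ c < w.1 ∧ w.1 ≤ c'} :=
    ENNReal.toReal_pos (hpos.trans_le (measure_mono hsub)).ne' hfin
  unfold discArea
  linarith

lemma discArea_of_one_le {c : ℝ} (h : 1 ≤ c) : discArea c = Real.pi := by
  rw [← volume_disc, discArea, subArea]
  congr 1
  ext w
  refine and_iff_left_of_imp fun hw => ?_
  have hw : w.1 ^ 2 + w.2 ^ 2 ≤ 1 := hw
  nlinarith [sq_nonneg w.2]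

lemma discArea_of_le {c : ℝ} (h : c ≤ -1) : discArea c = 0 := by
  have : {w | w ∈ disc ∧ w.1 ≤ c} ⊆ {((-1 : ℝ), (0 : ℝ))} := by
    rintro w ⟨hw, hwc⟩
    have hw : w.1 ^ 2 + w.2 ^ 2 ≤ 1 := hw
    have h1 : w.2 = 0 := by nlinarith [sq_nonneg w.2]
    have h2 : w.1 = -1 := by nlinarith [sq_nonneg w.2]
    exact Prod.ext h2 h1
  rw [discArea, subArea, measureReal_def, measure_mono_null this (measure_singleton _),
    ENNReal.toReal_zero]

lemma isCubic_zero (b₁ b₂ : ℝ) : IsCubic b₁ b₂ (fun _ => 0) 0 where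
  continuous := continuous_const
  smul r w := by simp
  nonneg := le_rfl
  bound w := by simp

/-- The median estimate holds for the same disc at every small `ρ` with vanishing asymmetry, so the
defect is bounded by `C' ρ²` for all of them and is zero. -/
lemma discArea_zero : discArea 0 = Real.pi / 2 := by
  obtain ⟨C', hC', δ, hδ, H⟩ := exists_median_estimate (a := 1) (b₁ := 0) (b₂ := 0) (C := 0) (K := 0)
    one_pos le_rfl le_rfl
  have h1 : ∀ᶠ ρ : ℝ in 𝓝[>] 0, |2 * discArea 0 - Real.pi| ≤ C' * ρ ^ 2 := by
    filter_upwards [Ioo_mem_nhdsGT hδ] with ρ hρ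
    have := H ρ _ _ _ hρ.1 hρ.2 (isCubic_zero 0 0) (localModel_disc ρ)
    simpa [asymm, volume_disc, discArea] using this
  have h2 : Tendsto (fun ρ : ℝ => C' * ρ ^ 2) (𝓝[>] 0) (𝓝 0) := by
    have : Tendsto (fun ρ : ℝ => C' * ρ ^ 2) (𝓝 0) (𝓝 (C' * 0 ^ 2)) :=
      Continuous.tendsto (by fun_prop) 0
    simpa using this.mono_left nhdsWithin_le_nhds
  have h3 := ge_of_tendsto h2 h1
  have h4 := abs_eq_zero.1 (le_antisymm h3 (abs_nonneg _))
  linarith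

/-- This expresses that the area function of the disc has derivative `2`, the length of the
diameter, at `0`. -/
lemma exists_discArea_strip {ε : ℝ} (hε : 0 < ε) :
    ∃ δ > 0, ∀ t₁ t₂, |t₁| ≤ δ → |t₂| ≤ δ → t₁ ≤ t₂ →
      |discArea t₂ - discArea t₁ - 2 * (t₂ - t₁)| ≤ ε * (t₂ - t₁) := by
  obtain ⟨δ, hδ, H⟩ := exists_strip_estimate (a := 1) (b₁ := 0) (b₂ := 0) (C := 0) (M := 0)
    (T := fun _ => 0) one_pos le_rfl (by simp) hε
  refine ⟨δ, hδ, fun t₁ t₂ h1 h2 h => ?_⟩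
  have := H (δ / 2) _ _ (by positivity) (by linarith) (localModel_disc _) t₁ t₂ h1 h2 h
  simpa [nu, discArea] using this

/-! ### Zeroth order: ellipses -/

/-- A triangular factorisation of `I + b bᵀ`, divided by `r`, maps the ellipse to the unit disc with
determinant `ν(s) / r²`. Being lower triangular, it only rescales the first coordinate, by `ν(s) /
(ν(b₂) r)`, so half planes `y ≤ const` stay of that form. -/
lemma volume_quadN_le {a b₁ b₂ s r : ℝ} (ha : 0 < a) (hs : s ^ 2 = b₁ ^ 2 + b₂ ^ 2) (hr : 0 < r)
    (t : ℝ) :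
    volume.real {w | quadN b₁ b₂ w ≤ r ^ 2 ∧ a * w.1 ≤ t} =
      r ^ 2 / nu s * discArea (t / (a * (nu b₂ / nu s) * r)) := by
  have h1 := nu_pos s
  have h2 := nu_pos b₂
  have hs2 := nu_sq s
  have hb2 := nu_sq b₂
  set L := Matrix.toLin (Module.Basis.finTwoProd ℝ) (Module.Basis.finTwoProd ℝ)
    !![nu s / nu b₂ / r, 0; b₁ * b₂ / nu b₂ / r, nu b₂ / r] with hL
  have hLa : ∀ w, L w = (nu s / nu b₂ / r * w.1, b₁ * b₂ / nu b₂ / r * w.1 + nu b₂ / r * w.2) := by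
    intro w; rw [hL, Matrix.toLin_finTwoProd_apply]; simp
  have hdet : LinearMap.det L = nu s / r ^ 2 := by
    rw [hL, LinearMap.det_toLin, Matrix.det_fin_two_of]; field_simp; ring
  have hset : {w | quadN b₁ b₂ w ≤ r ^ 2 ∧ a * w.1 ≤ t} =
      L ⁻¹' {w | w ∈ disc ∧ w.1 ≤ t / (a * (nu b₂ / nu s) * r)} := by
    ext w
    simp only [mem_ofPred_eq, mem_preimage, disc, hLa]
    refine and_congr ?_ ?_
    · have : (nu s / nu b₂ / r * w.1) ^ 2 + (b₁ * b₂ / nu b₂ / r * w.1 + nu b₂ / r * w.2) ^ 2 =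
          quadN b₁ b₂ w / r ^ 2 := by
        have e1 : (nu s / nu b₂ / r * w.1) ^ 2 = (1 + s ^ 2) / (1 + b₂ ^ 2) / r ^ 2 * w.1 ^ 2 := by
          rw [← hs2, ← hb2]; field_simp
        have e2 : (b₁ * b₂ / nu b₂ / r * w.1 + nu b₂ / r * w.2) ^ 2 =
            (b₁ ^ 2 * b₂ ^ 2 / (1 + b₂ ^ 2) * w.1 ^ 2 + 2 * (b₁ * b₂) * w.1 * w.2 +
              (1 + b₂ ^ 2) * w.2 ^ 2) / r ^ 2 := by
          rw [← hb2]; field_simp; ring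
        rw [e1, e2, hs, quadN]
        have : 1 + b₂ ^ 2 ≠ 0 := by positivity
        field_simp; ring
      rw [this, div_le_one (by positivity)]
    · rw [le_div_iff₀ (by positivity)]
      have : nu s / nu b₂ / r * w.1 * (a * (nu b₂ / nu s) * r) = a * w.1 := by
        field_simp
      rw [this]
  rw [hset, measureReal_def, Measure.addHaar_preimage_linearMap volume (by rw [hdet]; positivity),
    ENNReal.toReal_mul, hdet, ENNReal.toReal_ofReal (abs_nonneg _), abs_of_pos (by positivity),
    inv_div, discArea, subArea, measureReal_def]

/-- The zeroth order asymptotics of the areas in a rescaled amoeba. -/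
lemma exists_subArea_limit {a b₁ b₂ s C M : ℝ} {T : ℝ × ℝ → ℝ} (ha : 0 < a) (hC : 0 ≤ C)
    (hs : s ^ 2 = b₁ ^ 2 + b₂ ^ 2) (hM : ∀ w ∈ box, |T w| ≤ M) (t : ℝ) {ε : ℝ} (hε : 0 < ε) :
    ∃ δ > 0, ∀ ρ A U, 0 < ρ → ρ < δ → LocalModel a b₁ b₂ T C ρ A U →
      |subArea A U t - 1 / nu s * discArea (t / (a * (nu b₂ / nu s)))| < ε := by
  have h1 := nu_pos s
  have h2 := nu_pos b₂
  have hM0 : 0 ≤ M := (abs_nonneg _).trans (hM 0 (by simp [box]))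
  -- `F x` is the area for the ellipse of radius `1 + x` cut at level `t + x`. With `x = ρ (M + 3 C
  -- + 1)`, which dominates all error terms in the box, the area in question lies between `F (-x)`
  -- and `F x`.
  set F : ℝ → ℝ := fun x =>
    (1 + x) ^ 2 / nu s * discArea ((t + x) / (a * (nu b₂ / nu s) * (1 + x))) with hF
  have hF0 : F 0 = 1 / nu s * discArea (t / (a * (nu b₂ / nu s))) := by simp [hF]
  have hFc : ContinuousAt F 0 := by
    refine ContinuousAt.mul (by fun_prop) ?_
    refine continuous_discArea.continuousAt.comp ?_
    refine ContinuousAt.div (by fun_prop) (by fun_prop) ?_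
    rw [add_zero, mul_one]; positivity
  obtain ⟨η, hη, hηF⟩ := Metric.continuousAt_iff.1 hFc ε hε
  set L := M + 3 * C + 1 with hL
  refine ⟨min 1 (min η (1 / 2) / L), by positivity, fun ρ A U hρ hρδ h => ?_⟩
  have hρ1 : ρ < 1 := hρδ.trans_le (min_le_left _ _)
  have hx := hρδ.trans_le (min_le_right _ _)
  rw [lt_div_iff₀ (by positivity)] at hx
  set x := ρ * L with hxdef
  have hx0 : 0 < x := by positivity
  have hxη : x < η := hx.trans_le (min_le_left _ _)
  have hx2 : x < 1 / 2 := hx.trans_le (min_le_right _ _)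
  have hxe : x = ρ * M + 3 * (C * ρ) + ρ := by rw [hxdef, hL]; ring
  have hCρ : 0 ≤ C * ρ := by positivity
  have hMρ : 0 ≤ ρ * M := by positivity
  have hCρ2 : C * ρ ^ 2 ≤ C * ρ := by nlinarith
  have hT : ∀ w ∈ box, |ρ * T w| ≤ ρ * M := fun w hw => by
    rw [abs_mul, abs_of_pos hρ]; exact mul_le_mul_of_nonneg_left (hM w hw) hρ.le
  have hU : ∀ w ∈ box, |U w - a * w.1| ≤ x := fun w hw => by
    have h3 := h.abs_U_sub_le hw
    have h4 := mul_le_mul_of_nonneg_left hw.1 hCρ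
    linarith
  have hball : ∀ r, 0 ≤ r → r ≤ 2 → ∀ w, quadN b₁ b₂ w ≤ r ^ 2 → w ∈ box := by
    intro r hr hr2 w hw
    have : normN b₁ b₂ w ≤ r := by rw [normN, Real.sqrt_le_left hr]; exact hw
    exact ⟨(abs_fst_le_normN _ _ _).trans (by linarith), (abs_snd_le_normN _ _ _).trans (by linarith)⟩
  have s1 : {w | w ∈ A ∧ U w ≤ t} ⊆ {w | quadN b₁ b₂ w ≤ (1 + x) ^ 2 ∧ a * w.1 ≤ t + x} := by
    rintro w ⟨hwA, hwU⟩
    have hw := h.subset hwA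
    have h3 := abs_le.1 (hT w hw)
    have h4 := abs_le.1 (hU w hw)
    have h5 := h.upper w hwA
    refine ⟨?_, by linarith [h4.1]⟩
    nlinarith [h3.1]
  have s2 : {w | quadN b₁ b₂ w ≤ (1 + -x) ^ 2 ∧ a * w.1 ≤ t + -x} \ {0} ⊆ {w | w ∈ A ∧ U w ≤ t} := by
    rintro w ⟨⟨hq, hwU⟩, hw0⟩
    have hw := hball (1 + -x) (by linarith) (by linarith) w hq
    have h3 := abs_le.1 (hT w hw)
    have h4 := abs_le.1 (hU w hw)
    refine ⟨h.lower w hw hw0 ?_, by linarith [h4.2]⟩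
    nlinarith [h3.2]
  have v1 := measureReal_mono (μ := volume) s1
    (volume_lt_top_of_subset_box fun w hw => hball (1 + x) (by linarith) (by linarith) w hw.1).ne
  have v2 := measureReal_mono (μ := volume) s2
    (volume_lt_top_of_subset_box fun w hw => h.subset hw.1).ne
  rw [volume_real_diff_zero] at v2
  rw [volume_quadN_le ha hs (by linarith)] at v1 v2
  have f1 := hηF (x := x) (by rw [dist_zero_right, Real.norm_eq_abs, abs_of_pos hx0]; exact hxη)
  have f2 := hηF (x := -x)
    (by rw [dist_zero_right, Real.norm_eq_abs, abs_neg, abs_of_pos hx0]; exact hxη)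
  rw [Real.dist_eq, abs_lt, hF0] at f1 f2
  have v1' : subArea A U t ≤ F x := v1
  have v2' : F (-x) ≤ subArea A U t := v2
  rw [abs_lt]
  constructor <;> linarith [f1.1, f1.2, f2.1, f2.2]

/-- The limit of the area of the rescaled amoebas. -/
lemma exists_volume_limit {a b₁ b₂ s C M : ℝ} {T : ℝ × ℝ → ℝ} (ha : 0 < a) (hC : 0 ≤ C)
    (hs : s ^ 2 = b₁ ^ 2 + b₂ ^ 2) (hM : ∀ w ∈ box, |T w| ≤ M) {ε : ℝ} (hε : 0 < ε) :
    ∃ δ > 0, ∀ ρ A U, 0 < ρ → ρ < δ → LocalModel a b₁ b₂ T C ρ A U →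
      |volume.real A - Real.pi / nu s| < ε := by
  -- In the box `U ≤ 2 a + 3 C ρ`, which is below `3 a` for small `ρ`; hence the level `3 a` cuts
  -- off the whole amoeba.
  obtain ⟨δ, hδ, H⟩ := exists_subArea_limit ha hC hs hM (3 * a) hε
  have h1 := nu_pos s
  have h2 := nu_pos b₂
  have h3 : nu b₂ ≤ nu s := Real.sqrt_le_sqrt (by nlinarith [sq_nonneg b₁])
  refine ⟨min δ (min 1 (a / (3 * (C + 1)))), by positivity, fun ρ A U hρ hρδ h => ?_⟩
  have h4 := H ρ A U hρ (hρδ.trans_le (min_le_left _ _)) h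
  have hρ1 : ρ < 1 := hρδ.trans_le ((min_le_right _ _).trans (min_le_left _ _))
  have hρ2 : ρ < a / (3 * (C + 1)) := hρδ.trans_le ((min_le_right _ _).trans (min_le_right _ _))
  rw [lt_div_iff₀ (by positivity)] at hρ2
  have h5 : 1 ≤ 3 * a / (a * (nu b₂ / nu s)) := by
    rw [le_div_iff₀ (by positivity)]
    have : nu b₂ / nu s ≤ 1 := (div_le_one h1).2 h3
    nlinarith
  rw [discArea_of_one_le h5] at h4
  have h6 : subArea A U (3 * a) = volume.real A := by
    rw [subArea]
    congr 1
    ext w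
    refine and_iff_left_of_imp fun hw => ?_
    have hwb := h.subset hw
    have h7 := (abs_le.1 (h.abs_U_sub_le hwb)).2
    have h8 : C * ρ * |w.1| ≤ C * ρ * 2 := mul_le_mul_of_nonneg_left hwb.1 (by positivity)
    have h9 : C * ρ ^ 2 ≤ C * ρ := by nlinarith [mul_nonneg hC hρ.le]
    have h10 : a * w.1 ≤ a * 2 := mul_le_mul_of_nonneg_left ((le_abs_self _).trans hwb.1) ha.le
    linarith
  rw [h6] at h4
  convert h4 using 2
  ring

/-! ### The straightening chart and its Jacobian -/

/-- The shear `(y, z) ↦ (y - c z ^ 2, z)`. -/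
def shear (c : ℝ) : ℝ × ℝ ≃ᵐ ℝ × ℝ where
  toFun w := (w.1 - c * w.2 ^ 2, w.2)
  invFun w := (w.1 + c * w.2 ^ 2, w.2)
  left_inv w := by simp
  right_inv w := by simp
  measurable_toFun := by simp only [Equiv.coe_fn_mk]; fun_prop
  measurable_invFun := by simp only [Equiv.coe_fn_symm_mk]; fun_prop

lemma measurePreserving_shear (c : ℝ) : MeasurePreserving (shear c) := by
  have h1 : MeasurePreserving (fun p : ℝ × ℝ => (p.1, p.2 - c * p.1 ^ 2))
      (volume.prod volume) (volume.prod volume) := by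
    refine (MeasurePreserving.id volume).skew_product (g := fun z y => y - c * z ^ 2)
      (by unfold Function.uncurry; fun_prop) ?_
    refine Eventually.of_forall fun z => ?_
    exact (measurePreserving_sub_right volume (c * z ^ 2)).map_eq
  exact (Measure.measurePreserving_swap.comp h1).comp Measure.measurePreserving_swap

/-- Rescaled coordinates about `x₀` in the frame `(e, rot e)`, with a parabolic correction. -/
def chart (x₀ e : Plane) (k ρ : ℝ) (w : ℝ × ℝ) : Plane :=
  x₀ + ρ • ((w.1 - ρ * k / 2 * w.2 ^ 2) • e + w.2 • rot e)

/-- The chart is a translation after a dilation by `ρ`, a rotation and a shear. The parabolic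
correction is area preserving, so the factor `ρ²` is exact for every set, measurable or not. -/
lemma area_eq_chart (x₀ : Plane) {e : Plane} (he : ‖e‖ = 1) (k : ℝ) {ρ : ℝ} (hρ : 0 < ρ)
    (S : Set Plane) : area S = ρ ^ 2 * volume.real (chart x₀ e k ρ ⁻¹' S) := by
  have he' : e 0 ^ 2 + e 1 ^ 2 = 1 := by
    have := EuclideanSpace.norm_sq_eq e
    rw [he, Fin.sum_univ_two] at this
    simpa using this.symm
  set L := Matrix.toLin (Module.Basis.finTwoProd ℝ) (Module.Basis.finTwoProd ℝ)
    !![e 0, -(e 1); e 1, e 0] with hL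
  have hLa : ∀ w, L w = (e 0 * w.1 - e 1 * w.2, e 1 * w.1 + e 0 * w.2) := by
    intro w; rw [hL, Matrix.toLin_finTwoProd_apply]; simp [sub_eq_add_neg]
  have hdet : LinearMap.det L = 1 := by
    rw [hL, LinearMap.det_toLin, Matrix.det_fin_two_of]; linarith
  have hset : chart x₀ e k ρ ⁻¹' S = shear (ρ * k / 2) ⁻¹' (L ⁻¹' (cartesian ⁻¹'
      ((fun x => ρ • x) ⁻¹' ((fun x => x₀ + x) ⁻¹' S)))) := by
    ext w
    simp only [mem_preimage, hLa]
    have : chart x₀ e k ρ w = x₀ + ρ • cartesian (e 0 * (shear (ρ * k / 2) w).1 -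
        e 1 * (shear (ρ * k / 2) w).2, e 1 * (shear (ρ * k / 2) w).1 +
        e 0 * (shear (ρ * k / 2) w).2) := by
      rw [chart, cartesian_apply]
      congr 2
      ext i
      fin_cases i <;> simp [shear, rot] <;> ring
    rw [this]
  rw [hset, measureReal_def, (measurePreserving_shear _).measure_preimage_equiv,
    Measure.addHaar_preimage_linearMap volume (by rw [hdet]; norm_num),
    measurePreserving_cartesian.measure_preimage_equiv,
    Measure.addHaar_preimage_smul volume hρ.ne', measure_preimage_add, hdet, area, measureReal_def,
    ENNReal.toReal_mul, ENNReal.toReal_mul, ENNReal.toReal_ofReal (abs_nonneg _),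
    ENNReal.toReal_ofReal (abs_nonneg _), abs_of_pos (by positivity : (0 : ℝ) < (ρ ^ _)⁻¹)]
  simp
  field_simp

/-! ### Uniform Taylor estimates -/

/-- The mean value inequality on the ball of radius `‖v‖`, where the derivative is at most `C ‖v‖ ^
n`. Each use raises the order of a remainder by one. -/
lemma norm_le_pow_succ_of_hasFDerivAt {E G : Type*} [NormedAddCommGroup E] [NormedSpace ℝ E]
    [NormedAddCommGroup G] [NormedSpace ℝ G] {g : E → G} {g' : E → E →L[ℝ] G} {C r : ℝ} {n : ℕ}
    (hC : 0 ≤ C) (hg : ∀ v, ‖v‖ ≤ r → HasFDerivAt g (g' v) v)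
    (hb : ∀ v, ‖v‖ ≤ r → ‖g' v‖ ≤ C * ‖v‖ ^ n) (h0 : g 0 = 0) {v : E} (hv : ‖v‖ ≤ r) :
    ‖g v‖ ≤ C * ‖v‖ ^ (n + 1) := by
  have h1 : ∀ w ∈ Metric.closedBall (0 : E) ‖v‖, ‖w‖ ≤ ‖v‖ := fun w hw =>
    mem_closedBall_zero_iff.1 hw
  have := (convex_closedBall (0 : E) ‖v‖).norm_image_sub_le_of_norm_hasFDerivWithin_le
    (f := g) (f' := g') (C := C * ‖v‖ ^ n) (x := 0) (y := v)
    (fun w hw => (hg w ((h1 w hw).trans hv)).hasFDerivWithinAt)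
    (fun w hw => (hb w ((h1 w hw).trans hv)).trans
      (mul_le_mul_of_nonneg_left (pow_le_pow_left₀ (norm_nonneg _) (h1 w hw) n) hC))
    (by simp) (by simp)
  rw [h0, sub_zero, sub_zero] at this
  rwa [pow_succ, ← mul_assoc]

lemma hasFDerivAt_translate {E G : Type*} [NormedAddCommGroup E] [NormedSpace ℝ E]
    [NormedAddCommGroup G] [NormedSpace ℝ G] {g : E → G} {g' : E →L[ℝ] G} (x : E) {v : E}
    (h : HasFDerivAt g g' (x + v)) : HasFDerivAt (fun v => g (x + v)) g' v := by
  simpa [Function.comp_def] using h.comp v ((hasFDerivAt_id v).const_add x)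

/-- Uniform Taylor estimates near a point. -/
structure HasTaylorBound (f : Plane → ℝ) (x₀ : Plane) (C r : ℝ) : Prop where
  differentiableAt : ∀ v, ‖v‖ ≤ r → DifferentiableAt ℝ f (x₀ + v)
  lipschitz : ∀ v, ‖v‖ ≤ r → ‖fderiv ℝ f (x₀ + v) - fderiv ℝ f x₀‖ ≤ C * ‖v‖
  cubic : ∀ v, ‖v‖ ≤ r →
    |f (x₀ + v) - f x₀ - fderiv ℝ f x₀ v - d2 f x₀ v v / 2| ≤ C * ‖v‖ ^ 3

lemma HasTaylorBound.mono {f : Plane → ℝ} {x₀ : Plane} {C r C' r' : ℝ} (h : HasTaylorBound f x₀ C r)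
    (hC : C ≤ C') (hr : r' ≤ r) : HasTaylorBound f x₀ C' r' where
  differentiableAt v hv := h.differentiableAt v (hv.trans hr)
  lipschitz v hv := (h.lipschitz v (hv.trans hr)).trans (by gcongr)
  cubic v hv := (h.cubic v (hv.trans hr)).trans (by gcongr)

lemma d2_symm {f : Plane → ℝ} {x₀ : Plane} (hf : ContDiffAt ℝ 3 f x₀) (v w : Plane) :
    d2 f x₀ v w = d2 f x₀ w v :=
  (hf.isSymmSndFDerivAt (by simp; norm_num)).eq v w

lemma exists_lipschitz_near {G : Type*} [NormedAddCommGroup G] [NormedSpace ℝ G]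
    {g : Plane → G} {x₀ : Plane} (hg : ContDiffAt ℝ 1 g x₀) :
    ∃ K ≥ 0, ∀ᶠ x in 𝓝 x₀, ‖g x - g x₀‖ ≤ K * ‖x - x₀‖ := by
  obtain ⟨K, t, ht, hK⟩ := hg.exists_lipschitzOnWith
  refine ⟨K, K.2, ?_⟩
  filter_upwards [ht] with x hx
  exact hK.norm_sub_le hx (mem_of_mem_nhds ht)

/-- The second derivative is Lipschitz at `x₀`. Two applications of the mean value estimate, first
to the remainder of `fderiv ℝ f` and then to that of `f`, give the cubic bound. Symmetry of the
second derivative identifies the derivative of the quadratic term. -/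
lemma exists_hasTaylorBound {f : Plane → ℝ} {x₀ : Plane} (hf : ContDiffAt ℝ 3 f x₀) :
    ∃ C ≥ 0, ∃ r > 0, HasTaylorBound f x₀ C r := by
  have h1 : ContDiffAt ℝ 2 (fderiv ℝ f) x₀ := hf.fderiv_right (by norm_num)
  have h2 : ContDiffAt ℝ 1 (fderiv ℝ (fderiv ℝ f)) x₀ := h1.fderiv_right (by norm_num)
  obtain ⟨K₁, hK₁, e1⟩ := exists_lipschitz_near (h1.of_le (by norm_num))
  obtain ⟨K₂, hK₂, e2⟩ := exists_lipschitz_near h2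
  have e3 : ∀ᶠ x in 𝓝 x₀, ContDiffAt ℝ 3 f x := hf.eventually (by decide)
  have e4 : ∀ᶠ x in 𝓝 x₀, ContDiffAt ℝ 2 (fderiv ℝ f) x := h1.eventually (by decide)
  obtain ⟨r, hr, H⟩ := Metric.nhds_basis_closedBall.eventually_iff.1 (((e1.and e2).and e3).and e4)
  have hb : ∀ v : Plane, ‖v‖ ≤ r → x₀ + v ∈ Metric.closedBall x₀ r := fun v hv => by
    simpa [mem_closedBall_iff_norm] using hv
  have hdf : ∀ v : Plane, ‖v‖ ≤ r → HasFDerivAt f (fderiv ℝ f (x₀ + v)) (x₀ + v) := fun v hv =>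
    ((H (hb v hv)).1.2.differentiableAt (by norm_num)).hasFDerivAt
  have hddf : ∀ v : Plane, ‖v‖ ≤ r →
      HasFDerivAt (fderiv ℝ f) (fderiv ℝ (fderiv ℝ f) (x₀ + v)) (x₀ + v) := fun v hv =>
    ((H (hb v hv)).2.differentiableAt (by norm_num)).hasFDerivAt
  have hq : ∀ v : Plane, ‖v‖ ≤ r →
      ‖fderiv ℝ f (x₀ + v) - fderiv ℝ f x₀ - fderiv ℝ (fderiv ℝ f) x₀ v‖ ≤ K₂ * ‖v‖ ^ (1 + 1) := by
    intro v hv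
    refine norm_le_pow_succ_of_hasFDerivAt (r := r)
      (g := fun v => fderiv ℝ f (x₀ + v) - fderiv ℝ f x₀ - fderiv ℝ (fderiv ℝ f) x₀ v)
      (g' := fun v => fderiv ℝ (fderiv ℝ f) (x₀ + v) - fderiv ℝ (fderiv ℝ f) x₀)
      hK₂ (fun w hw => ?_) (fun w hw => ?_) (by simp) hv
    · refine ((hasFDerivAt_translate x₀ (hddf w hw)).sub_const _).sub ?_
      exact (fderiv ℝ (fderiv ℝ f) x₀).hasFDerivAt
    · simpa using (H (hb w hw)).1.1.2
  refine ⟨max K₁ K₂, le_max_of_le_left hK₁, r, hr, ?_, ?_, ?_⟩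
  · exact fun v hv => (hdf v hv).differentiableAt
  · intro v hv
    have := (H (hb v hv)).1.1.1
    rw [add_sub_cancel_left] at this
    exact this.trans (by gcongr; exact le_max_left _ _)
  · intro v hv
    refine (?_ : _ ≤ K₂ * ‖v‖ ^ (2 + 1)).trans (by norm_num; gcongr; exact le_max_right _ _)
    refine norm_le_pow_succ_of_hasFDerivAt (r := r)
      (g := fun v => f (x₀ + v) - f x₀ - fderiv ℝ f x₀ v - d2 f x₀ v v / 2)
      (g' := fun v => fderiv ℝ f (x₀ + v) - fderiv ℝ f x₀ - fderiv ℝ (fderiv ℝ f) x₀ v)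
      hK₂ (fun w hw => ?_) (fun w hw => hq w hw) (by simp [d2]) hv
    have hB : HasFDerivAt (fun v => d2 f x₀ v v / 2) (fderiv ℝ (fderiv ℝ f) x₀ w) w := by
      have h3 : HasFDerivAt (fun v => d2 f x₀ v v) _ w :=
        ((fderiv ℝ (fderiv ℝ f) x₀).hasFDerivAt (x := w)).clm_apply (hasFDerivAt_id w)
      convert! h3.mul_const (2⁻¹ : ℝ) using 1
      ext z
      have := d2_symm hf z w
      simp only [d2] at this
      simp [this]
      ring
    exact (((hasFDerivAt_translate x₀ (hdf w hw)).sub_const _).sub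
      (fderiv ℝ f x₀).hasFDerivAt).sub hB

lemma HasTaylorBound.quadratic {f : Plane → ℝ} {x₀ : Plane} {C r : ℝ} (hC : 0 ≤ C)
    (h : HasTaylorBound f x₀ C r) {v : Plane} (hv : ‖v‖ ≤ r) :
    |f (x₀ + v) - f x₀ - fderiv ℝ f x₀ v| ≤ C * ‖v‖ ^ 2 := by
  refine norm_le_pow_succ_of_hasFDerivAt (n := 1) (r := r)
    (g := fun v => f (x₀ + v) - f x₀ - fderiv ℝ f x₀ v)
    (g' := fun v => fderiv ℝ f (x₀ + v) - fderiv ℝ f x₀) hC (fun w hw => ?_)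
    (fun w hw => ?_) (by simp) hv
  · exact ((hasFDerivAt_translate x₀ (h.differentiableAt w hw).hasFDerivAt).sub_const _).sub
      (fderiv ℝ f x₀).hasFDerivAt
  · simpa using h.lipschitz w hw

/-- Increments near `x₀` are close to those of the linearisation. -/
lemma HasTaylorBound.increment {f : Plane → ℝ} {x₀ : Plane} {C r R : ℝ}
    (h : HasTaylorBound f x₀ C r) (hC : 0 ≤ C) (hR : R ≤ r) {v w : Plane} (hv : ‖v‖ ≤ R)
    (hw : ‖w‖ ≤ R) :
    |f (x₀ + w) - f (x₀ + v) - fderiv ℝ f x₀ (w - v)| ≤ C * R * ‖w - v‖ := by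
  have := (convex_closedBall (0 : Plane) R).norm_image_sub_le_of_norm_hasFDerivWithin_le
    (f := fun v => f (x₀ + v) - fderiv ℝ f x₀ v)
    (f' := fun v => fderiv ℝ f (x₀ + v) - fderiv ℝ f x₀) (C := C * R) (x := v) (y := w)
    (fun z hz => ?_) (fun z hz => ?_) (by simpa using hv) (by simpa using hw)
  · rw [Real.norm_eq_abs] at this
    convert! this using 2
    rw [map_sub]; ring
  · have hz' : ‖z‖ ≤ R := by simpa using hz
    exact ((hasFDerivAt_translate x₀ (h.differentiableAt z (hz'.trans hR)).hasFDerivAt).sub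
      (fderiv ℝ f x₀).hasFDerivAt).hasFDerivWithinAt
  · have hz' : ‖z‖ ≤ R := by simpa using hz
    exact (h.lipschitz z (hz'.trans hR)).trans (by gcongr)

/-! ### Amoeba distance versus chords of the graph -/

lemma continuousOn_speed {f : Plane → ℝ} {c : ℝ → Plane} (hc : ContDiffOn ℝ 1 c (Icc 0 1))
    (hfc : ContDiffOn ℝ 1 (f ∘ c) (Icc 0 1)) :
    ContinuousOn (fun t => Real.sqrt (‖derivWithin c (Icc 0 1) t‖ ^ 2 +
      |derivWithin (f ∘ c) (Icc 0 1) t| ^ 2)) (Icc (0 : ℝ) 1) := by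
  have h1 := hc.continuousOn_derivWithin (uniqueDiffOn_Icc zero_lt_one) le_rfl
  have h2 := hfc.continuousOn_derivWithin (uniqueDiffOn_Icc zero_lt_one) le_rfl
  exact ((h1.norm.pow 2).add (h2.abs.pow 2)).sqrt

lemma curveLength_eq {f : Plane → ℝ} {c : ℝ → Plane} (hc : ContDiffOn ℝ 1 c (Icc 0 1))
    (hfc : ContDiffOn ℝ 1 (f ∘ c) (Icc 0 1)) :
    curveLength f c = ENNReal.ofReal (∫ t in (0 : ℝ)..1,
      Real.sqrt (‖derivWithin c (Icc 0 1) t‖ ^ 2 + |derivWithin (f ∘ c) (Icc 0 1) t| ^ 2)) := by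
  rw [curveLength, intervalIntegral.integral_of_le zero_le_one, ← integral_Icc_eq_integral_Ioc,
    ofReal_integral_eq_lintegral_ofReal]
  · exact (continuousOn_speed hc hfc).integrableOn_compact isCompact_Icc
  · exact Eventually.of_forall fun t => Real.sqrt_nonneg _

lemma integral_derivWithin_eq {G : Type*} [NormedAddCommGroup G] [NormedSpace ℝ G]
    [CompleteSpace G] {h : ℝ → G} (hh : ContDiffOn ℝ 1 h (Icc 0 1)) :
    ∫ t in (0 : ℝ)..1, derivWithin h (Icc 0 1) t = h 1 - h 0 := by
  refine intervalIntegral.integral_eq_sub_of_hasDerivAt_of_le zero_le_one hh.continuousOn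
    (fun t ht => ?_) ?_
  · exact ((hh.differentiableOn (by norm_num)) t (Ioo_subset_Icc_self ht)).hasDerivWithinAt.hasDerivAt
      (Icc_mem_nhds ht.1 ht.2)
  · refine ContinuousOn.intervalIntegrable ?_
    rw [uIcc_of_le zero_le_one]
    exact hh.continuousOn_derivWithin (uniqueDiffOn_Icc zero_lt_one) le_rfl

/-- Length of the chord of the graph of `f`. -/
def chord (f : Plane → ℝ) (p q : Plane) : ℝ := Real.sqrt (‖q - p‖ ^ 2 + (f q - f p) ^ 2)

lemma chord_sq (f : Plane → ℝ) (p q : Plane) :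
    chord f p q ^ 2 = ‖q - p‖ ^ 2 + (f q - f p) ^ 2 := Real.sq_sqrt (by positivity)

lemma chord_nonneg (f : Plane → ℝ) (p q : Plane) : 0 ≤ chord f p q := Real.sqrt_nonneg _

/-- A curve on the graph of `f` is at least as long as the segment in space joining its endpoints.
Cauchy–Schwarz against the constant vector `(q - p, f q - f p)` proves it after integration. -/
lemma chord_le_curveLength {Ω : Set Plane} {f : Plane → ℝ} (hf : ContDiffOn ℝ 1 f Ω) {p q : Plane}
    {c : ℝ → Plane} (hc : IsRegularCurve Ω p q c) :
    ENNReal.ofReal (chord f p q) ≤ curveLength f c := by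
  have hfc : ContDiffOn ℝ 1 (f ∘ c) (Icc 0 1) := hf.comp hc.contDiffOn hc.mapsTo
  rw [curveLength_eq hc.contDiffOn hfc]
  refine ENNReal.ofReal_le_ofReal ?_
  rcases (chord_nonneg f p q).eq_or_lt with h0 | h0
  · rw [← h0]
    exact intervalIntegral.integral_nonneg zero_le_one fun t _ => Real.sqrt_nonneg _
  set S := chord f p q with hS
  have hU := uniqueDiffOn_Icc (zero_lt_one (α := ℝ))
  have c1 := hc.contDiffOn.continuousOn_derivWithin hU le_rfl
  have c2 := hfc.continuousOn_derivWithin hU le_rfl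
  have i1 : IntervalIntegrable (derivWithin c (Icc 0 1)) volume 0 1 := by
    refine ContinuousOn.intervalIntegrable ?_
    rwa [uIcc_of_le zero_le_one]
  have i2 : IntervalIntegrable (derivWithin (f ∘ c) (Icc 0 1)) volume 0 1 := by
    refine ContinuousOn.intervalIntegrable ?_
    rwa [uIcc_of_le zero_le_one]
  have i3 : IntervalIntegrable (fun t => inner ℝ (q - p) (derivWithin c (Icc 0 1) t)) volume 0 1 := by
    refine ContinuousOn.intervalIntegrable ?_
    rw [uIcc_of_le zero_le_one]
    exact continuousOn_const.inner c1
  have i4 : IntervalIntegrable (fun t => (f q - f p) * derivWithin (f ∘ c) (Icc 0 1) t) volume 0 1 :=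
    i2.const_mul _
  have e1 : ∫ t in (0 : ℝ)..1, (inner ℝ (q - p) (derivWithin c (Icc 0 1) t) +
      (f q - f p) * derivWithin (f ∘ c) (Icc 0 1) t) = S * S := by
    rw [intervalIntegral.integral_add i3 i4, intervalIntegral.integral_const_mul,
      integral_derivWithin_eq hfc]
    have := (innerSL ℝ (q - p)).intervalIntegral_comp_comm i1
    simp only [innerSL_apply_apply] at this
    rw [this, integral_derivWithin_eq hc.contDiffOn, hc.source, hc.target,
      real_inner_self_eq_norm_sq, Function.comp, Function.comp, hc.source, hc.target,
      ← sq S, hS, chord_sq]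
    ring
  have i5 : IntervalIntegrable (fun t => Real.sqrt (‖derivWithin c (Icc 0 1) t‖ ^ 2 +
      |derivWithin (f ∘ c) (Icc 0 1) t| ^ 2)) volume 0 1 := by
    refine ContinuousOn.intervalIntegrable ?_
    rw [uIcc_of_le zero_le_one]
    exact continuousOn_speed hc.contDiffOn hfc
  have e2 : S * S ≤ S * ∫ t in (0 : ℝ)..1, Real.sqrt (‖derivWithin c (Icc 0 1) t‖ ^ 2 +
      |derivWithin (f ∘ c) (Icc 0 1) t| ^ 2) := by
    rw [← e1, ← intervalIntegral.integral_const_mul]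
    refine intervalIntegral.integral_mono_on zero_le_one (i3.add i4) (i5.const_mul _) fun t _ => ?_
    set v := derivWithin c (Icc 0 1) t
    set y := derivWithin (f ∘ c) (Icc 0 1) t
    rw [hS, chord, ← Real.sqrt_mul (by positivity)]
    refine Real.le_sqrt_of_sq_le ?_
    have h1 := abs_real_inner_le_norm (q - p) v
    have h2 : inner ℝ (q - p) v + (f q - f p) * y ≤ ‖q - p‖ * ‖v‖ + |f q - f p| * |y| := by
      refine add_le_add ((le_abs_self _).trans h1) ?_
      rw [← abs_mul]; exact le_abs_self _
    have h3 : |inner ℝ (q - p) v + (f q - f p) * y| ≤ ‖q - p‖ * ‖v‖ + |f q - f p| * |y| := by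
      refine (abs_add_le _ _).trans (add_le_add h1 ?_)
      rw [abs_mul]
    rw [← sq_abs, ← sq_abs (f q - f p)]
    refine (pow_le_pow_left₀ (abs_nonneg _) h3 2).trans ?_
    nlinarith [sq_nonneg (‖q - p‖ * |y| - |f q - f p| * ‖v‖)]
  exact le_of_mul_le_mul_left e2 h0

lemma chord_le_of_mem_amoeba {Ω : Set Plane} {f : Plane → ℝ} (hf : ContDiffOn ℝ 1 f Ω)
    {p q : Plane} {ρ : ℝ} (hρ : 0 ≤ ρ) (hq : q ∈ amoeba Ω f p ρ) : chord f p q ≤ ρ := by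
  rw [← ENNReal.ofReal_le_ofReal_iff hρ]
  refine le_trans ?_ hq.2
  exact le_iInf₂ fun c hc => chord_le_curveLength hf hc

/-- The straight segment in the plane is the competitor; `v ≠ 0` makes it regular. Its lift to the
graph exceeds the chord only by `O(‖v‖³)`, because the slope deviates from its mean by `O(‖v‖²)` and
the linear effect of this deviation integrates to zero. -/
lemma mem_amoeba_of_chord_le {Ω : Set Plane} {f : Plane → ℝ} (hf : ContDiffOn ℝ 1 f Ω)
    {x₀ : Plane} {C r ρ : ℝ} (hC : 0 ≤ C) (h : HasTaylorBound f x₀ C r)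
    (hΩ : ∀ v : Plane, ‖v‖ ≤ r → x₀ + v ∈ Ω) {v : Plane} (hv0 : v ≠ 0) (hv : ‖v‖ ≤ r)
    (hρ : chord f x₀ (x₀ + v) + 2 * C ^ 2 * ‖v‖ ^ 3 ≤ ρ) : x₀ + v ∈ amoeba Ω f x₀ ρ := by
  have hvpos : 0 < ‖v‖ := norm_pos_iff.2 hv0
  have hU := uniqueDiffOn_Icc (zero_lt_one (α := ℝ))
  set c : ℝ → Plane := fun t => x₀ + t • v with hc
  have hnorm : ∀ t ∈ Icc (0 : ℝ) 1, ‖t • v‖ ≤ ‖v‖ := fun t ht => by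
    rw [norm_smul, Real.norm_eq_abs, abs_of_nonneg ht.1]
    exact mul_le_of_le_one_left (norm_nonneg _) ht.2
  have hcd : ∀ t : ℝ, HasDerivAt c v t := fun t => by
    have := ((hasDerivAt_id t).smul_const v).const_add x₀
    rw [one_smul] at this
    exact this
  have hcd' : ∀ t ∈ Icc (0 : ℝ) 1, derivWithin c (Icc 0 1) t = v := fun t ht =>
    (hcd t).hasDerivWithinAt.derivWithin (hU t ht)
  have hfd : ∀ t ∈ Icc (0 : ℝ) 1, derivWithin (f ∘ c) (Icc 0 1) t = fderiv ℝ f (x₀ + t • v) v :=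
    fun t ht => by
      have h1 := (h.differentiableAt (t • v) ((hnorm t ht).trans hv)).hasFDerivAt
      exact (h1.comp_hasDerivAt t (hcd t)).hasDerivWithinAt.derivWithin (hU t ht)
  have hreg : IsRegularCurve Ω x₀ (x₀ + v) c :=
    { contDiffOn := by rw [hc]; fun_prop
      regular := fun t ht => by rw [hcd' t ht]; exact hv0
      mapsTo := fun t ht => hΩ _ ((hnorm t ht).trans hv)
      source := by simp [hc]
      target := by simp [hc] }
  have hfc : ContDiffOn ℝ 1 (f ∘ c) (Icc 0 1) := hf.comp hreg.contDiffOn hreg.mapsTo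
  refine ⟨hΩ v hv, (iInf₂_le c hreg).trans ?_⟩
  rw [curveLength_eq hreg.contDiffOn hfc]
  refine ENNReal.ofReal_le_ofReal (le_trans ?_ hρ)
  set S := chord f x₀ (x₀ + v) with hS
  set H := f (x₀ + v) - f x₀ with hH
  have hS2 : S ^ 2 = ‖v‖ ^ 2 + H ^ 2 := by rw [hS, chord_sq, add_sub_cancel_left]
  have hSv : ‖v‖ ≤ S := by
    refine le_of_sq_le_sq ?_ (chord_nonneg _ _ _)
    rw [hS2]; nlinarith [sq_nonneg H]
  have hS0 : 0 < S := hvpos.trans_le hSv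
  have c2 := hfc.continuousOn_derivWithin hU le_rfl
  have i2 : IntervalIntegrable (derivWithin (f ∘ c) (Icc 0 1)) volume 0 1 := by
    refine ContinuousOn.intervalIntegrable ?_
    rwa [uIcc_of_le zero_le_one]
  have i5 : IntervalIntegrable (fun t => Real.sqrt (‖derivWithin c (Icc 0 1) t‖ ^ 2 +
      |derivWithin (f ∘ c) (Icc 0 1) t| ^ 2)) volume 0 1 := by
    refine ContinuousOn.intervalIntegrable ?_
    rw [uIcc_of_le zero_le_one]
    exact continuousOn_speed hreg.contDiffOn hfc
  have i6 : IntervalIntegrable (fun t => H / S * (derivWithin (f ∘ c) (Icc 0 1) t - H)) volume 0 1 :=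
    (i2.sub intervalIntegrable_const).const_mul _
  -- From `2 S z ≤ S² + z²` the speed `z` is at most `S + (H / S) (y - H) + (y - H)² / (2 S)`. The
  -- middle term has mean zero. The last is at most `2 C² ‖v‖³`, since `|y - H| ≤ 2 C ‖v‖²` and `‖v‖
  -- ≤ S`.
  have e1 : ∫ t in (0 : ℝ)..1, ((S + 2 * C ^ 2 * ‖v‖ ^ 3) +
      H / S * (derivWithin (f ∘ c) (Icc 0 1) t - H)) = S + 2 * C ^ 2 * ‖v‖ ^ 3 := by
    rw [intervalIntegral.integral_add intervalIntegrable_const i6,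
      intervalIntegral.integral_const_mul,
      intervalIntegral.integral_sub i2 intervalIntegrable_const, integral_derivWithin_eq hfc]
    simp [hc, hH]
  rw [← e1]
  refine intervalIntegral.integral_mono_on zero_le_one i5 (intervalIntegrable_const.add i6)
    fun t ht => ?_
  rw [hcd' t ht, hfd t ht, sq_abs]
  set y := fderiv ℝ f (x₀ + t • v) v with hy
  have hyH : |y - H| ≤ 2 * C * ‖v‖ ^ 2 := by
    have h1 : |y - fderiv ℝ f x₀ v| ≤ C * ‖v‖ ^ 2 := by
      have h2 : y - fderiv ℝ f x₀ v = (fderiv ℝ f (x₀ + t • v) - fderiv ℝ f x₀) v := by simp [hy]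
      rw [h2, ← Real.norm_eq_abs]
      refine (ContinuousLinearMap.le_opNorm _ _).trans ?_
      have h3 := h.lipschitz (t • v) ((hnorm t ht).trans hv)
      have h4 : C * ‖t • v‖ ≤ C * ‖v‖ := mul_le_mul_of_nonneg_left (hnorm t ht) hC
      nlinarith [norm_nonneg v]
    have h2 := h.quadratic hC hv
    rw [← hH] at h2
    have h3 : y - H = (y - fderiv ℝ f x₀ v) - (H - fderiv ℝ f x₀ v) := by ring
    rw [h3]
    refine (abs_sub _ _).trans ?_
    linarith
  have h1 : (y - H) ^ 2 ≤ (2 * C * ‖v‖ ^ 2) ^ 2 := sq_le_sq' (abs_le.1 hyH).1 (abs_le.1 hyH).2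
  set z := Real.sqrt (‖v‖ ^ 2 + y ^ 2) with hz
  have hz2 : z ^ 2 = ‖v‖ ^ 2 + y ^ 2 := Real.sq_sqrt (by positivity)
  have h3 : C ^ 2 * ‖v‖ ^ 3 * ‖v‖ ≤ C ^ 2 * ‖v‖ ^ 3 * S :=
    mul_le_mul_of_nonneg_left hSv (by positivity)
  have h4 : H / S * (y - H) * (2 * S) = 2 * H * (y - H) := by field_simp
  refine le_of_mul_le_mul_right ?_ (by positivity : 0 < 2 * S)
  rw [add_mul, h4]
  nlinarith [sq_nonneg (z - S)]

/-! ### Rescaled amoebas as local models -/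

/-- The third order part of the squared chord length in the coordinates `chart`. -/
def cubicT (b₁ b₂ q₁ q₂ q₃ k : ℝ) (w : ℝ × ℝ) : ℝ :=
  (b₁ * w.1 + b₂ * w.2) * (q₁ * w.1 ^ 2 + 2 * q₂ * w.1 * w.2 + q₃ * w.2 ^ 2)
    - k * w.2 ^ 2 * (w.1 + b₁ * (b₁ * w.1 + b₂ * w.2))

lemma exists_isCubic_cubicT (b₁ b₂ q₁ q₂ q₃ k : ℝ) :
    ∃ K, IsCubic b₁ b₂ (cubicT b₁ b₂ q₁ q₂ q₃ k) K := by
  refine ⟨(|q₁| + 2 * |q₂| + |q₃|) + |k| * (1 + |b₁|), ?_, ?_, by positivity, ?_⟩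
  · unfold cubicT; fun_prop
  · intro r w; simp only [cubicT, Prod.smul_fst, Prod.smul_snd, smul_eq_mul]; ring
  · intro w
    set N := normN b₁ b₂ w
    have hN : 0 ≤ N := normN_nonneg _ _ _
    have hy : |w.1| ≤ N := abs_fst_le_normN b₁ b₂ w
    have hz : |w.2| ≤ N := abs_snd_le_normN b₁ b₂ w
    have hl : |b₁ * w.1 + b₂ * w.2| ≤ N := by
      refine abs_le_of_sq_le_sq ?_ hN
      rw [normN_sq, quadN]; nlinarith [sq_nonneg w.1, sq_nonneg w.2]
    have hyy : |w.1| ^ 2 ≤ N ^ 2 := pow_le_pow_left₀ (abs_nonneg _) hy 2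
    have hzz : |w.2| ^ 2 ≤ N ^ 2 := pow_le_pow_left₀ (abs_nonneg _) hz 2
    have hyz : |w.1| * |w.2| ≤ N ^ 2 := by
      rw [sq]; exact mul_le_mul hy hz (abs_nonneg _) hN
    have h1 : |q₁ * w.1 ^ 2 + 2 * q₂ * w.1 * w.2 + q₃ * w.2 ^ 2| ≤
        (|q₁| + 2 * |q₂| + |q₃|) * N ^ 2 := by
      refine (abs_add_three _ _ _).trans ?_
      rw [abs_mul, abs_mul, abs_mul, abs_mul, abs_mul, abs_pow, abs_pow, abs_two]
      have := mul_le_mul_of_nonneg_left hyy (abs_nonneg q₁)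
      have := mul_le_mul_of_nonneg_left hyz (abs_nonneg q₂)
      have := mul_le_mul_of_nonneg_left hzz (abs_nonneg q₃)
      linarith
    have h2 : |w.1 + b₁ * (b₁ * w.1 + b₂ * w.2)| ≤ (1 + |b₁|) * N := by
      refine (abs_add_le _ _).trans ?_
      rw [abs_mul]
      have := mul_le_mul_of_nonneg_left hl (abs_nonneg b₁)
      linarith
    refine (abs_sub _ _).trans ?_
    rw [abs_mul, abs_mul, abs_mul, abs_pow]
    have h3 := mul_le_mul hl h1 (abs_nonneg _) hN
    have h4 := mul_le_mul (mul_le_mul_of_nonneg_left hzz (abs_nonneg k)) h2 (abs_nonneg _)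
      (by positivity)
    nlinarith

/-- After removal of the orders `0` and `1` in `ρ`, what remains is `ρ²` times a polynomial `G` in
`(y, z, ρ, E)`, bounded on a compact box. `E` stands for the normalised Taylor remainder of `f`. -/
lemma exists_cubicT_bound (b₁ b₂ q₁ q₂ q₃ k E₀ : ℝ) :
    ∃ C ≥ 0, ∀ y z ρ E : ℝ, |y| ≤ 2 → |z| ≤ 2 → |ρ| ≤ 1 → |E| ≤ E₀ →
      |(y - ρ * k / 2 * z ^ 2) ^ 2 + z ^ 2 + (b₁ * (y - ρ * k / 2 * z ^ 2) + b₂ * z +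
        ρ / 2 * (q₁ * (y - ρ * k / 2 * z ^ 2) ^ 2 + 2 * q₂ * (y - ρ * k / 2 * z ^ 2) * z +
          q₃ * z ^ 2) + ρ ^ 2 * E) ^ 2
        - (quadN b₁ b₂ (y, z) + ρ * cubicT b₁ b₂ q₁ q₂ q₃ k (y, z))| ≤ C * ρ ^ 2 := by
  set E2 : ℝ × ℝ × ℝ × ℝ → ℝ := fun p => p.2.2.2 + 1 / 2 * (q₁ * (-(k / 2) * p.2.1 ^ 2) *
    (2 * p.1 - p.2.2.1 * k / 2 * p.2.1 ^ 2) + 2 * q₂ * p.2.1 * (-(k / 2) * p.2.1 ^ 2)) with hE2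
  set P : ℝ × ℝ × ℝ × ℝ → ℝ := fun p =>
    1 / 2 * (q₁ * p.1 ^ 2 + 2 * q₂ * p.1 * p.2.1 + q₃ * p.2.1 ^ 2) - b₁ * k / 2 * p.2.1 ^ 2 with hP
  set G : ℝ × ℝ × ℝ × ℝ → ℝ := fun p => k ^ 2 / 4 * p.2.1 ^ 4 + P p ^ 2 +
    2 * E2 p * (b₁ * p.1 + b₂ * p.2.1 + p.2.2.1 * P p) + p.2.2.1 ^ 2 * E2 p ^ 2 with hG
  have hGc : Continuous G := by rw [hG, hE2, hP]; fun_prop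
  have hK : IsCompact (Icc (-2 : ℝ) 2 ×ˢ Icc (-2 : ℝ) 2 ×ˢ Icc (-1 : ℝ) 1 ×ˢ Icc (-E₀) E₀) :=
    isCompact_Icc.prod (isCompact_Icc.prod (isCompact_Icc.prod isCompact_Icc))
  obtain ⟨C, hC⟩ := hK.exists_bound_of_continuousOn hGc.continuousOn
  refine ⟨max C 0, le_max_right _ _, fun y z ρ E hy hz hρ hE => ?_⟩
  have h1 := hC (y, z, ρ, E) ⟨abs_le.1 hy, abs_le.1 hz, abs_le.1 hρ, abs_le.1 hE⟩
  have e : (y - ρ * k / 2 * z ^ 2) ^ 2 + z ^ 2 + (b₁ * (y - ρ * k / 2 * z ^ 2) + b₂ * z +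
        ρ / 2 * (q₁ * (y - ρ * k / 2 * z ^ 2) ^ 2 + 2 * q₂ * (y - ρ * k / 2 * z ^ 2) * z +
          q₃ * z ^ 2) + ρ ^ 2 * E) ^ 2
        - (quadN b₁ b₂ (y, z) + ρ * cubicT b₁ b₂ q₁ q₂ q₃ k (y, z)) = G (y, z, ρ, E) * ρ ^ 2 := by
    simp only [hG, hE2, hP, quadN, cubicT]; ring
  rw [e, abs_mul, abs_of_nonneg (sq_nonneg ρ)]
  exact mul_le_mul_of_nonneg_right (h1.trans (le_max_left _ _)) (sq_nonneg ρ)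

lemma norm_rot (e : Plane) : ‖rot e‖ = ‖e‖ := by
  rw [EuclideanSpace.norm_eq, EuclideanSpace.norm_eq]
  simp [rot, Fin.sum_univ_two, add_comm]

lemma inner_rot (e : Plane) : inner ℝ e (rot e) = 0 := by
  simp [rot, PiLp.inner_apply, Fin.sum_univ_two]; ring

lemma norm_frame_sq {e : Plane} (he : ‖e‖ = 1) (y z : ℝ) :
    ‖y • e + z • rot e‖ ^ 2 = y ^ 2 + z ^ 2 := by
  rw [norm_add_sq_real, norm_smul, norm_smul, norm_rot, he, inner_smul_left, inner_smul_right,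
    inner_rot]
  simp

lemma d2_frame {f : Plane → ℝ} {x₀ : Plane} (hf : ContDiffAt ℝ 3 f x₀) (e e' : Plane) (y z : ℝ) :
    d2 f x₀ (y • e + z • e') (y • e + z • e') =
      d2 f x₀ e e * y ^ 2 + 2 * d2 f x₀ e e' * y * z + d2 f x₀ e' e' * z ^ 2 := by
  have := d2_symm hf e e'
  simp only [d2] at this ⊢
  simp only [map_add, map_smul, add_apply, smul_apply,
    smul_eq_mul, ← this]
  ring

lemma d2_smul (f : Plane → ℝ) (x₀ v : Plane) (r : ℝ) :
    d2 f x₀ (r • v) (r • v) = r ^ 2 * d2 f x₀ v v := by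
  simp only [d2, map_smul, smul_apply, smul_eq_mul]; ring

set_option maxHeartbeats 1600000 in
/-- In suitable coordinates, amoebas are rescaled to local models. -/
lemma exists_localModel {Ω : Set Plane} {f u : Plane → ℝ} (hf : ContDiffOn ℝ ∞ f Ω)
    (hu : ContDiffOn ℝ ∞ u Ω) {x₀ : Plane} (hx₀ : x₀ ∈ interior Ω) {e : Plane} (he : ‖e‖ = 1)
    {a : ℝ} (ha : 0 < a) (hue : fderiv ℝ u x₀ e = a) (hur : fderiv ℝ u x₀ (rot e) = 0) :
    ∃ C ≥ 0, ∃ δ > 0, ∀ ρ, 0 < ρ → ρ < δ →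
      LocalModel a (fderiv ℝ f x₀ e) (fderiv ℝ f x₀ (rot e))
        (cubicT (fderiv ℝ f x₀ e) (fderiv ℝ f x₀ (rot e)) (d2 f x₀ e e) (d2 f x₀ e (rot e))
          (d2 f x₀ (rot e) (rot e)) (d2 u x₀ (rot e) (rot e) / a)) C ρ
        (chart x₀ e (d2 u x₀ (rot e) (rot e) / a) ρ ⁻¹' amoeba Ω f x₀ ρ)
        (fun w => (u (chart x₀ e (d2 u x₀ (rot e) (rot e) / a) ρ w) - u x₀) / ρ) := by
  have hΩ : Ω ∈ 𝓝 x₀ := mem_interior_iff_mem_nhds.1 hx₀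
  have h3 : (3 : WithTop ℕ∞) ≤ (∞ : WithTop ℕ∞) := ENat.LEInfty.out
  have h1 : (1 : WithTop ℕ∞) ≤ (∞ : WithTop ℕ∞) := ENat.LEInfty.out
  have hf3 : ContDiffAt ℝ 3 f x₀ := (hf.contDiffAt hΩ).of_le h3
  have hu3 : ContDiffAt ℝ 3 u x₀ := (hu.contDiffAt hΩ).of_le h3
  have hf1 : ContDiffOn ℝ 1 f Ω := hf.of_le h1
  obtain ⟨K₁, hK₁, r₁, hr₁, hTf'⟩ := exists_hasTaylorBound hf3
  obtain ⟨K₂, hK₂, r₂, hr₂, hTu'⟩ := exists_hasTaylorBound hu3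
  obtain ⟨r₃, hr₃, hball⟩ := Metric.nhds_basis_closedBall.mem_iff.1 hΩ
  set K := max K₁ K₂
  set r := min r₁ (min r₂ r₃)
  have hK : 0 ≤ K := le_max_of_le_left hK₁
  have hr : 0 < r := by positivity
  have hTf : HasTaylorBound f x₀ K r := hTf'.mono (le_max_left _ _) (min_le_left _ _)
  have hTu : HasTaylorBound u x₀ K r := hTu'.mono (le_max_right _ _)
    ((min_le_right _ _).trans (min_le_left _ _))
  have hrΩ : ∀ v : Plane, ‖v‖ ≤ r → x₀ + v ∈ Ω := fun v hv => hball (by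
    rw [mem_closedBall_iff_norm, add_sub_cancel_left]
    exact hv.trans ((min_le_right _ _).trans (min_le_right _ _)))
  set b₁ := fderiv ℝ f x₀ e
  set b₂ := fderiv ℝ f x₀ (rot e)
  set q₁ := d2 f x₀ e e
  set q₂ := d2 f x₀ e (rot e)
  set q₃ := d2 f x₀ (rot e) (rot e)
  set k := d2 u x₀ (rot e) (rot e) / a with hk
  set u₁ := d2 u x₀ e e
  set u₂ := d2 u x₀ e (rot e)
  have hka : d2 u x₀ (rot e) (rot e) = a * k := by rw [hk]; field_simp
  obtain ⟨C₃, hC₃, hC₃b⟩ := exists_cubicT_bound b₁ b₂ q₁ q₂ q₃ k (125 * K)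
  -- The summands serve, in order, the expansion of the squared chord, the excess of distance over
  -- chord, the increments of `u` in direction `e`, and the values of `u` on the straightened level
  -- line. The factors `5` and `125 = 5³` come from `‖v w‖ ≤ 5 ρ` on the box.
  set C := C₃ + 500 * K ^ 2 + 5 * K + (2 * k ^ 2 * |u₁| + 4 * |k| * |u₂| + 125 * K) with hC
  have hC0 : 0 ≤ C := by positivity
  refine ⟨C, hC0, min 1 (min (r / 5) (1 / (2 * (|k| + 1)))), by positivity, fun ρ hρ hρδ => ?_⟩
  have hρ1 : ρ < 1 := hρδ.trans_le (min_le_left _ _)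
  have hρr : 5 * ρ ≤ r := by
    have : ρ < r / 5 := hρδ.trans_le ((min_le_right _ _).trans (min_le_left _ _))
    linarith
  have hρk : ρ * |k| ≤ 1 / 2 := by
    have : ρ < 1 / (2 * (|k| + 1)) := hρδ.trans_le ((min_le_right _ _).trans (min_le_right _ _))
    rw [lt_div_iff₀ (by positivity)] at this
    nlinarith
  set v : ℝ × ℝ → Plane := fun w => ρ • ((w.1 - ρ * k / 2 * w.2 ^ 2) • e + w.2 • rot e) with hv
  have hchart : ∀ w, chart x₀ e k ρ w = x₀ + v w := fun w => rfl
  have hvn : ∀ w, ‖v w‖ ^ 2 = ρ ^ 2 * ((w.1 - ρ * k / 2 * w.2 ^ 2) ^ 2 + w.2 ^ 2) := fun w => by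
    rw [hv, norm_smul, mul_pow, norm_frame_sq he, Real.norm_eq_abs, sq_abs]
  have hshift : ∀ z : ℝ, |z| ≤ 2 → |ρ * k / 2 * z ^ 2| ≤ 2 * (ρ * |k|) := fun z hz => by
    have : z ^ 2 ≤ 4 := by nlinarith [abs_le.1 hz]
    rw [abs_mul, abs_div, abs_mul, abs_two, abs_of_pos hρ, abs_of_nonneg (sq_nonneg z)]
    have h0 : 0 ≤ ρ * |k| := by positivity
    nlinarith
  have hvb : ∀ w ∈ box, ‖v w‖ ≤ 5 * ρ := fun w hw => by
    refine le_of_sq_le_sq ?_ (by positivity)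
    have h4 := abs_le.1 (hshift w.2 hw.2)
    have h5 := abs_le.1 hw.1
    have h6 := abs_le.1 hw.2
    have h7 : (w.1 - ρ * k / 2 * w.2 ^ 2) ^ 2 ≤ 3 ^ 2 := sq_le_sq' (by linarith) (by linarith)
    have h8 : w.2 ^ 2 ≤ 2 ^ 2 := sq_le_sq' (by linarith) (by linarith)
    rw [hvn, mul_pow]
    nlinarith [sq_nonneg ρ]
  have hvr : ∀ w ∈ box, ‖v w‖ ≤ r := fun w hw => (hvb w hw).trans hρr
  have hcube : ∀ w ∈ box, K * ‖v w‖ ^ 3 ≤ 125 * K * ρ ^ 3 := fun w hw => by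
    have := mul_le_mul_of_nonneg_left (pow_le_pow_left₀ (norm_nonneg _) (hvb w hw) 3) hK
    linarith
  have hcont : Continuous v := by rw [hv]; fun_prop
  have hsq : 0 < ρ ^ 2 := by positivity
  -- the squared chord length in the rescaled coordinates
  have hchord : ∀ w ∈ box, |chord f x₀ (x₀ + v w) ^ 2 / ρ ^ 2 -
      (quadN b₁ b₂ w + ρ * cubicT b₁ b₂ q₁ q₂ q₃ k w)| ≤ C₃ * ρ ^ 2 := by
    intro w hw
    have t1 := (hTf.cubic (v w) (hvr w hw)).trans (hcube w hw)
    set E := (f (x₀ + v w) - f x₀ - fderiv ℝ f x₀ (v w) - d2 f x₀ (v w) (v w) / 2) / ρ ^ 3 with hE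
    have hEb : |E| ≤ 125 * K := by
      rw [hE, abs_div, abs_of_pos (pow_pos hρ 3), div_le_iff₀ (by positivity)]
      exact t1
    have e1 : fderiv ℝ f x₀ (v w) = ρ * (b₁ * (w.1 - ρ * k / 2 * w.2 ^ 2) + b₂ * w.2) := by
      simp only [hv, map_add, map_smul, smul_eq_mul, b₁, b₂]; ring
    have e2 : d2 f x₀ (v w) (v w) = ρ ^ 2 * (q₁ * (w.1 - ρ * k / 2 * w.2 ^ 2) ^ 2 +
        2 * q₂ * (w.1 - ρ * k / 2 * w.2 ^ 2) * w.2 + q₃ * w.2 ^ 2) := by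
      rw [hv, d2_smul, d2_frame hf3]
    have e3 : f (x₀ + v w) - f x₀ = ρ * (b₁ * (w.1 - ρ * k / 2 * w.2 ^ 2) + b₂ * w.2 +
        ρ / 2 * (q₁ * (w.1 - ρ * k / 2 * w.2 ^ 2) ^ 2 +
        2 * q₂ * (w.1 - ρ * k / 2 * w.2 ^ 2) * w.2 + q₃ * w.2 ^ 2) + ρ ^ 2 * E) := by
      have : f (x₀ + v w) - f x₀ = fderiv ℝ f x₀ (v w) + d2 f x₀ (v w) (v w) / 2 + ρ ^ 3 * E := by
        rw [hE]; field_simp; ring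
      rw [this, e1, e2]; ring
    have := hC₃b w.1 w.2 ρ E hw.1 hw.2 (by rw [abs_of_pos hρ]; exact hρ1.le) hEb
    convert! this using 3
    rw [chord_sq, add_sub_cancel_left, hvn, e3, mul_pow, ← mul_add, mul_div_cancel_left₀ _ hsq.ne']
  -- The chord dominates the Euclidean distance, so the uncorrected coordinates lie in the unit
  -- disc. The parabolic shift is at most `1`, which is why a box of half-width `2` suffices.
  have hmem : ∀ w, chord f x₀ (x₀ + v w) ≤ ρ → w ∈ box := by
    intro w hw
    have h4 : chord f x₀ (x₀ + v w) ^ 2 ≤ ρ ^ 2 := pow_le_pow_left₀ (chord_nonneg _ _ _) hw 2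
    rw [chord_sq, add_sub_cancel_left, hvn] at h4
    have h5 : (w.1 - ρ * k / 2 * w.2 ^ 2) ^ 2 + w.2 ^ 2 ≤ 1 := by
      by_contra! hcon
      nlinarith [sq_nonneg (f (x₀ + v w) - f x₀)]
    have h6 : |w.2| ≤ 1 := abs_le_one_iff_mul_self_le_one.2
      (by nlinarith [sq_nonneg (w.1 - ρ * k / 2 * w.2 ^ 2)])
    have h7 := abs_le_one_iff_mul_self_le_one.2
      (by nlinarith [sq_nonneg w.2] : (w.1 - ρ * k / 2 * w.2 ^ 2) * (w.1 - ρ * k / 2 * w.2 ^ 2) ≤ 1)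
    refine ⟨?_, by linarith⟩
    have h8 := abs_le.1 (hshift w.2 (by linarith))
    have h9 := abs_le.1 h7
    rw [abs_le]; constructor <;> linarith
  refine ⟨?_, ?_, ?_, ?_, ?_, ?_⟩
  · exact fun w hw => hmem w (chord_le_of_mem_amoeba hf1 hρ.le hw)
  · intro w hw
    have h4 := chord_le_of_mem_amoeba hf1 hρ.le hw
    rw [hchart] at h4
    have h5 := (abs_le.1 (hchord w (hmem w h4))).1
    have h6 : chord f x₀ (x₀ + v w) ^ 2 / ρ ^ 2 ≤ 1 := by
      rw [div_le_one hsq]; exact pow_le_pow_left₀ (chord_nonneg _ _ _) h4 2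
    have h7 : C₃ * ρ ^ 2 ≤ C * ρ ^ 2 := mul_le_mul_of_nonneg_right (by
      have : 0 ≤ 500 * K ^ 2 + 5 * K + (2 * k ^ 2 * |u₁| + 4 * |k| * |u₂| + 125 * K) := by positivity
      linarith) hsq.le
    linarith
  · intro w hw hw0 hq
    have hv0 : v w ≠ 0 := by
      intro h0
      have h4 := hvn w
      rw [h0, norm_zero, zero_pow two_ne_zero, eq_comm, mul_eq_zero, or_iff_right hsq.ne'] at h4
      have h5 : w.2 = 0 := by nlinarith [sq_nonneg (w.1 - ρ * k / 2 * w.2 ^ 2), sq_nonneg w.2]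
      rw [h5] at h4
      have h6 : w.1 = 0 := by nlinarith
      exact hw0 (Prod.ext h6 h5)
    refine mem_amoeba_of_chord_le hf1 hK hTf hrΩ hv0 (hvr w hw) ?_
    have h5 := (abs_le.1 (hchord w hw)).2
    set S := chord f x₀ (x₀ + v w) with hS
    have hS0 : 0 ≤ S := chord_nonneg _ _ _
    have h7 : C₃ * ρ ^ 2 + 500 * K ^ 2 * ρ ^ 2 ≤ C * ρ ^ 2 := by
      rw [← add_mul]
      refine mul_le_mul_of_nonneg_right ?_ hsq.le
      have : 0 ≤ 5 * K + (2 * k ^ 2 * |u₁| + 4 * |k| * |u₂| + 125 * K) := by positivity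
      linarith
    have h6 : S ^ 2 / ρ ^ 2 ≤ 1 - 500 * K ^ 2 * ρ ^ 2 := by linarith
    rw [div_le_iff₀ hsq] at h6
    have h8 : 2 * K ^ 2 * ‖v w‖ ^ 3 ≤ 250 * K ^ 2 * ρ ^ 3 := by
      have := mul_le_mul_of_nonneg_left (hcube w hw) hK
      nlinarith
    have h9 : 0 ≤ S ^ 2 := sq_nonneg S
    have h10 : 0 ≤ ρ - 250 * K ^ 2 * ρ ^ 3 := by
      have : 0 ≤ 1 - 500 * K ^ 2 * ρ ^ 2 := by
        by_contra! hcon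
        nlinarith
      have h11 := mul_nonneg hρ.le this
      nlinarith
    -- Since `S² ≤ ρ² - 500 K² ρ⁴ ≤ (ρ - 250 K² ρ³)²`, there is exactly enough room for the excess
    -- `2 K² ‖v w‖³ ≤ 250 K² ρ³` of the segment.
    have h11 : S ≤ ρ - 250 * K ^ 2 * ρ ^ 3 := by
      refine le_of_sq_le_sq ?_ h10
      nlinarith [sq_nonneg (250 * K ^ 2 * ρ ^ 3)]
    linarith
  · refine ContinuousOn.div_const (ContinuousOn.sub ?_ continuousOn_const) _
    exact hu.continuousOn.comp (continuous_const.add hcont).continuousOn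
      fun w hw => hrΩ _ (hvr w hw)
  · intro y₁ y₂ z hw1 hw2
    have h4 := hTu.increment hK hρr (hvb _ hw1) (hvb _ hw2)
    have h5 : v (y₂, z) - v (y₁, z) = (ρ * (y₂ - y₁)) • e := by
      simp only [hv]; module
    rw [h5, map_smul, hue, norm_smul, he, smul_eq_mul, mul_one, Real.norm_eq_abs, abs_mul,
      abs_of_pos hρ] at h4
    have h6 : (u (chart x₀ e k ρ (y₂, z)) - u x₀) / ρ - (u (chart x₀ e k ρ (y₁, z)) - u x₀) / ρ -
        a * (y₂ - y₁) = (u (x₀ + v (y₂, z)) - u (x₀ + v (y₁, z)) - ρ * (y₂ - y₁) * a) / ρ := by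
      rw [hchart, hchart]; field_simp; ring
    rw [h6, abs_div, abs_of_pos hρ, div_le_iff₀ hρ]
    refine h4.trans ?_
    have h7 : 5 * K ≤ C := by
      have : 0 ≤ C₃ + 500 * K ^ 2 + (2 * k ^ 2 * |u₁| + 4 * |k| * |u₂| + 125 * K) := by positivity
      linarith
    have h8 : 0 ≤ ρ * ρ * |y₂ - y₁| := by positivity
    nlinarith
  · intro z hz
    have hw : ((0 : ℝ), z) ∈ box := ⟨by simp, hz⟩
    have t1 := (hTu.cubic (v (0, z)) (hvr _ hw)).trans (hcube _ hw)
    set s := ρ * k / 2 * z ^ 2 with hs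
    have e1 : fderiv ℝ u x₀ (v (0, z)) = ρ * (-s * a) := by
      simp only [hv, map_add, map_smul, smul_eq_mul, hue, hur]; ring
    have e2 : d2 u x₀ (v (0, z)) (v (0, z)) =
        ρ ^ 2 * (u₁ * s ^ 2 - 2 * u₂ * s * z + a * k * z ^ 2) := by
      rw [hv, d2_smul, d2_frame hu3, hka]
      simp only [← hs]; ring
    rw [e1, e2] at t1
    -- Here the chart pays off: the linear term along the parabola cancels the curvature term `ρ² a
    -- k z² / 2` of `u`, leaving only third-order contributions.
    have e3 : u (x₀ + v (0, z)) - u x₀ - ρ * (-s * a) -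
        ρ ^ 2 * (u₁ * s ^ 2 - 2 * u₂ * s * z + a * k * z ^ 2) / 2 =
        u (x₀ + v (0, z)) - u x₀ - ρ ^ 2 / 2 * (u₁ * s ^ 2 - 2 * u₂ * s * z) := by
      rw [hs]; ring
    rw [e3] at t1
    have hsb : |s| ≤ 2 * (ρ * |k|) := hshift z hz
    have h4 : |u₁ * s ^ 2| ≤ ρ * (4 * k ^ 2 * |u₁|) := by
      rw [abs_mul, abs_pow]
      have h5 : |s| ^ 2 ≤ (2 * (ρ * |k|)) ^ 2 := pow_le_pow_left₀ (abs_nonneg _) hsb 2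
      have h6 : (2 * (ρ * |k|)) ^ 2 = ρ * (ρ * (4 * k ^ 2)) := by
        rw [mul_pow, mul_pow, sq_abs]; ring
      have h7 : ρ * (ρ * (4 * k ^ 2)) ≤ ρ * (4 * k ^ 2) :=
        mul_le_mul_of_nonneg_left (mul_le_of_le_one_left (by positivity) hρ1.le) hρ.le
      have := mul_le_mul_of_nonneg_left (h5.trans (h6.le.trans h7)) (abs_nonneg u₁)
      linarith
    have h5 : |2 * u₂ * s * z| ≤ ρ * (8 * |k| * |u₂|) := by
      rw [abs_mul, abs_mul, abs_mul, abs_two]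
      have h6 : |s| * |z| ≤ 2 * (ρ * |k|) * 2 := mul_le_mul hsb hz (abs_nonneg _) (by positivity)
      have := mul_le_mul_of_nonneg_left h6 (abs_nonneg u₂)
      linarith
    have h6 : |u₁ * s ^ 2 - 2 * u₂ * s * z| ≤ ρ * (4 * k ^ 2 * |u₁|) + ρ * (8 * |k| * |u₂|) :=
      (abs_sub _ _).trans (add_le_add h4 h5)
    have h7 : |u (x₀ + v (0, z)) - u x₀| ≤
        125 * K * ρ ^ 3 + ρ ^ 2 / 2 * (ρ * (4 * k ^ 2 * |u₁|) + ρ * (8 * |k| * |u₂|)) := by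
      have h8 : u (x₀ + v (0, z)) - u x₀ =
          (u (x₀ + v (0, z)) - u x₀ - ρ ^ 2 / 2 * (u₁ * s ^ 2 - 2 * u₂ * s * z)) +
          ρ ^ 2 / 2 * (u₁ * s ^ 2 - 2 * u₂ * s * z) := by ring
      rw [h8]
      refine (abs_add_le _ _).trans (add_le_add t1 ?_)
      rw [abs_mul, abs_of_pos (by positivity : 0 < ρ ^ 2 / 2)]
      exact mul_le_mul_of_nonneg_left h6 (by positivity)
    rw [hchart, abs_div, abs_of_pos hρ, div_le_iff₀ hρ]
    refine h7.trans ?_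
    have h9 : 0 ≤ (C₃ + 500 * K ^ 2 + 5 * K) * ρ ^ 3 := by positivity
    have h10 : C * ρ ^ 2 * ρ = (C₃ + 500 * K ^ 2 + 5 * K) * ρ ^ 3 +
      (2 * k ^ 2 * |u₁| + 4 * |k| * |u₂| + 125 * K) * ρ ^ 3 := by rw [hC]; ring
    rw [h10]
    linarith

/-! ### Asymptotics of areas and values as the radius tends to zero -/

/-- A family of rescaled amoebas, with uniform constants for small radii. -/
def ModelFamily (a b₁ b₂ : ℝ) (T : ℝ × ℝ → ℝ) (A : ℝ → Set (ℝ × ℝ)) (U : ℝ → ℝ × ℝ → ℝ) : Prop :=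
  ∃ C ≥ 0, ∃ δ > 0, ∀ ρ, 0 < ρ → ρ < δ → LocalModel a b₁ b₂ T C ρ (A ρ) (U ρ)

lemma IsCubic.exists_bound {b₁ b₂ K : ℝ} {T : ℝ × ℝ → ℝ} (hT : IsCubic b₁ b₂ T K) :
    ∃ M, ∀ w ∈ box, |T w| ≤ M := by
  have : IsCompact box := by rw [box_eq]; exact isCompact_Icc.prod isCompact_Icc
  exact this.exists_bound_of_continuousOn hT.continuous.continuousOn

lemma LocalModel.subArea_eq_zero {a b₁ b₂ C ρ : ℝ} {T : ℝ × ℝ → ℝ} {A : Set (ℝ × ℝ)}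
    {U : ℝ × ℝ → ℝ} (h : LocalModel a b₁ b₂ T C ρ A U) : ∃ t, subArea A U t = 0 := by
  have : IsCompact box := by rw [box_eq]; exact isCompact_Icc.prod isCompact_Icc
  obtain ⟨M, hM⟩ := this.exists_bound_of_continuousOn h.cont
  refine ⟨-M - 1, ?_⟩
  have : {w | w ∈ A ∧ U w ≤ -M - 1} = ∅ := by
    ext w
    simp only [mem_ofPred_eq, mem_empty_iff_false, iff_false, not_and, not_le]
    intro hw
    linarith [(abs_le.1 (hM w (h.subset hw))).1]
  rw [subArea, this, measureReal_empty]

lemma LocalModel.subArea_eq_volume {a b₁ b₂ C ρ : ℝ} {T : ℝ × ℝ → ℝ} {A : Set (ℝ × ℝ)}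
    {U : ℝ × ℝ → ℝ} (h : LocalModel a b₁ b₂ T C ρ A U) :
    ∃ t, subArea A U t = volume.real A := by
  have : IsCompact box := by rw [box_eq]; exact isCompact_Icc.prod isCompact_Icc
  obtain ⟨M, hM⟩ := this.exists_bound_of_continuousOn h.cont
  refine ⟨M, ?_⟩
  rw [subArea]
  congr 1
  ext w
  exact and_iff_left_of_imp fun hw => (abs_le.1 (hM w (h.subset hw))).2

namespace ModelFamily

variable {a b₁ b₂ K : ℝ} {T : ℝ × ℝ → ℝ} {A : ℝ → Set (ℝ × ℝ)} {U : ℝ → ℝ × ℝ → ℝ}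

lemma eventually_localModel (h : ModelFamily a b₁ b₂ T A U) (ha : 0 < a) :
    ∃ C, ∀ᶠ ρ in 𝓝[>] (0 : ℝ), C * ρ < a ∧ LocalModel a b₁ b₂ T C ρ (A ρ) (U ρ) := by
  obtain ⟨C, hC, δ, hδ, H⟩ := h
  refine ⟨C, ?_⟩
  filter_upwards [Ioo_mem_nhdsGT hδ, Ioo_mem_nhdsGT (by positivity : 0 < a / (C + 1))] with ρ h1 h2
  refine ⟨?_, H ρ h1.1 h1.2⟩
  have h3 := h2.2
  rw [lt_div_iff₀ (by positivity)] at h3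
  nlinarith [h1.1]

lemma tendsto_volume (h : ModelFamily a b₁ b₂ T A U) (ha : 0 < a) (hT : IsCubic b₁ b₂ T K) {s : ℝ}
    (hs : s ^ 2 = b₁ ^ 2 + b₂ ^ 2) :
    Tendsto (fun ρ => volume.real (A ρ)) (𝓝[>] 0) (𝓝 (Real.pi / nu s)) := by
  obtain ⟨C, hC, δ, hδ, H⟩ := h
  obtain ⟨M, hM⟩ := hT.exists_bound
  rw [Metric.tendsto_nhds]
  intro ε hε
  obtain ⟨δ', hδ', H'⟩ := exists_volume_limit ha hC hs hM hε
  filter_upwards [Ioo_mem_nhdsGT hδ, Ioo_mem_nhdsGT hδ'] with ρ h1 h2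
  exact H' ρ _ _ h1.1 h2.2 (H ρ h1.1 h1.2)

lemma tendsto_subArea (h : ModelFamily a b₁ b₂ T A U) (ha : 0 < a) (hT : IsCubic b₁ b₂ T K) {s : ℝ}
    (hs : s ^ 2 = b₁ ^ 2 + b₂ ^ 2) (t : ℝ) :
    Tendsto (fun ρ => subArea (A ρ) (U ρ) t) (𝓝[>] 0)
      (𝓝 (1 / nu s * discArea (t / (a * (nu b₂ / nu s))))) := by
  obtain ⟨C, hC, δ, hδ, H⟩ := h
  obtain ⟨M, hM⟩ := hT.exists_bound
  rw [Metric.tendsto_nhds]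
  intro ε hε
  obtain ⟨δ', hδ', H'⟩ := exists_subArea_limit ha hC hs hM t hε
  filter_upwards [Ioo_mem_nhdsGT hδ, Ioo_mem_nhdsGT hδ'] with ρ h1 h2
  exact H' ρ _ _ h1.1 h2.2 (H ρ h1.1 h1.2)

lemma isLittleO_strip (h : ModelFamily a b₁ b₂ T A U) (ha : 0 < a) (hT : IsCubic b₁ b₂ T K)
    {t₁ t₂ : ℝ → ℝ} (h1 : Tendsto t₁ (𝓝[>] 0) (𝓝 0)) (h2 : Tendsto t₂ (𝓝[>] 0) (𝓝 0)) :
    (fun ρ => subArea (A ρ) (U ρ) (t₂ ρ) - subArea (A ρ) (U ρ) (t₁ ρ) -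
      2 / (a * nu b₂) * (t₂ ρ - t₁ ρ)) =o[𝓝[>] 0] fun ρ => t₂ ρ - t₁ ρ := by
  obtain ⟨C, hC, δ, hδ, H⟩ := h
  obtain ⟨M, hM⟩ := hT.exists_bound
  rw [Asymptotics.isLittleO_iff]
  intro ε hε
  obtain ⟨δ', hδ', H'⟩ := exists_strip_estimate ha hC hM hε
  filter_upwards [Ioo_mem_nhdsGT hδ, Ioo_mem_nhdsGT hδ', h1 (Metric.closedBall_mem_nhds 0 hδ'),
    h2 (Metric.closedBall_mem_nhds 0 hδ')] with ρ r1 r2 r3 r4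
  have r3 : |t₁ ρ| ≤ δ' := mem_closedBall_zero_iff.1 r3
  have r4 : |t₂ ρ| ≤ δ' := mem_closedBall_zero_iff.1 r4
  have := H' ρ _ _ r1.1 r2.2 (H ρ r1.1 r1.2)
  rw [Real.norm_eq_abs, Real.norm_eq_abs]
  rcases le_total (t₁ ρ) (t₂ ρ) with h12 | h12
  · rw [abs_of_nonneg (sub_nonneg.2 h12)]
    exact this _ _ r3 r4 h12
  · rw [abs_sub_comm (t₂ ρ), abs_of_nonneg (sub_nonneg.2 h12), ← abs_neg]
    convert this _ _ r4 r3 h12 using 2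
    ring

/-- If the areas below the values `t` approach the area below `0`, then `t → 0`. -/
lemma tendsto_zero (h : ModelFamily a b₁ b₂ T A U) (ha : 0 < a) (hT : IsCubic b₁ b₂ T K)
    {t : ℝ → ℝ} (ht : Tendsto (fun ρ => subArea (A ρ) (U ρ) (t ρ) - subArea (A ρ) (U ρ) 0)
      (𝓝[>] 0) (𝓝 0)) : Tendsto t (𝓝[>] 0) (𝓝 0) := by
  have hν := nu_pos b₂
  obtain ⟨C, hC, δ, hδ, H⟩ := h
  obtain ⟨M, hM⟩ := hT.exists_bound
  -- With half the limiting density as tolerance, the strips between `0` and `±η` have area at least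
  -- `η / (a ν(b₂))`. By monotonicity, a level beyond `±η` would change the area by at least that
  -- much.
  obtain ⟨δ', hδ', H'⟩ := exists_strip_estimate ha hC hM
    (by positivity : 0 < 1 / (a * nu b₂))
  rw [Metric.tendsto_nhds] at ht ⊢
  intro ε hε
  set η := min (ε / 2) δ' with hη
  have hη0 : 0 < η := by positivity
  have hηε : η < ε := (min_le_left _ _).trans_lt (by linarith)
  have hηδ : |η| ≤ δ' := by rw [abs_of_pos hη0]; exact min_le_right _ _
  filter_upwards [Ioo_mem_nhdsGT hδ, Ioo_mem_nhdsGT hδ',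
    ht (1 / (a * nu b₂) * η) (by positivity)] with ρ r1 r2 r3
  have hm := H ρ r1.1 r1.2
  have e1 := (abs_le.1 (H' ρ _ _ r1.1 r2.2 hm 0 η (by simpa using hδ'.le) hηδ hη0.le)).1
  have e2 := (abs_le.1 (H' ρ _ _ r1.1 r2.2 hm (-η) 0 (by rwa [abs_neg]) (by simpa using hδ'.le)
    (by linarith))).1
  rw [Real.dist_eq, sub_zero, abs_lt] at r3 ⊢
  have e3 : 2 / (a * nu b₂) = 2 * (1 / (a * nu b₂)) := by ring
  rw [e3] at e1 e2
  constructor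
  · by_contra! hcon
    have := hm.monotone_subArea (by linarith : t ρ ≤ -η)
    linarith [r3.1]
  · by_contra! hcon
    have := hm.monotone_subArea (by linarith : η ≤ t ρ)
    linarith [r3.2]

lemma tendsto_median_defect (h : ModelFamily a b₁ b₂ T A U) (ha : 0 < a) (hT : IsCubic b₁ b₂ T K) :
    Tendsto (fun ρ => (volume.real (A ρ) / 2 - subArea (A ρ) (U ρ) 0) / ρ) (𝓝[>] 0)
      (𝓝 (-(asymm b₁ b₂ T / 2))) := by
  obtain ⟨C, hC, δ, hδ, H⟩ := h
  obtain ⟨C', hC', δ', hδ', H'⟩ := exists_median_estimate (b₁ := b₁) (b₂ := b₂) ha hC hT.nonneg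
  have h0 : Tendsto (fun ρ : ℝ => C' * ρ) (𝓝[>] 0) (𝓝 0) := by
    have : Tendsto (fun ρ : ℝ => C' * ρ) (𝓝 0) (𝓝 (C' * 0)) := Continuous.tendsto (by fun_prop) 0
    rw [mul_zero] at this
    exact this.mono_left nhdsWithin_le_nhds
  rw [tendsto_iff_dist_tendsto_zero]
  refine squeeze_zero' (Eventually.of_forall fun _ => dist_nonneg) ?_ h0
  filter_upwards [Ioo_mem_nhdsGT hδ, Ioo_mem_nhdsGT hδ'] with ρ r1 r2
  have hρ : 0 < ρ := r1.1
  have := H' ρ T _ _ r1.1 r2.2 hT (H ρ r1.1 r1.2)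
  rw [Real.dist_eq]
  have e1 : (volume.real (A ρ) / 2 - subArea (A ρ) (U ρ) 0) / ρ - -(asymm b₁ b₂ T / 2) =
      -(2 * subArea (A ρ) (U ρ) 0 - volume.real (A ρ) - ρ * asymm b₁ b₂ T) / (2 * ρ) := by
    field_simp; ring
  rw [e1, abs_div, abs_neg, abs_of_pos (by positivity : 0 < 2 * ρ), div_le_iff₀ (by positivity)]
  have : 0 ≤ C' * ρ ^ 2 := by positivity
  nlinarith

/-- The values at two areas that approach the area below `0` differ by the difference of the areas
divided by the length of the level line. -/
lemma isLittleO_value (h : ModelFamily a b₁ b₂ T A U) (ha : 0 < a) (hT : IsCubic b₁ b₂ T K)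
    {t₁ t₂ : ℝ → ℝ} (h1 : Tendsto t₁ (𝓝[>] 0) (𝓝 0)) (h2 : Tendsto t₂ (𝓝[>] 0) (𝓝 0)) :
    (fun ρ => t₂ ρ - t₁ ρ - a * nu b₂ / 2 *
      (subArea (A ρ) (U ρ) (t₂ ρ) - subArea (A ρ) (U ρ) (t₁ ρ))) =o[𝓝[>] 0]
      fun ρ => subArea (A ρ) (U ρ) (t₂ ρ) - subArea (A ρ) (U ρ) (t₁ ρ) := by
  have hν := nu_pos b₂
  have h3 := h.isLittleO_strip ha hT h1 h2
  -- The strip estimate has an error relative to the difference of values; as the density is bounded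
  -- below, this is also small relative to the difference of areas.
  have h4 : (fun ρ => t₂ ρ - t₁ ρ) =O[𝓝[>] 0]
      fun ρ => subArea (A ρ) (U ρ) (t₂ ρ) - subArea (A ρ) (U ρ) (t₁ ρ) := by
    refine Asymptotics.IsBigO.of_bound (a * nu b₂) ?_
    filter_upwards [Asymptotics.isLittleO_iff.1 h3 (by positivity : 0 < 1 / (a * nu b₂))] with ρ hρ
    rw [Real.norm_eq_abs, Real.norm_eq_abs] at hρ ⊢
    set D := t₂ ρ - t₁ ρ
    set E := subArea (A ρ) (U ρ) (t₂ ρ) - subArea (A ρ) (U ρ) (t₁ ρ)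
    have e1 : 2 / (a * nu b₂) * |D| ≤ |E| + |E - 2 / (a * nu b₂) * D| := by
      have := abs_sub E (E - 2 / (a * nu b₂) * D)
      rwa [sub_sub_cancel, abs_mul, abs_of_pos (by positivity : 0 < 2 / (a * nu b₂))] at this
    have e2 : 2 / (a * nu b₂) = 2 * (1 / (a * nu b₂)) := by ring
    have e3 : 1 / (a * nu b₂) * |D| ≤ |E| := by
      rw [e2] at e1 hρ; linarith
    rwa [one_div, inv_mul_le_iff₀ (by positivity)] at e3
  have h5 := (h3.trans_isBigO h4).const_mul_left (-(a * nu b₂ / 2))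
  refine h5.congr_left fun ρ => ?_
  field_simp
  ring

/-- First order asymptotics of the median. -/
lemma tendsto_median (h : ModelFamily a b₁ b₂ T A U) (ha : 0 < a) (hT : IsCubic b₁ b₂ T K)
    {t : ℝ → ℝ} (h1 : Tendsto t (𝓝[>] 0) (𝓝 0))
    (h2 : ∀ᶠ ρ in 𝓝[>] 0, subArea (A ρ) (U ρ) (t ρ) = volume.real (A ρ) / 2) :
    Tendsto (fun ρ => t ρ / ρ) (𝓝[>] 0) (𝓝 (-(a * nu b₂ / 4 * asymm b₁ b₂ T))) := by
  have h3 := h.isLittleO_value ha hT tendsto_const_nhds h1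
  have h4 := h.tendsto_median_defect ha hT
  have h6 : (fun ρ => subArea (A ρ) (U ρ) (t ρ) - subArea (A ρ) (U ρ) 0) =O[𝓝[>] 0]
      (fun ρ : ℝ => ρ) := by
    refine Asymptotics.isBigO_of_div_tendsto_nhds ?_ _ (h4.congr' ?_)
    · filter_upwards [self_mem_nhdsWithin] with ρ hρ h0
      exact absurd h0 (ne_of_gt hρ)
    · filter_upwards [h2] with ρ hρ
      simp [hρ]
  have h7 := (h3.trans_isBigO h6).tendsto_div_nhds_zero
  -- The first-order value is the density inverse `a ν(b₂) / 2` times the area missing from one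
  -- half, `-(ρ / 2) asymm`.
  have h8 := h7.add (h4.const_mul (a * nu b₂ / 2))
  have e : 0 + a * nu b₂ / 2 * -(asymm b₁ b₂ T / 2) = -(a * nu b₂ / 4 * asymm b₁ b₂ T) := by ring
  rw [e] at h8
  refine h8.congr' ?_
  filter_upwards [h2] with ρ hρ
  rw [hρ]; ring

end ModelFamily

/-- A continuous monotone function attains the rank `k` at the value at rank `k`. -/
lemma eq_of_continuous_sInf {G : ℝ → ℝ} (hG : Continuous G) {k m₀ m₁ : ℝ} (hmono : Monotone G)
    (h0 : G m₀ < k) (h1 : k ≤ G m₁) : G (sInf {m | k ≤ G m}) = k := by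
  have hcl : IsClosed {m | k ≤ G m} := isClosed_le continuous_const hG
  have hlb : m₀ ∈ lowerBounds {m | k ≤ G m} := fun m hm => by
    by_contra! hcon
    exact absurd (hmono hcon.le) (not_le.2 (h0.trans_le hm))
  have hmem : k ≤ G (sInf {m | k ≤ G m}) := hcl.csInf_mem ⟨m₁, h1⟩ ⟨m₀, hlb⟩
  have hle : m₀ ≤ sInf {m | k ≤ G m} := le_csInf ⟨m₁, h1⟩ hlb
  obtain ⟨m, hm, hmk⟩ := intermediate_value_Icc hle hG.continuousOn ⟨h0.le, hmem⟩
  have : sInf {m | k ≤ G m} ≤ m := csInf_le ⟨m₀, hlb⟩ hmk.ge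
  rw [le_antisymm this hm.2, hmk]

/-! ### The asymmetry integral and the contour equation -/

lemma hasDerivAt_nu (z : ℝ) : HasDerivAt nu (z / nu z) z := by
  have h1 : HasDerivAt (fun z : ℝ => 1 + z ^ 2) (2 * z) z := by
    simpa using (hasDerivAt_pow 2 z).const_add 1
  have := h1.sqrt (by positivity)
  convert! this using 1
  rw [nu, mul_div_mul_left _ _ two_ne_zero]

lemma normN_circ_sq (b₁ b₂ φ : ℝ) :
    normN b₁ b₂ (circ φ) ^ 2 = 1 + (b₁ * Real.cos φ + b₂ * Real.sin φ) ^ 2 := by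
  rw [normN_sq, quadN, circ]
  linarith [Real.sin_sq_add_cos_sq φ]

lemma normN_circ (b₁ b₂ φ : ℝ) :
    normN b₁ b₂ (circ φ) = nu (b₁ * Real.cos φ + b₂ * Real.sin φ) := by
  rw [nu, ← normN_circ_sq, Real.sqrt_sq (normN_nonneg _ _ _)]

/-- The contribution of the curvature of the level line of `u`. -/
lemma integral_curvature (b₁ b₂ : ℝ) :
    ∫ φ in (-(Real.pi / 2))..(Real.pi / 2),
      Real.sin φ ^ 2 * (Real.cos φ + b₁ * (b₁ * Real.cos φ + b₂ * Real.sin φ)) /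
        normN b₁ b₂ (circ φ) ^ 5 = 2 / (3 * nu b₂ ^ 3) := by
  have hpos : ∀ φ, 0 < normN b₁ b₂ (circ φ) := fun φ =>
    zero_lt_one.trans_le (one_le_normN_circ b₁ b₂ φ)
  -- The integrand has the antiderivative `sin³ φ / (3 N³)`, and `N = ν(b₂)` at both endpoints.
  have hd : ∀ φ, HasDerivAt (fun φ => Real.sin φ ^ 3 / (3 * normN b₁ b₂ (circ φ) ^ 3))
      (Real.sin φ ^ 2 * (Real.cos φ + b₁ * (b₁ * Real.cos φ + b₂ * Real.sin φ)) /
        normN b₁ b₂ (circ φ) ^ 5) φ := by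
    intro φ
    set l := b₁ * Real.cos φ + b₂ * Real.sin φ with hl
    have h1 : HasDerivAt (fun φ => b₁ * Real.cos φ + b₂ * Real.sin φ)
        (b₁ * -Real.sin φ + b₂ * Real.cos φ) φ :=
      ((Real.hasDerivAt_cos φ).const_mul b₁).add ((Real.hasDerivAt_sin φ).const_mul b₂)
    have h2 : HasDerivAt (fun φ => normN b₁ b₂ (circ φ))
        (l / normN b₁ b₂ (circ φ) * (b₁ * -Real.sin φ + b₂ * Real.cos φ)) φ := by
      have := (hasDerivAt_nu l).comp φ h1
      rw [hl, ← normN_circ] at this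
      refine this.congr_of_eventuallyEq (Eventually.of_forall fun ψ => ?_)
      exact normN_circ _ _ _
    have h3 := ((Real.hasDerivAt_sin φ).fun_pow 3).fun_div ((h2.fun_pow 3).const_mul 3)
      (mul_ne_zero three_ne_zero (pow_ne_zero 3 (hpos φ).ne'))
    convert! h3 using 1
    have hN := hpos φ
    have hsq := normN_circ_sq b₁ b₂ φ
    have hsc := Real.sin_sq_add_cos_sq φ
    rw [← hl] at hsq
    set N := normN b₁ b₂ (circ φ)
    set s := Real.sin φ
    set c := Real.cos φ
    have key : c + b₁ * l = c * N ^ 2 - s * l * (b₁ * -s + b₂ * c) := by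
      rw [hsq]
      have : c * (1 + l ^ 2) - s * l * (b₁ * -s + b₂ * c) =
        c + l * (c * l + b₁ * s ^ 2 - b₂ * s * c) := by ring
      rw [this]
      have h4 : c * l + b₁ * s ^ 2 - b₂ * s * c = b₁ * (s ^ 2 + c ^ 2) := by rw [hl]; ring
      rw [h4, hsc]; ring
    rw [key]
    push_cast
    field_simp
  rw [intervalIntegral.integral_eq_sub_of_hasDerivAt (fun φ _ => hd φ)]
  · have e1 : normN b₁ b₂ (circ (Real.pi / 2)) = nu b₂ := by rw [normN_circ]; simp
    have e2 : normN b₁ b₂ (circ (-(Real.pi / 2))) = nu b₂ := by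
      rw [normN_circ]; simp [nu]
    rw [e1, e2]
    have := nu_pos b₂
    simp
    field_simp
    ring
  · refine Continuous.intervalIntegrable ?_ _ _
    refine Continuous.div (by fun_prop) ?_ fun φ => (pow_pos (hpos φ) 5).ne'
    exact ((continuous_normN b₁ b₂).comp continuous_circ).pow 5

lemma rot_smul_add (y z : ℝ) (v w : Plane) : rot (y • v + z • w) = y • rot v + z • rot w := by
  ext i; fin_cases i <;> simp [rot]; ring

lemma rot_rot (v : Plane) : rot (rot v) = -v := by
  ext i; fin_cases i <;> simp [rot]

lemma dir_frame (χ : Plane) (α φ : ℝ) :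
    Real.cos φ • dir χ α + Real.sin φ • rot (dir χ α) = dir χ (φ + α) := by
  rw [dir, rot_smul_add, rot_rot, dir, Real.cos_add, Real.sin_add]
  module

lemma norm_dir {χ : Plane} (hχ : ‖χ‖ = 1) (θ : ℝ) : ‖dir χ θ‖ = 1 := by
  have := norm_frame_sq hχ (Real.cos θ) (Real.sin θ)
  rw [Real.cos_sq_add_sin_sq] at this
  exact (pow_eq_one_iff_of_nonneg (norm_nonneg _) two_ne_zero).1 this

/-- Since `ν'(z) = z / ν(z)`, the fourth power of `ν` becomes a fifth, matching `T / N⁵`. The shift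
by `α` passes from angles measured from `χ` to angles measured from `η`. -/
lemma hCoeff_eq (s α : ℝ) (k : ℝ → ℝ) :
    hCoeff s α k = 3 / 2 * nu (s * Real.sin α) * ∫ φ in (-(Real.pi / 2))..(Real.pi / 2),
      s * Real.cos (φ + α) / nu (s * Real.cos (φ + α)) ^ 5 * k (φ + α) := by
  rw [hCoeff, intervalIntegral.integral_comp_add_right (fun θ =>
    s * Real.cos θ / nu (s * Real.cos θ) ^ 5 * k θ)]
  have e1 : -(Real.pi / 2) + α = α - Real.pi / 2 := by ring
  have e2 : Real.pi / 2 + α = α + Real.pi / 2 := by ring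
  rw [e1, e2]
  congr 1
  refine intervalIntegral.integral_congr fun θ _ => ?_
  have := nu_pos (s * Real.cos θ)
  simp only [(hasDerivAt_nu (s * Real.cos θ)).deriv]
  field_simp

/-- The right-hand side of the amoeba active contour equation in terms of the asymmetry of the
rescaled amoebas. -/
lemma contourRHS_eq {f u : Plane → ℝ} {x₀ χ : Plane} {α s a : ℝ} (hf : ContDiffAt ℝ 3 f x₀)
    (hs : ‖gradient f x₀‖ = s) (ha : ‖gradient u x₀‖ = a) (ha0 : 0 < a) :
    contourRHS f u x₀ χ α = -(3 / 2 * a * nu (s * Real.sin α) *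
      asymm (s * Real.cos α) (-(s * Real.sin α))
        (cubicT (s * Real.cos α) (-(s * Real.sin α)) (d2 f x₀ (dir χ α) (dir χ α))
          (d2 f x₀ (dir χ α) (rot (dir χ α))) (d2 f x₀ (rot (dir χ α)) (rot (dir χ α)))
          (d2 u x₀ (rot (dir χ α)) (rot (dir χ α)) / a))) := by
  set b₁ := s * Real.cos α with hb₁
  set b₂ := -(s * Real.sin α) with hb₂
  set k := d2 u x₀ (rot (dir χ α)) (rot (dir χ α)) / a with hk
  have hka : d2 u x₀ (rot (dir χ α)) (rot (dir χ α)) = a * k := by rw [hk]; field_simp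
  have hnu : nu (s * Real.sin α) = nu b₂ := by rw [hb₂]; simp [nu]
  have hl : ∀ φ, b₁ * Real.cos φ + b₂ * Real.sin φ = s * Real.cos (φ + α) := fun φ => by
    rw [hb₁, hb₂, Real.cos_add]; ring
  have hN : ∀ φ, normN b₁ b₂ (circ φ) = nu (s * Real.cos (φ + α)) := fun φ => by
    rw [normN_circ, hl]
  have hpos : ∀ φ, 0 < nu (s * Real.cos (φ + α)) := fun φ => nu_pos _
  have hnuc : Continuous nu := by unfold nu; fun_prop
  have hw : Continuous fun φ => s * Real.cos (φ + α) / nu (s * Real.cos (φ + α)) ^ 5 :=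
    Continuous.div (by fun_prop) (by fun_prop) fun φ => (pow_pos (hpos φ) 5).ne'
  -- The two terms of `cubicT` separate. The Hessian of `f`, rewritten in the frame of `χ`, gives
  -- the three `H` integrals. The curvature part gives `-2 k / (3 ν³)`, which the prefactor `-(3/2)
  -- a ν` turns into `u_ξξ / ν²`.
  have e1 : asymm b₁ b₂ (cubicT b₁ b₂ (d2 f x₀ (dir χ α) (dir χ α))
      (d2 f x₀ (dir χ α) (rot (dir χ α))) (d2 f x₀ (rot (dir χ α)) (rot (dir χ α))) k) =
      (∫ φ in (-(Real.pi / 2))..(Real.pi / 2),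
        (s * Real.cos (φ + α) / nu (s * Real.cos (φ + α)) ^ 5 * Real.cos (φ + α) ^ 2 * d2 f x₀ χ χ +
        2 * (s * Real.cos (φ + α) / nu (s * Real.cos (φ + α)) ^ 5 *
          (Real.sin (φ + α) * Real.cos (φ + α))) * d2 f x₀ χ (rot χ) +
        s * Real.cos (φ + α) / nu (s * Real.cos (φ + α)) ^ 5 * Real.sin (φ + α) ^ 2 *
          d2 f x₀ (rot χ) (rot χ))) - k * (2 / (3 * nu b₂ ^ 3)) := by
    rw [← integral_curvature b₁ b₂, ← intervalIntegral.integral_const_mul,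
      ← intervalIntegral.integral_sub, asymm]
    · refine intervalIntegral.integral_congr fun φ _ => ?_
      have h1 : d2 f x₀ (dir χ α) (dir χ α) * Real.cos φ ^ 2 +
          2 * d2 f x₀ (dir χ α) (rot (dir χ α)) * Real.cos φ * Real.sin φ +
          d2 f x₀ (rot (dir χ α)) (rot (dir χ α)) * Real.sin φ ^ 2 =
          d2 f x₀ χ χ * Real.cos (φ + α) ^ 2 +
          2 * d2 f x₀ χ (rot χ) * Real.cos (φ + α) * Real.sin (φ + α) +
          d2 f x₀ (rot χ) (rot χ) * Real.sin (φ + α) ^ 2 := by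
        rw [← d2_frame hf, ← d2_frame hf, dir_frame]; rfl
      simp only [cubicT, circ]
      rw [h1]
      have h2 := hN φ
      rw [circ] at h2
      rw [h2, hl]
      have := hpos φ
      field_simp
    · refine Continuous.intervalIntegrable ?_ _ _
      fun_prop
    · refine Continuous.intervalIntegrable ?_ _ _
      refine continuous_const.mul (Continuous.div (by fun_prop) ?_ fun φ => by
        rw [hN]; exact (pow_pos (hpos φ) 5).ne')
      exact ((continuous_normN b₁ b₂).comp continuous_circ).pow 5
  rw [e1, intervalIntegral.integral_add, intervalIntegral.integral_add,
    intervalIntegral.integral_mul_const, intervalIntegral.integral_mul_const,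
    intervalIntegral.integral_mul_const, intervalIntegral.integral_const_mul,
    contourRHS, hs, ha, hCoeff_eq, hCoeff_eq, hCoeff_eq, hka, hnu]
  · have := nu_pos b₂
    field_simp
    ring
  all_goals
    refine Continuous.intervalIntegrable ?_ _ _
    fun_prop

/-! ### Back to amoebas: ranks and small biases -/

/-- The area below a level is, after an affine change of the level, `ρ²` times the continuous
monotone function `subArea`. It therefore takes every intermediate value, and the infimum defining
the rank value attains the rank exactly. -/
lemma rankAttained_of_localModel {a b₁ b₂ C ρ k κ : ℝ} {T : ℝ × ℝ → ℝ} {A : Set Plane}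
    {u : Plane → ℝ} {x₀ e : Plane} (he : ‖e‖ = 1) (hρ : 0 < ρ) (hCρ : C * ρ < a)
    (h : LocalModel a b₁ b₂ T C ρ (chart x₀ e k ρ ⁻¹' A)
      (fun w => (u (chart x₀ e k ρ w) - u x₀) / ρ))
    (hκ0 : 0 < κ) (hκ : κ < volume.real (chart x₀ e k ρ ⁻¹' A)) :
    RankAttained A u (ρ ^ 2 * κ) ∧
      subArea (chart x₀ e k ρ ⁻¹' A) (fun w => (u (chart x₀ e k ρ w) - u x₀) / ρ)
        ((rankValue A u (ρ ^ 2 * κ) - u x₀) / ρ) = κ := by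
  have hsq : 0 < ρ ^ 2 := by positivity
  have hG : ∀ m, area {x | x ∈ A ∧ u x ≤ m} = ρ ^ 2 * subArea (chart x₀ e k ρ ⁻¹' A)
      (fun w => (u (chart x₀ e k ρ w) - u x₀) / ρ) ((m - u x₀) / ρ) := by
    intro m
    rw [area_eq_chart x₀ he k hρ, subArea]
    congr 2
    ext w
    simp only [mem_preimage, mem_ofPred_eq, div_le_div_iff_of_pos_right hρ, sub_le_sub_iff_right]
  set G : ℝ → ℝ := fun m => area {x | x ∈ A ∧ u x ≤ m} with hGdef
  have hcont : Continuous G := by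
    have : G = fun m => ρ ^ 2 * subArea (chart x₀ e k ρ ⁻¹' A)
      (fun w => (u (chart x₀ e k ρ w) - u x₀) / ρ) ((m - u x₀) / ρ) := funext hG
    rw [this]
    exact continuous_const.mul ((h.continuous_subArea hCρ).comp (by fun_prop))
  have hmono : Monotone G := fun m m' hm => by
    simp only [hGdef, hG]
    refine mul_le_mul_of_nonneg_left (h.monotone_subArea ?_) hsq.le
    gcongr
  obtain ⟨t₀, ht₀⟩ := h.subArea_eq_zero
  obtain ⟨t₁, ht₁⟩ := h.subArea_eq_volume
  have hshift : ∀ t, (u x₀ + ρ * t - u x₀) / ρ = t := fun t => by field_simp; ring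
  have key : G (rankValue A u (ρ ^ 2 * κ)) = ρ ^ 2 * κ := by
    refine eq_of_continuous_sInf hcont (m₀ := u x₀ + ρ * t₀) (m₁ := u x₀ + ρ * t₁) hmono ?_ ?_
    · simp only [hGdef, hG, hshift, ht₀]; rw [mul_zero]; positivity
    · simp only [hGdef, hG, hshift, ht₁]
      exact mul_le_mul_of_nonneg_left hκ.le hsq.le
  refine ⟨⟨by positivity, ?_, key⟩, ?_⟩
  · rw [area_eq_chart x₀ he k hρ]
    exact mul_lt_mul_of_pos_left hκ hsq
  · have := key
    simp only [hGdef, hG] at this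
    exact mul_left_cancel₀ hsq.ne' this

lemma fderiv_eq_inner_gradient (h : Plane → ℝ) (x v : Plane) :
    fderiv ℝ h x v = inner ℝ (gradient h x) v :=
  (InnerProductSpace.toDual_symm_apply (𝕜 := ℝ)).symm

/-- The situation of the theorem in rescaled coordinates. -/
structure Rescaled (Ω : Set Plane) (f u : Plane → ℝ) (x₀ χ : Plane) (α a s : ℝ)
    (T : ℝ × ℝ → ℝ) (K : ℝ) (A : ℝ → Set (ℝ × ℝ)) (U : ℝ → ℝ × ℝ → ℝ) : Prop where
  pos : 0 < a
  isCubic : IsCubic (s * Real.cos α) (-(s * Real.sin α)) T K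
  family : ModelFamily a (s * Real.cos α) (-(s * Real.sin α)) T A U
  area_eq : ∀ ρ, 0 < ρ → area (amoeba Ω f x₀ ρ) = ρ ^ 2 * volume.real (A ρ)
  rank : ∀ᶠ ρ in 𝓝[>] 0, ∀ κ, 0 < κ → κ < volume.real (A ρ) →
    RankAttained (amoeba Ω f x₀ ρ) u (ρ ^ 2 * κ) ∧
      subArea (A ρ) (U ρ) ((rankValue (amoeba Ω f x₀ ρ) u (ρ ^ 2 * κ) - u x₀) / ρ) = κ
  rhs : contourRHS f u x₀ χ α = -(3 / 2 * a * nu (s * Real.sin α) *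
    asymm (s * Real.cos α) (-(s * Real.sin α)) T)

/-- The frame is `e = η`, in which `∇f` has components `s cos α` and `-s sin α` and the tangential
derivative of `u` vanishes. -/
lemma exists_rescaled {Ω : Set Plane} {f u : Plane → ℝ} (hf : ContDiffOn ℝ ∞ f Ω)
    (hu : ContDiffOn ℝ ∞ u Ω) {x₀ : Plane} (hx₀ : x₀ ∈ interior Ω) (hgrad : gradient u x₀ ≠ 0)
    {χ : Plane} {α : ℝ} (hχ : ‖χ‖ = 1) (hfχ : gradient f x₀ = ‖gradient f x₀‖ • χ)
    (huα : gradient u x₀ = ‖gradient u x₀‖ • dir χ α) :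
    ∃ T K A U, Rescaled Ω f u x₀ χ α ‖gradient u x₀‖ ‖gradient f x₀‖ T K A U := by
  set a := ‖gradient u x₀‖ with ha
  set s := ‖gradient f x₀‖ with hs
  have ha0 : 0 < a := norm_pos_iff.2 hgrad
  have he := norm_dir hχ α
  have h1 : fderiv ℝ f x₀ (dir χ α) = s * Real.cos α := by
    rw [fderiv_eq_inner_gradient, hfχ, dir, inner_smul_left, inner_add_right, inner_smul_right,
      inner_smul_right, inner_rot, real_inner_self_eq_norm_sq, hχ]
    simp
  have h2 : fderiv ℝ f x₀ (rot (dir χ α)) = -(s * Real.sin α) := by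
    rw [fderiv_eq_inner_gradient, hfχ, dir, rot_smul_add, rot_rot, inner_smul_left, inner_add_right,
      inner_smul_right, inner_smul_right, inner_rot, inner_neg_right, real_inner_self_eq_norm_sq, hχ]
    simp
  have h3 : fderiv ℝ u x₀ (dir χ α) = a := by
    rw [fderiv_eq_inner_gradient, huα, inner_smul_left, real_inner_self_eq_norm_sq, he]
    simp
  have h4 : fderiv ℝ u x₀ (rot (dir χ α)) = 0 := by
    rw [fderiv_eq_inner_gradient, huα, inner_smul_left, inner_rot, mul_zero]
  obtain ⟨C, hC, δ, hδ, H⟩ := exists_localModel hf hu hx₀ he ha0 h3 h4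
  rw [h1, h2] at H
  obtain ⟨K, hK⟩ := exists_isCubic_cubicT (s * Real.cos α) (-(s * Real.sin α))
    (d2 f x₀ (dir χ α) (dir χ α)) (d2 f x₀ (dir χ α) (rot (dir χ α)))
    (d2 f x₀ (rot (dir χ α)) (rot (dir χ α))) (d2 u x₀ (rot (dir χ α)) (rot (dir χ α)) / a)
  have hfam := (⟨C, hC, δ, hδ, H⟩ : ModelFamily a (s * Real.cos α) (-(s * Real.sin α)) _ (fun ρ => _)
    (fun ρ => _))
  refine ⟨_, K, _, _, ha0, hK, hfam, fun ρ hρ => area_eq_chart x₀ he _ hρ _, ?_, ?_⟩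
  · obtain ⟨C', hev⟩ := ModelFamily.eventually_localModel hfam ha0
    filter_upwards [hev, self_mem_nhdsWithin] with ρ hρ hρ0 κ hκ0 hκ
    exact rankAttained_of_localModel he hρ0 hρ.1 hρ.2 hκ0 hκ
  · have h5 : (3 : WithTop ℕ∞) ≤ (∞ : WithTop ℕ∞) := ENat.LEInfty.out
    exact contourRHS_eq ((hf.contDiffAt (mem_interior_iff_mem_nhds.1 hx₀)).of_le h5) hs.symm ha.symm ha0

namespace Rescaled

variable {Ω : Set Plane} {f u : Plane → ℝ} {x₀ χ : Plane} {α a s K : ℝ} {T : ℝ × ℝ → ℝ}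
  {A : ℝ → Set (ℝ × ℝ)} {U : ℝ → ℝ × ℝ → ℝ}

lemma tendsto_volume (h : Rescaled Ω f u x₀ χ α a s T K A U) :
    Tendsto (fun ρ => volume.real (A ρ)) (𝓝[>] 0) (𝓝 (Real.pi / nu s)) := by
  refine h.family.tendsto_volume h.pos h.isCubic ?_
  have := Real.sin_sq_add_cos_sq α
  linear_combination -(s ^ 2) * this

lemma eventually_rank (h : Rescaled Ω f u x₀ χ α a s T K A U) {κ : ℝ → ℝ} {κ₀ : ℝ}
    (hκ : Tendsto κ (𝓝[>] 0) (𝓝 κ₀)) (h0 : 0 < κ₀) (h1 : κ₀ < Real.pi / nu s) :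
    ∀ᶠ ρ in 𝓝[>] 0, RankAttained (amoeba Ω f x₀ ρ) u (ρ ^ 2 * κ ρ) ∧
      subArea (A ρ) (U ρ) ((rankValue (amoeba Ω f x₀ ρ) u (ρ ^ 2 * κ ρ) - u x₀) / ρ) = κ ρ := by
  filter_upwards [h.rank, hκ.eventually_const_lt h0, hκ.eventually_lt h.tendsto_volume h1]
    with ρ h2 h3 h4
  exact h2 _ h3 h4

/-- All small biases are treated at once. Only the rescaled area `B / ρ² → 0` matters, and the shift
it causes is `τ (3 B / ρ³) a ν(s sin α)` to leading order. The hypothesis `hγ` says that this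
coefficient is `γ F` up to a relative error tending to zero. -/
lemma approximatesForce (h : Rescaled Ω f u x₀ χ α a s T K A U) {bias : ℝ → ℝ → ℝ} {γ : ℝ → ℝ}
    {F : ℝ}
    (hβ : Tendsto (fun ρ => bias ρ (area (amoeba Ω f x₀ ρ)) / ρ ^ 2) (𝓝[>] 0) (𝓝 0))
    (hγ : (fun ρ => 3 * bias ρ (area (amoeba Ω f x₀ ρ)) / ρ ^ 3 * (a * nu (s * Real.sin α)) -
      γ ρ * F) =o[𝓝[>] 0] γ) :
    ApproximatesForce Ω f u x₀ χ α bias γ F := by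
  set B : ℝ → ℝ := fun ρ => bias ρ (area (amoeba Ω f x₀ ρ)) with hB
  set c := a * nu (s * Real.sin α) with hc
  have hν := nu_pos (s * Real.sin α)
  have hc0 : 0 < c := mul_pos h.pos hν
  have hcneg : a * nu (-(s * Real.sin α)) = c := by rw [hc]; simp [nu]
  have hπ : 0 < Real.pi / nu s := div_pos Real.pi_pos (nu_pos s)
  have hvol := h.tendsto_volume
  have hvol2 : Tendsto (fun ρ => volume.real (A ρ) / 2) (𝓝[>] 0) (𝓝 (Real.pi / nu s / 2)) :=
    hvol.div_const 2
  have hvolB : Tendsto (fun ρ => volume.real (A ρ) / 2 + B ρ / ρ ^ 2) (𝓝[>] 0)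
      (𝓝 (Real.pi / nu s / 2)) := by simpa using hvol2.add hβ
  have r0 := h.eventually_rank hvol2 (by linarith) (by linarith)
  have rB := h.eventually_rank hvolB (by linarith) (by linarith)
  have hpos : ∀ᶠ ρ : ℝ in 𝓝[>] 0, 0 < ρ := self_mem_nhdsWithin
  have e0 : ∀ᶠ ρ in 𝓝[>] 0, rankValue (amoeba Ω f x₀ ρ) u (ρ ^ 2 * (volume.real (A ρ) / 2)) =
      medianStep Ω f u x₀ ρ := by
    filter_upwards [hpos] with ρ hρ
    rw [medianStep, h.area_eq ρ hρ, mul_div_assoc]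
  have eB : ∀ᶠ ρ in 𝓝[>] 0, ρ ^ 2 * (volume.real (A ρ) / 2 + B ρ / ρ ^ 2) =
      biasedRank Ω f x₀ ρ (bias ρ) := by
    filter_upwards [hpos] with ρ hρ
    rw [biasedRank, mul_add, mul_div_cancel₀ _ (pow_pos hρ 2).ne', ← mul_div_assoc,
      ← h.area_eq ρ hρ]
  set t₀ : ℝ → ℝ := fun ρ => (medianStep Ω f u x₀ ρ - u x₀) / ρ with ht₀
  set tB : ℝ → ℝ := fun ρ => (biasedStep Ω f u x₀ ρ (bias ρ) - u x₀) / ρ with htB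
  have s0 : ∀ᶠ ρ in 𝓝[>] 0, subArea (A ρ) (U ρ) (t₀ ρ) = volume.real (A ρ) / 2 := by
    filter_upwards [r0, e0] with ρ h1 h2
    have := h1.2
    rwa [h2] at this
  have sB : ∀ᶠ ρ in 𝓝[>] 0, subArea (A ρ) (U ρ) (tB ρ) = volume.real (A ρ) / 2 + B ρ / ρ ^ 2 := by
    filter_upwards [rB, eB] with ρ h1 h2
    have := h1.2
    rwa [h2] at this
  have hid : Tendsto (fun ρ : ℝ => ρ) (𝓝[>] 0) (𝓝 0) := nhdsWithin_le_nhds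
  have hdef : Tendsto (fun ρ => volume.real (A ρ) / 2 - subArea (A ρ) (U ρ) 0) (𝓝[>] 0) (𝓝 0) := by
    have := (h.family.tendsto_median_defect h.pos h.isCubic).mul hid
    rw [mul_zero] at this
    refine this.congr' ?_
    filter_upwards [hpos] with ρ hρ
    field_simp
  have l0 : Tendsto t₀ (𝓝[>] 0) (𝓝 0) := by
    refine h.family.tendsto_zero h.pos h.isCubic (hdef.congr' ?_)
    filter_upwards [s0] with ρ h1
    rw [h1]
  have lB : Tendsto tB (𝓝[>] 0) (𝓝 0) := by
    have := hdef.add hβ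
    rw [add_zero] at this
    refine h.family.tendsto_zero h.pos h.isCubic (this.congr' ?_)
    filter_upwards [sB] with ρ h1
    rw [h1]; ring
  have m0 := h.family.tendsto_median h.pos h.isCubic l0 s0
  have v0 : (fun ρ => tB ρ - t₀ ρ - c / 2 * (B ρ / ρ ^ 2)) =o[𝓝[>] 0] fun ρ => B ρ / ρ ^ 2 := by
    refine (h.family.isLittleO_value h.pos h.isCubic l0 lB).congr' ?_ ?_
    · filter_upwards [s0, sB] with ρ h1 h2
      rw [h1, h2, hcneg]; ring
    · filter_upwards [s0, sB] with ρ h1 h2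
      rw [h1, h2]; ring
  have hX : (fun ρ => 3 * B ρ / ρ ^ 3 * c) =O[𝓝[>] 0] γ := by
    have h1 : (fun ρ => γ ρ * F) =O[𝓝[>] 0] γ := by
      simpa [mul_comm] using (Asymptotics.isBigO_refl γ (𝓝[>] (0 : ℝ))).const_mul_left F
    simpa using hγ.isBigO.add h1
  -- Because `c > 0`, `hγ` also bounds `B / ρ³` by a multiple of `γ`, so errors small against `B /
  -- ρ` are small against `τ γ`, even where `γ` is not bounded.
  have hρβ : (fun ρ => ρ * (B ρ / ρ ^ 2)) =O[𝓝[>] 0] fun ρ => ρ ^ 2 / 6 * γ ρ := by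
    have h1 := ((Asymptotics.isBigO_refl (fun ρ : ℝ => ρ ^ 2 / 6) (𝓝[>] (0 : ℝ))).mul hX).const_mul_left
      (2 / c)
    refine h1.congr' ?_ EventuallyEq.rfl
    filter_upwards [hpos] with ρ hρ
    field_simp
    ring
  have hmain : (fun ρ : ℝ => biasedStep Ω f u x₀ ρ (bias ρ) - medianStep Ω f u x₀ ρ
      - ρ ^ 2 / 6 * (γ ρ * F)) =o[𝓝[>] (0 : ℝ)] fun ρ : ℝ => ρ ^ 2 / 6 * γ ρ := by
    have h1 := ((Asymptotics.isBigO_refl (fun ρ : ℝ => ρ) (𝓝[>] (0 : ℝ))).mul_isLittleO v0).trans_isBigO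
      hρβ
    have h2 := (Asymptotics.isBigO_refl (fun ρ : ℝ => ρ ^ 2 / 6) (𝓝[>] (0 : ℝ))).mul_isLittleO hγ
    refine (h1.add h2).congr' ?_ EventuallyEq.rfl
    filter_upwards [hpos] with ρ hρ
    simp only [ht₀, htB]
    field_simp
    ring
  refine ⟨?_, hmain, fun γ₀ hγ₀ => ?_⟩
  · filter_upwards [rB, eB] with ρ h1 h2
    rw [← h2]; exact h1.1
  · have h1 : Tendsto (fun ρ : ℝ => (biasedStep Ω f u x₀ ρ (bias ρ) - medianStep Ω f u x₀ ρ
      - ρ ^ 2 / 6 * (γ ρ * F)) / (ρ ^ 2 / 6)) (𝓝[>] 0) (𝓝 0) := by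
      have h2 := hmain.trans_isBigO
        ((Asymptotics.isBigO_refl (fun ρ : ℝ => ρ ^ 2 / 6) (𝓝[>] (0 : ℝ))).mul (hγ₀.isBigO_one ℝ))
      simp only [mul_one] at h2
      exact h2.tendsto_div_nhds_zero
    -- The factor `6` is `ρ² / τ`: the median contributes `ρ t₀`, and `t₀ / ρ` has a limit.
    have h2 := ((m0.const_mul 6).add h1).add (hγ₀.mul_const F)
    have e1 : 6 * -(a * nu (-(s * Real.sin α)) / 4 *
        asymm (s * Real.cos α) (-(s * Real.sin α)) T) + 0 + γ₀ * F =
        contourRHS f u x₀ χ α + γ₀ * F := by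
      rw [h.rhs, hcneg, hc]; ring
    rw [e1] at h2
    refine h2.congr' ?_
    filter_upwards [hpos] with ρ hρ
    simp only [ht₀]
    field_simp
    ring

end Rescaled

/-! ### Fixed quantiles and the offset function of the disc -/

lemma discArea_diskOffset {q : ℝ} (hq : q ∈ Ioo (-(1 / 2) : ℝ) (1 / 2)) :
    discArea (diskOffset q) = Real.pi / 2 + q * Real.pi := by
  have hπ := Real.pi_pos
  have : diskOffset q = sInf {m | Real.pi / 2 + q * Real.pi ≤ discArea m} := by
    rw [diskOffset, rankValue]
    simp_rw [area_closedBall_le]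
  rw [this]
  refine eq_of_continuous_sInf continuous_discArea (m₀ := -1) (m₁ := 1) monotone_discArea ?_ ?_
  · rw [discArea_of_le le_rfl]; nlinarith [hq.1]
  · rw [discArea_of_one_le le_rfl]; nlinarith [hq.2]

lemma diskOffset_mem {q : ℝ} (hq : q ∈ Ioo (-(1 / 2) : ℝ) (1 / 2)) :
    diskOffset q ∈ Ioo (-1 : ℝ) 1 := by
  have hπ := Real.pi_pos
  have h := discArea_diskOffset hq
  constructor
  · by_contra! hcon
    rw [discArea_of_le hcon] at h
    nlinarith [hq.1]
  · by_contra! hcon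
    rw [discArea_of_one_le hcon] at h
    nlinarith [hq.2]

/-- The area function of the disc equals `π / 2` with derivative `2` at `0`, so `2 c ≈ q π` for `c =
diskOffset q`. The strip estimate gives this as `|q π - 2 c| ≤ ε' |c|`, first confining `c` to the
range where the estimate is valid. -/
lemma tendsto_diskOffset_div :
    Tendsto (fun q : ℝ => diskOffset q / q) (𝓝[≠] (0 : ℝ)) (𝓝 (Real.pi / 2)) := by
  have hπ := Real.pi_pos
  rw [Metric.tendsto_nhds]
  intro ε hε
  set ε' := min 1 (ε / Real.pi) with hε'
  have hε'0 : 0 < ε' := by positivity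
  have hε'1 : ε' ≤ 1 := min_le_left _ _
  have hε'π : ε' * Real.pi ≤ ε := by
    have := mul_le_mul_of_nonneg_right (min_le_right 1 (ε / Real.pi)) hπ.le
    rwa [div_mul_cancel₀ _ hπ.ne'] at this
  obtain ⟨δ, hδ, H⟩ := exists_discArea_strip hε'0
  have hnear : ∀ᶠ q : ℝ in 𝓝[≠] 0, q ∈ Ioo (-(min (1 / 2) (δ / Real.pi))) (min (1 / 2) (δ / Real.pi)) :=
    nhdsWithin_le_nhds (Ioo_mem_nhds (by simp only [Left.neg_neg_iff]; positivity) (by positivity))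
  filter_upwards [hnear, self_mem_nhdsWithin] with q hq hq0
  have hqabs := abs_lt.2 hq
  have hq1 : |q| < 1 / 2 := hqabs.trans_le (min_le_left _ _)
  have hq2 : |q| < δ / Real.pi := hqabs.trans_le (min_le_right _ _)
  rw [lt_div_iff₀ hπ] at hq2
  have hqpos : 0 < |q| := abs_pos.2 hq0
  have h := discArea_diskOffset (abs_lt.1 hq1)
  set c := diskOffset q
  have hqπ := abs_le.1 (le_of_eq (abs_mul q Real.pi))
  rw [abs_of_pos hπ] at hqπ
  have hδ0 := (abs_le.1 (H 0 δ (by simpa using hδ.le) (by rw [abs_of_pos hδ]) hδ.le)).1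
  have hδ1 := (abs_le.1 (H (-δ) 0 (by rw [abs_neg, abs_of_pos hδ]) (by simpa using hδ.le)
    (by linarith))).1
  rw [discArea_zero] at hδ0 hδ1
  have hεδ : ε' * δ ≤ δ := mul_le_of_le_one_left hδ.le hε'1
  have hc1 : c ≤ δ := by
    by_contra! hcon
    have := monotone_discArea hcon.le
    linarith [hqπ.2]
  have hc2 : -δ ≤ c := by
    by_contra! hcon
    have := monotone_discArea hcon.le
    linarith [hqπ.1]
  have hc : |c| ≤ δ := abs_le.2 ⟨hc2, hc1⟩
  have key : |q * Real.pi - 2 * c| ≤ ε' * |c| := by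
    rcases le_total 0 c with h0 | h0
    · have := H 0 c (by simpa using hδ.le) hc h0
      rw [h, discArea_zero] at this
      rw [abs_of_nonneg h0]
      convert this using 2 <;> ring
    · have := H c 0 hc (by simpa using hδ.le) h0
      rw [h, discArea_zero] at this
      rw [abs_of_nonpos h0, ← abs_neg]
      convert this using 2 <;> ring
  have hcq : |c| ≤ Real.pi * |q| := by
    have h1 := abs_sub (q * Real.pi) (q * Real.pi - 2 * c)
    rw [sub_sub_cancel, abs_mul, abs_two, abs_mul, abs_of_pos hπ] at h1
    have : ε' * |c| ≤ |c| := mul_le_of_le_one_left (abs_nonneg _) hε'1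
    linarith
  rw [Real.dist_eq]
  have e1 : c / q - Real.pi / 2 = -(q * Real.pi - 2 * c) / (2 * q) := by
    have : q ≠ 0 := hq0
    field_simp; ring
  rw [e1, abs_div, abs_neg, abs_mul, abs_two, div_lt_iff₀ (by positivity)]
  have h1 := mul_le_mul_of_nonneg_left hcq hε'0.le
  have h2 := mul_le_mul_of_nonneg_right hε'π hqpos.le
  have h3 := mul_pos hε hqpos
  linarith

lemma quantileForce_eq (a s α : ℝ) :
    quantileForce a s α = a * (nu (s * Real.sin α) / nu s) := by
  rw [quantileForce, nu, nu, mul_pow, Real.sqrt_div (by positivity)]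

namespace Rescaled

variable {Ω : Set Plane} {f u : Plane → ℝ} {x₀ χ : Plane} {α a s K : ℝ} {T : ℝ × ℝ → ℝ}
  {A : ℝ → Set (ℝ × ℝ)} {U : ℝ → ℝ × ℝ → ℝ}

/-- The filter with a quantile bias that does not depend on the radius. -/
lemma quantile_const (h : Rescaled Ω f u x₀ χ α a s T K A U) {q : ℝ}
    (hq : q ∈ Ioo (-(1 / 2) : ℝ) (1 / 2)) :
    (∀ᶠ ρ in 𝓝[>] (0 : ℝ), RankAttained (amoeba Ω f x₀ ρ) u
        (biasedRank Ω f x₀ ρ (fun p => q * p))) ∧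
      Tendsto (fun ρ : ℝ => (biasedStep Ω f u x₀ ρ (fun p => q * p) - u x₀) / ρ)
        (𝓝[>] (0 : ℝ)) (𝓝 (diskOffset q * quantileForce a s α)) := by
  have hπ := Real.pi_pos
  have hνs := nu_pos s
  have hν := nu_pos (s * Real.sin α)
  have ha := h.pos
  set F := quantileForce a s α with hF
  have hFe : a * (nu (-(s * Real.sin α)) / nu s) = F := by
    rw [hF, quantileForce_eq]; simp [nu]
  have hF0 : 0 < F := by rw [hF, quantileForce_eq]; positivity
  set κ : ℝ → ℝ := fun ρ => (1 / 2 + q) * volume.real (A ρ) with hκ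
  have hκlim : Tendsto κ (𝓝[>] 0) (𝓝 ((1 / 2 + q) * (Real.pi / nu s))) :=
    h.tendsto_volume.const_mul _
  have hq1 := hq.1
  have hq2 := hq.2
  have hπν : 0 < Real.pi / nu s := by positivity
  have r := h.eventually_rank hκlim (mul_pos (by linarith) hπν) (by nlinarith)
  have e : ∀ᶠ ρ in 𝓝[>] 0, ρ ^ 2 * κ ρ = biasedRank Ω f x₀ ρ (fun p => q * p) := by
    filter_upwards [self_mem_nhdsWithin] with ρ hρ
    rw [biasedRank, h.area_eq ρ hρ, hκ]; ring
  refine ⟨?_, ?_⟩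
  · filter_upwards [r, e] with ρ h1 h2
    rw [← h2]; exact h1.1
  set t : ℝ → ℝ := fun ρ => (biasedStep Ω f u x₀ ρ (fun p => q * p) - u x₀) / ρ with ht
  have hsub : ∀ᶠ ρ in 𝓝[>] 0, subArea (A ρ) (U ρ) (t ρ) = κ ρ := by
    filter_upwards [r, e] with ρ h1 h2
    have := h1.2
    rwa [h2] at this
  set c := diskOffset q with hc
  have hc1 : -1 < c ∧ c < 1 := diskOffset_mem hq
  have hcA := discArea_diskOffset hq
  rw [← hc] at hcA
  have hlim : ∀ x, Tendsto (fun ρ => subArea (A ρ) (U ρ) x) (𝓝[>] 0)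
      (𝓝 (1 / nu s * discArea (x / F))) := by
    intro x
    have := h.family.tendsto_subArea h.pos h.isCubic (s := s)
      (by linear_combination -(s ^ 2) * Real.sin_sq_add_cos_sq α) x
    rwa [hFe] at this
  have hκc : (1 / 2 + q) * (Real.pi / nu s) = 1 / nu s * discArea c := by
    rw [hcA]; ring
  rw [hκc] at hκlim
  obtain ⟨C, hC⟩ := h.family.eventually_localModel h.pos
  -- For a fixed level `x` on either side of the claimed limit, the area below `x` converges to a
  -- value strictly on the same side of the limiting rank. Monotonicity in the level then places `t
  -- ρ` on the correct side of `x`.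
  refine tendsto_order.2 ⟨fun x hx => ?_, fun x hx => ?_⟩
  · have h1 : x / F < c := by rwa [div_lt_iff₀ hF0]
    have h2 : 1 / nu s * discArea (x / F) < 1 / nu s * discArea c :=
      mul_lt_mul_of_pos_left (discArea_lt h1 hc1.1 (h1.trans hc1.2)) (by positivity)
    filter_upwards [hsub, hC, (hlim x).eventually_lt hκlim h2] with ρ h3 h4 h5
    by_contra! hcon
    have := h4.2.monotone_subArea hcon
    linarith
  · have h1 : c < x / F := by rwa [lt_div_iff₀ hF0]
    have h2 : 1 / nu s * discArea c < 1 / nu s * discArea (x / F) :=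
      mul_lt_mul_of_pos_left (discArea_lt h1 (hc1.1.trans h1) hc1.2) (by positivity)
    filter_upwards [hsub, hC, hκlim.eventually_lt (hlim x) h2] with ρ h3 h4 h5
    by_contra! hcon
    have := h4.2.monotone_subArea hcon
    linarith

end Rescaled

/-! ### The three kinds of bias -/

lemma isLittleO_mul_of_tendsto_zero {l : Filter ℝ} {g h : ℝ → ℝ} (hh : Tendsto h l (𝓝 0)) :
    (fun ρ => g ρ * h ρ) =o[l] g := by
  have := (Asymptotics.isBigO_refl g l).mul_isLittleO ((Asymptotics.isLittleO_one_iff ℝ).2 hh)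
  simpa using this

namespace Rescaled

variable {Ω : Set Plane} {f u : Plane → ℝ} {x₀ χ : Plane} {α a s K : ℝ} {T : ℝ × ℝ → ℝ}
  {A : ℝ → Set (ℝ × ℝ)} {U : ℝ → ℝ × ℝ → ℝ}

lemma offset (h : Rescaled Ω f u x₀ χ α a s T K A U) {b : ℝ → ℝ}
    (hb : b =o[𝓝[>] (0 : ℝ)] fun ρ : ℝ => ρ ^ 2) :
    ApproximatesForce Ω f u x₀ χ α (fun ρ _ => b ρ) (fun ρ => 3 * b ρ / ρ ^ 3)
      (offsetForce a s α) := by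
  refine h.approximatesForce hb.tendsto_div_nhds_zero ?_
  simp only [offsetForce, sub_self]
  exact Asymptotics.isLittleO_zero _ _

/-- With `p = ρ² vol (A ρ)`, the coefficient `3 q p a ν(s sin α) / ρ³` differs from `γ F` by the
factor by which `vol (A ρ)` differs from its limit `π / ν(s)`. This is a relative error tending to
zero, whatever the rate of `q`. -/
lemma quantile (h : Rescaled Ω f u x₀ χ α a s T K A U) {q : ℝ → ℝ}
    (hq : Tendsto q (𝓝[>] (0 : ℝ)) (𝓝 0)) :
    ApproximatesForce Ω f u x₀ χ α (fun ρ p => q ρ * p) (fun ρ => 3 * Real.pi * q ρ / ρ)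
      (quantileForce a s α) := by
  have hvol := h.tendsto_volume
  have hνs := nu_pos s
  refine h.approximatesForce ?_ ?_
  · have := hq.mul hvol
    rw [zero_mul] at this
    refine this.congr' ?_
    filter_upwards [self_mem_nhdsWithin] with ρ hρ
    have hρ0 : (ρ : ℝ) ≠ 0 := ne_of_gt hρ
    rw [h.area_eq ρ hρ]; field_simp
  · have h1 : Tendsto (fun ρ => (volume.real (A ρ) - Real.pi / nu s) *
        (a * nu (s * Real.sin α) / Real.pi)) (𝓝[>] 0) (𝓝 0) := by
      have := (hvol.sub_const (Real.pi / nu s)).mul_const (a * nu (s * Real.sin α) / Real.pi)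
      simpa using this
    refine (isLittleO_mul_of_tendsto_zero h1).congr' ?_ EventuallyEq.rfl
    filter_upwards [self_mem_nhdsWithin] with ρ hρ
    have hρ0 : (ρ : ℝ) ≠ 0 := ne_of_gt hρ
    have hπ := Real.pi_pos
    rw [h.area_eq ρ hρ, quantileForce_eq]
    field_simp

/-- As for quantiles, with `p²`: the second factor `π / ν(s)` produces the weight `1 / ν(s)²`. -/
lemma quadratic (h : Rescaled Ω f u x₀ χ α a s T K A U) {r : ℝ → ℝ}
    (hr : Tendsto (fun ρ : ℝ => r ρ * ρ ^ 2) (𝓝[>] (0 : ℝ)) (𝓝 0)) :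
    ApproximatesForce Ω f u x₀ χ α (fun ρ p => r ρ * p ^ 2) (fun ρ => 3 * Real.pi ^ 2 * ρ * r ρ)
      (quadraticForce a s α) := by
  have hvol := h.tendsto_volume
  have hνs := nu_pos s
  refine h.approximatesForce ?_ ?_
  · have := hr.mul (hvol.pow 2)
    rw [zero_mul] at this
    refine this.congr' ?_
    filter_upwards [self_mem_nhdsWithin] with ρ hρ
    have hρ0 : (ρ : ℝ) ≠ 0 := ne_of_gt hρ
    rw [h.area_eq ρ hρ]; field_simp
  · have h1 : Tendsto (fun ρ => (volume.real (A ρ) ^ 2 - (Real.pi / nu s) ^ 2) *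
        (a * nu (s * Real.sin α) / Real.pi ^ 2)) (𝓝[>] 0) (𝓝 0) := by
      have := ((hvol.pow 2).sub_const ((Real.pi / nu s) ^ 2)).mul_const
        (a * nu (s * Real.sin α) / Real.pi ^ 2)
      simpa using this
    refine (isLittleO_mul_of_tendsto_zero h1).congr' ?_ EventuallyEq.rfl
    filter_upwards [self_mem_nhdsWithin] with ρ hρ
    have hρ0 : (ρ : ℝ) ≠ 0 := ne_of_gt hρ
    have hπ := Real.pi_pos
    rw [h.area_eq ρ hρ, quadraticForce]
    field_simp

end Rescaled

/-! ### Rotational symmetry -/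

/-- The derivative of a rotationally symmetric function vanishes in tangential direction. -/
lemma fderiv_rot_eq_zero {Ω : Set Plane} {h : Plane → ℝ} {x₀ z : Plane} (hΩ : Ω ∈ 𝓝 x₀)
    (hd : DifferentiableAt ℝ h x₀) (hz : RotSymmetricAbout Ω z h) :
    fderiv ℝ h x₀ (rot (x₀ - z)) = 0 := by
  set w := x₀ - z with hw
  -- The circle about `z` through `x₀` has velocity `rot w` at `t = 0`, and `h` is constant along it
  -- near `x₀`.
  set c : ℝ → Plane := fun t => z + (Real.cos t • w + Real.sin t • rot w) with hc
  have hc0 : c 0 = x₀ := by simp [hc, hw]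
  have hcd : HasDerivAt c (rot w) 0 := by
    have := (((Real.hasDerivAt_cos 0).smul_const w).add
      ((Real.hasDerivAt_sin 0).smul_const (rot w))).const_add z
    simp only [Real.cos_zero, Real.sin_zero, neg_zero, zero_smul, one_smul, zero_add] at this
    exact this
  have hdist : ∀ t, dist (c t) z = dist x₀ z := by
    intro t
    rw [dist_eq_norm, dist_eq_norm, hc]
    simp only [add_sub_cancel_left]
    refine (pow_left_inj₀ (norm_nonneg _) (norm_nonneg _) two_ne_zero).1 ?_
    rw [norm_add_sq_real, norm_smul, norm_smul, norm_rot, inner_smul_left, inner_smul_right,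
      inner_rot, mul_pow, mul_pow, Real.norm_eq_abs, Real.norm_eq_abs, sq_abs, sq_abs, ← hw]
    linear_combination ‖w‖ ^ 2 * Real.cos_sq_add_sin_sq t
  have hev : ∀ᶠ t in 𝓝 (0 : ℝ), (h ∘ c) t = h x₀ := by
    have : c ⁻¹' Ω ∈ 𝓝 (0 : ℝ) := hcd.continuousAt (by rwa [hc0])
    filter_upwards [this] with t ht
    exact hz _ ht _ (mem_of_mem_nhds hΩ) (hdist t)
  have h1 : HasDerivAt (h ∘ c) (fderiv ℝ h x₀ (rot w)) 0 := by
    have h2 : HasFDerivAt h (fderiv ℝ h x₀) (c 0) := by rw [hc0]; exact hd.hasFDerivAt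
    exact h2.comp_hasDerivAt 0 hcd
  have h2 : HasDerivAt (h ∘ c) 0 0 := (hasDerivAt_const (0 : ℝ) (h x₀)).congr_of_eventuallyEq hev
  exact h1.unique h2

/-- Along each line through the centre the function is even, so its derivative there equals its own
negative. -/
lemma fderiv_center_eq_zero {Ω : Set Plane} {h : Plane → ℝ} {x₀ : Plane} (hΩ : Ω ∈ 𝓝 x₀)
    (hd : DifferentiableAt ℝ h x₀) (hz : RotSymmetricAbout Ω x₀ h) : fderiv ℝ h x₀ = 0 := by
  ext v
  have hcd : ∀ v : Plane, HasDerivAt (fun t : ℝ => x₀ + t • v) v 0 := fun v => by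
    have := ((hasDerivAt_id (0 : ℝ)).smul_const v).const_add x₀
    rw [one_smul] at this
    exact this
  have h1 : ∀ v : Plane, HasDerivAt (fun t : ℝ => h (x₀ + t • v)) (fderiv ℝ h x₀ v) 0 := fun v => by
    have h2 : HasFDerivAt h (fderiv ℝ h x₀) (x₀ + (0 : ℝ) • v) := by
      rw [zero_smul, add_zero]; exact hd.hasFDerivAt
    exact h2.comp_hasDerivAt 0 (hcd v)
  have hmem : ∀ v : Plane, ∀ᶠ t in 𝓝 (0 : ℝ), x₀ + t • v ∈ Ω := fun v =>
    (hcd v).continuousAt (by simpa using hΩ)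
  have hev : (fun t : ℝ => h (x₀ + t • -v)) =ᶠ[𝓝 0] fun t : ℝ => h (x₀ + t • v) := by
    filter_upwards [hmem v, hmem (-v)] with t h3 h4
    exact hz _ h4 _ h3 (by simp)
  have h5 := ((h1 v).congr_of_eventuallyEq hev).unique (h1 (-v))
  rw [map_neg] at h5
  simp only [zero_apply]
  linarith

lemma inner_rot_right (v w : Plane) : inner ℝ v (rot w) = v 1 * w 0 - v 0 * w 1 := by
  simp [rot, PiLp.inner_apply, Fin.sum_univ_two]; ring

/-- For rotationally symmetric images, the gradients are parallel. -/
lemma norm_mul_sin_eq_zero {Ω : Set Plane} {f u : Plane → ℝ} {x₀ χ z : Plane} {α : ℝ}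
    (hΩ : Ω ∈ 𝓝 x₀) (hf : DifferentiableAt ℝ f x₀) (hu : DifferentiableAt ℝ u x₀)
    (hgrad : gradient u x₀ ≠ 0) (hχ : ‖χ‖ = 1) (hfχ : gradient f x₀ = ‖gradient f x₀‖ • χ)
    (huα : gradient u x₀ = ‖gradient u x₀‖ • dir χ α)
    (hfz : RotSymmetricAbout Ω z f) (huz : RotSymmetricAbout Ω z u) :
    ‖gradient f x₀‖ * Real.sin α = 0 := by
  -- The centre of symmetry cannot be `x₀`, as the gradient of `u` would vanish there.
  have hne : x₀ - z ≠ 0 := by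
    intro h0
    have : x₀ = z := sub_eq_zero.1 h0
    rw [← this] at huz
    have h1 := fderiv_center_eq_zero hΩ hu huz
    exact hgrad (by rw [gradient, h1, map_zero])
  have h1 := fderiv_rot_eq_zero hΩ hf hfz
  have h2 := fderiv_rot_eq_zero hΩ hu huz
  rw [fderiv_eq_inner_gradient, hfχ, inner_smul_left] at h1
  rw [fderiv_eq_inner_gradient, huα, inner_smul_left, mul_eq_zero,
    or_iff_right (by simpa using hgrad)] at h2
  rw [mul_eq_zero]
  refine (mul_eq_zero.1 h1).imp (by simp) fun h3 => ?_
  rw [inner_rot_right] at h2 h3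
  set w := x₀ - z
  have hχ2 : χ 0 ^ 2 + χ 1 ^ 2 = 1 := by
    have := EuclideanSpace.norm_sq_eq χ
    rw [hχ, Fin.sum_univ_two] at this
    simpa using this.symm
  have e0 : dir χ α 0 = Real.cos α * χ 0 - Real.sin α * χ 1 := by simp [dir, rot]; ring
  have e1 : dir χ α 1 = Real.cos α * χ 1 + Real.sin α * χ 0 := by simp [dir, rot]
  rw [e0, e1] at h2
  -- If `∇f ≠ 0`, both `χ` and `dir χ α` are orthogonal to `rot w`. Expanding the second condition
  -- leaves `sin α (χ · w) = 0`, and `χ · w = 0` together with `χ ⟂ rot w` would give `w = 0`.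
  have h4 : Real.sin α * (χ 0 * w 0 + χ 1 * w 1) = 0 := by
    linear_combination h2 - Real.cos α * h3
  refine (mul_eq_zero.1 h4).resolve_right fun h5 => hne ?_
  have hw0 : w 0 = 0 := by linear_combination χ 0 * h5 + χ 1 * h3 - w 0 * hχ2
  have hw1 : w 1 = 0 := by linear_combination χ 1 * h5 - χ 0 * h3 - w 1 * hχ2
  ext i
  fin_cases i
  · exact hw0
  · exact hw1

lemma forces_of_mul_sin_eq_zero {a s α : ℝ} (ha : 0 ≤ a) (h : s * Real.sin α = 0) :
    offsetForce a s α = a ∧ edgeStop s * a ≤ quantileForce a s α ∧ quantileForce a s α ≤ a ∧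
      quadraticForce a s α = edgeStop s * a := by
  have hν0 : nu 0 = 1 := by simp [nu]
  have hν := nu_pos s
  have h1 := one_le_nu s
  rw [offsetForce, quantileForce_eq, quadraticForce, edgeStop, h, hν0, ← nu_sq, mul_comm (1 / _) a]
  refine ⟨mul_one a, mul_le_mul_of_nonneg_left ?_ ha, mul_le_of_le_one_right ha ?_, rfl⟩
  · exact one_div_le_one_div_of_le hν (by nlinarith)
  · exact (div_le_one hν).2 h1

end Amoeba

end

theorem mainTheorem5
    (Ω : Set Amoeba.Plane) (f u : Amoeba.Plane → ℝ)
    (hf : ContDiffOn ℝ ∞ f Ω) (hu : ContDiffOn ℝ ∞ u Ω)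
    (x₀ : Amoeba.Plane) (hx₀ : x₀ ∈ interior Ω) (hgrad : gradient u x₀ ≠ 0)
    (χ : Amoeba.Plane) (α : ℝ) (hχ : ‖χ‖ = 1)
    (hfχ : gradient f x₀ = ‖gradient f x₀‖ • χ)
    (huα : gradient u x₀ = ‖gradient u x₀‖ • Amoeba.dir χ α) :
    -- fixed offset bias: rank `p / 2 + b`
    (∀ b : ℝ → ℝ, (b =o[𝓝[>] (0 : ℝ)] fun ρ : ℝ => ρ ^ 2) →
      Amoeba.ApproximatesForce Ω f u x₀ χ α (fun ρ _ => b ρ) (fun ρ => 3 * b ρ / ρ ^ 3)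
        (Amoeba.offsetForce ‖gradient u x₀‖ ‖gradient f x₀‖ α)) ∧
    -- quantile bias: rank `p / 2 + q p`
    (∀ q : ℝ → ℝ, Tendsto q (𝓝[>] (0 : ℝ)) (𝓝 0) →
      Amoeba.ApproximatesForce Ω f u x₀ χ α (fun ρ p => q ρ * p)
        (fun ρ => 3 * Real.pi * q ρ / ρ)
        (Amoeba.quantileForce ‖gradient u x₀‖ ‖gradient f x₀‖ α)) ∧
    -- quantile bias whose strength `q` does not depend on `ρ`
    (∀ q ∈ Ioo (-(1 / 2) : ℝ) (1 / 2),
      (∀ᶠ ρ in 𝓝[>] (0 : ℝ), Amoeba.RankAttained (Amoeba.amoeba Ω f x₀ ρ) u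
        (Amoeba.biasedRank Ω f x₀ ρ (fun p => q * p))) ∧
      Tendsto (fun ρ : ℝ => (Amoeba.biasedStep Ω f u x₀ ρ (fun p => q * p) - u x₀) / ρ)
        (𝓝[>] (0 : ℝ))
        (𝓝 (Amoeba.diskOffset q *
          Amoeba.quantileForce ‖gradient u x₀‖ ‖gradient f x₀‖ α))) ∧
    Tendsto (fun q : ℝ => Amoeba.diskOffset q / q) (𝓝[≠] (0 : ℝ)) (𝓝 (Real.pi / 2)) ∧
    -- quadratic bias: rank `p / 2 + r p ^ 2`
    (∀ r : ℝ → ℝ, Tendsto (fun ρ : ℝ => r ρ * ρ ^ 2) (𝓝[>] (0 : ℝ)) (𝓝 0) →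
      Amoeba.ApproximatesForce Ω f u x₀ χ α (fun ρ p => r ρ * p ^ 2)
        (fun ρ => 3 * Real.pi ^ 2 * ρ * r ρ)
        (Amoeba.quadraticForce ‖gradient u x₀‖ ‖gradient f x₀‖ α)) ∧
    -- the force terms in the rotationally symmetric case
    (∀ z : Amoeba.Plane, Amoeba.RotSymmetricAbout Ω z f → Amoeba.RotSymmetricAbout Ω z u →
      Amoeba.offsetForce ‖gradient u x₀‖ ‖gradient f x₀‖ α = ‖gradient u x₀‖ ∧
      Amoeba.edgeStop ‖gradient f x₀‖ * ‖gradient u x₀‖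
        ≤ Amoeba.quantileForce ‖gradient u x₀‖ ‖gradient f x₀‖ α ∧
      Amoeba.quantileForce ‖gradient u x₀‖ ‖gradient f x₀‖ α ≤ ‖gradient u x₀‖ ∧
      Amoeba.quadraticForce ‖gradient u x₀‖ ‖gradient f x₀‖ α
        = Amoeba.edgeStop ‖gradient f x₀‖ * ‖gradient u x₀‖) := by
  obtain ⟨T, K, A, U, h⟩ := Amoeba.exists_rescaled hf hu hx₀ hgrad hχ hfχ huα
  have hΩ : Ω ∈ 𝓝 x₀ := mem_interior_iff_mem_nhds.1 hx₀
  refine ⟨fun b hb => h.offset hb, fun q hq => h.quantile hq, fun q hq => h.quantile_const hq,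
    Amoeba.tendsto_diskOffset_div, fun r hr => h.quadratic hr, fun z hfz huz => ?_⟩
  exact Amoeba.forces_of_mul_sin_eq_zero (norm_nonneg _)
    (Amoeba.norm_mul_sin_eq_zero hΩ ((hf.contDiffAt hΩ).differentiableAt (by simp))
      ((hu.contDiffAt hΩ).differentiableAt (by simp)) hgrad hχ hfχ huα hfz huz)
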